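/- Let $k$ be a field. Superspaces are $\mathbb{Z}/2$-graded $k$-vector spaces, $\bar v$ is the parity of a homogeneous element $v$; formulas involving parities are stated for homogeneous elements and extended linearly. Let $A$ be a unital associative superalgebra over $k$ with an anti-involution $\star$: a parity-preserving $k$-linear map with $(a^\star)^\star=a$ and $(ab)^\star=(-1)^{\bar a\bar b}b^\star a^\star$. Let $V$ be a finite-dimensional right $A$-supermodule, $\nu\in\{1,-1\}\subset k$, $\sigma\in\mathbb{Z}/2$, and let $\Phi\colon V\times V\to k$ be a nondegenerate $(\nu,\star)$-supersymmetric form of parity $\sigma$: a nondegenerate $k$-bilinear form with $\Phi(v,w)=0$ unless $\bar v+\bar w=\sigma$, $\Phi(v,w)=\nu(-1)^{\bar v\bar w}\Phi(w,v)$ and $\Phi(va,w)=(-1)^{\bar a\bar w}\Phi(v,wa^\star)$. *Diagram category.* In a monoidal supercategory composition is parity-preserving and $(f'\otimes g')\circ(f\otimes g)=(-1)^{\bar f\,\bar g'}(f'\circ f)\otimes(g'\circ g)$. Let $\mathcal{B}^\sigma_k(A,\star)$ be the strict $k$-linear monoidal supercategory generated by one object $\mathsf{I}$ and morphisms $X\colon\mathsf{I}^{\otimes2}\to\mathsf{I}^{\otimes2}$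 (crossing, even), $\cap\colon\mathsf{I}^{\otimes2}\to\mathbf{1}$ and $\cup\colon\mathbf{1}\to\mathsf{I}^{\otimes2}$ (cap and cup, of parity $\sigma$), and $t_a\colon\mathsf{I}\to\mathsf{I}$, $a\in A$ (tokens, of parity $\bar a$), subject to the following relations, where $1=1_{\mathsf I}$: $$X\circ X=1\otimes 1,\quad (X\otimes1)(1\otimes X)(X\otimes1)=(1\otimes X)(X\otimes1)(1\otimes X),$$ $$(1\otimes\cap)(\cup\otimes1)=1=(-1)^\sigma(\cap\otimes1)(1\otimes\cup),\quad \cap\circ X=\cap,\quad (1\otimes\cap)(X\otimes1)=(\cap\otimes1)(1\otimes X),$$ $$t_1=1,\quad t_{\lambda a+\mu b}=\lambda t_a+\mu t_b,\quad t_a\circ t_b=t_{ab},\quad X(t_a\otimes1)=(1\otimes t_a)X,\quad \cap(t_a\otimes1)=\cap(1\otimes t_{a^\star}).$$ The bubble is $\beta_a=\cap\circ(1\otimes t_a)\circ\cup$. For $d\in k$, let $\mathcal{B}^\sigma_k(A,\star;d)$ be the quotient of $\mathcal{B}^\sigma_k(A,\star)$ by the relations $\beta_a=d\,\mathrm{str}_A(a)1_{\mathbf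 1}$, $a\in A$. Here, for a right $A$-supermodule $W$, finite-dimensional over $k$, with homogeneous basis $\mathbf{B}_W$ and dual basis $\{w^*\}$, $\mathrm{str}_W(a)=\sum_{w\in\mathbf{B}_W}(-1)^{\bar w}w^*(wa)$, and in $\mathrm{str}_A$ the superalgebra $A$ is regarded as a right supermodule over itself. (This quotient is used below only when either $A$ is finite-dimensional or $d=0$; in the latter case the relations are $\beta_a=0$.) *Supergroup.* Let $G(\Phi)=(G_{\mathrm{rd}}(\Phi),\mathfrak{g}(\Phi))$ be the following Harish-Chandra superpair. $G_{\mathrm{rd}}(\Phi)$ is the algebraic group over $k$ whose points, over a commutative $k$-algebra $R$, are the even $A$-linear automorphisms $g$ of $R\otimes V$ over $R$ with $\Phi(gv,gw)=\Phi(v,w)$ (for the $R$-bilinear extension of $\Phi$). $\mathfrak{g}(\Phi)$ is the Lie superalgebra, under the supercommutator, of the $A$-linear endomorphisms $Y$ of $V$ with $\Phi(Yv,w)=-(-1)^{\bar Y\bar v}\Phi(v,Yw)$. Let $G(\Phi)\text{-smod}_k$ be the monoidal supercategory of finite-dimensional $G(\Phi)$-supermodules: finite-dimensional superspaces $W$ with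 an algebraic action of $G_{\mathrm{rd}}(\Phi)$ by even automorphisms and an action of the Lie superalgebra $\mathfrak{g}(\Phi)$, such that the differential of the action of $G_{\mathrm{rd}}(\Phi)$ is the action of $\mathfrak{g}(\Phi)_0$. Its morphisms are the sums of homogeneous $k$-linear maps $f$ that commute with $G_{\mathrm{rd}}(\Phi)$ and satisfy $f(Yw)=(-1)^{\bar f\bar Y}Yf(w)$ for $Y\in\mathfrak{g}(\Phi)$; the tensor product is $\otimes_k$, with $(f\otimes g)(v\otimes w)=(-1)^{\bar g\bar v}f(v)\otimes g(w)$. Let $\rho_a\colon V\to V$, $v\mapsto(-1)^{\bar a\bar v}va$, and $\mathrm{flip}\colon V\otimes V\to V\otimes V$, $v\otimes w\mapsto(-1)^{\bar v\bar w}w\otimes v$. **Theorem.** There is a (not necessarily strict) monoidal superfunctor $\mathsf{F}_\Phi\colon\mathcal{B}^\sigma_k(A,\star)\to G(\Phi)\text{-smod}_k$ such that $\mathsf{F}_\Phi(\mathsf I)=V$ and, under the structural identifications $\mathsf{F}_\Phi(\mathsf I^{\otimes 2})\cong V\otimes V$ and $\mathsf{F}_\Phi(\mathbf 1)\cong k$,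 $$\mathsf{F}_\Phi(X)=\nu\,\mathrm{flip},\qquad \mathsf{F}_\Phi(\cap)=\Phi,\qquad \mathsf{F}_\Phi(t_a)=\rho_{a^\star}\quad(a\in A).$$ It is unique: if $(\mathsf F,e)$ and $(\mathsf F',e')$ are two monoidal superfunctors with even isomorphisms $e\colon\mathsf F(\mathsf I)\cong V$ and $e'\colon\mathsf F'(\mathsf I)\cong V$ that satisfy these equations (after transport along $e$ and $e'$), then there is exactly one even monoidal natural isomorphism $\eta\colon\mathsf F\to\mathsf F'$ with $e'\circ\eta_{\mathsf I}=e$. Moreover, every such $\mathsf F$ has the following properties. 1. For every homogeneous $k$-basis $\mathbf B_V$ of $V$, with left dual basis $\{v^\vee\}$ determined by $\Phi(v^\vee,w)=\delta_{vw}$ for $v,w\in\mathbf B_V$, the cup is sent to the map $k\to V\otimes V$, $1\mapsto\sum_{v\in\mathbf B_V}(-1)^{\sigma\bar v}v\otimes v^\vee$. 2. $\mathsf F(\beta_a)=\nu\,\mathrm{str}_V(a)\,1$ for all $a\in A$. 3. If $V\cong A^{m|n}$ as right $A$-supermodules (by an even isomorphism) for some $m,n\in\mathbb N$, where $A^{m|n}$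 is the sum of $m$ copies of $A$ and $n$ copies of $A$ with the parity reversed, then $\mathsf F$ factors, in a unique way, through the quotient superfunctor $\mathcal{B}^\sigma_k(A,\star)\to\mathcal{B}^\sigma_k(A,\star;\nu(m-n))$ as a monoidal superfunctor $\mathcal{B}^\sigma_k(A,\star;\nu(m-n))\to G(\Phi)\text{-smod}_k$. -/

import Mathlib

open scoped TensorProduct
open CategoryTheory

universe u w

/-! ### Superspaces -/

section Superspaces

variable {k : Type*} [Field k]

/-- The Koszul sign `(-1)^{rs}` in `k`, for parities `r` and `s`. -/
def koszul (k : Type*) [Field k] (r s : ZMod 2) : k := (-1) ^ (r.val * s.val)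

theorem zmod_two_cases : ∀ r : ZMod 2, r = 0 ∨ r = 1 := by decide

theorem sum_zmod_two {M : Type*} [AddCommMonoid M] (f : ZMod 2 → M) :
    ∑ r : ZMod 2, f r = f 0 + f 1 := Fin.sum_univ_two f

@[simp] theorem koszul_zero_left (r : ZMod 2) : koszul k 0 r = 1 := by simp [koszul]

@[simp] theorem koszul_zero_right (r : ZMod 2) : koszul k r 0 = 1 := by simp [koszul]

@[simp] theorem koszul_one_one : koszul k 1 1 = -1 := by simp [koszul, ZMod.val_one]

theorem koszul_comm (r s : ZMod 2) : koszul k r s = koszul k s r := by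
  simp [koszul, mul_comm]

theorem koszul_add_left (r s t : ZMod 2) : koszul k (r + s) t = koszul k r t * koszul k s t := by
  obtain rfl | rfl := zmod_two_cases r <;> obtain rfl | rfl := zmod_two_cases s <;>
    obtain rfl | rfl := zmod_two_cases t <;> simp [(by decide : (1 : ZMod 2) + 1 = 0)]

theorem koszul_add_right (r s t : ZMod 2) :
    koszul k r (s + t) = koszul k r s * koszul k r t := by
  rw [koszul_comm, koszul_add_left, koszul_comm s, koszul_comm t]

theorem koszul_mul_self (r s : ZMod 2) : koszul k r s * koszul k r s = 1 := by
  simp [koszul, ← mul_pow]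

/-- A superspace: a vector space `V` with `V = V₀ ⊕ V₁`. -/
class IsSuperspace {V : Type*} [AddCommGroup V] [Module k V]
    (𝒱 : ZMod 2 → Submodule k V) : Prop where
  isCompl : IsCompl (𝒱 0) (𝒱 1)

variable {V W U V' W' : Type*}
  [AddCommGroup V] [Module k V] [AddCommGroup W] [Module k W] [AddCommGroup U] [Module k U]
  [AddCommGroup V'] [Module k V'] [AddCommGroup W'] [Module k W']

theorem IsSuperspace.isCompl_add_one (𝒱 : ZMod 2 → Submodule k V) [h : IsSuperspace 𝒱]
    (r : ZMod 2) : IsCompl (𝒱 r) (𝒱 (r + 1)) := by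
  fin_cases r
  · exact h.isCompl
  · exact h.isCompl.symm

/-- The projection of `V` onto its homogeneous part of parity `r`. -/
noncomputable def parityProj (𝒱 : ZMod 2 → Submodule k V) [IsSuperspace 𝒱] (r : ZMod 2) :
    V →ₗ[k] V :=
  (𝒱 r).projection (𝒱 (r + 1)) (IsSuperspace.isCompl_add_one 𝒱 r)

/-- The linear map `v ↦ (-1)^{v̄} v`. -/
noncomputable def parityInv (𝒱 : ZMod 2 → Submodule k V) [IsSuperspace 𝒱] : V →ₗ[k] V :=
  parityProj 𝒱 0 - parityProj 𝒱 1

/-- The linear maps `V → W` that are homogeneous of parity `p`. -/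
def homParity (𝒱 : ZMod 2 → Submodule k V) (𝒲 : ZMod 2 → Submodule k W) (p : ZMod 2) :
    Submodule k (V →ₗ[k] W) where
  carrier := {f | ∀ r, ∀ v ∈ 𝒱 r, f v ∈ 𝒲 (r + p)}
  add_mem' hf hg r v hv := add_mem (hf r v hv) (hg r v hv)
  zero_mem' _ _ _ := zero_mem _
  smul_mem' c _ hf r v hv := Submodule.smul_mem _ c (hf r v hv)

/-- The homogeneous component of parity `p` of a linear map. -/
noncomputable def homComponent (𝒱 : ZMod 2 → Submodule k V) [IsSuperspace 𝒱]
    (𝒲 : ZMod 2 → Submodule k W) [IsSuperspace 𝒲] (p : ZMod 2) (f : V →ₗ[k] W) : V →ₗ[k] W :=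
  ∑ r : ZMod 2, parityProj 𝒲 (r + p) ∘ₗ f ∘ₗ parityProj 𝒱 r

/-- The grading of the tensor product of two superspaces:
`(V ⊗ W)_r = ⊕_s V_s ⊗ W_{r-s}`. -/
def tensorGrading (𝒱 : ZMod 2 → Submodule k V) (𝒲 : ZMod 2 → Submodule k W) (r : ZMod 2) :
    Submodule k (V ⊗[k] W) :=
  ⨆ s : ZMod 2, Submodule.map₂ (TensorProduct.mk k V W) (𝒱 s) (𝒲 (r - s))

/-- The grading of the ground field, which is purely even. -/
def unitGrading (k : Type*) [Field k] (r : ZMod 2) : Submodule k k := if r = 0 then ⊤ else ⊥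

/-- The tensor product of (not necessarily parity-preserving) linear maps `f` and `g`, with
`(f ⊗ g)(v ⊗ w) = (-1)^{ḡ v̄} f(v) ⊗ g(w)`; bilinear in `f` and `g`. -/
noncomputable def superTensor (𝒱 : ZMod 2 → Submodule k V) [IsSuperspace 𝒱]
    (𝒲 : ZMod 2 → Submodule k W) [IsSuperspace 𝒲]
    (𝒲' : ZMod 2 → Submodule k W') [IsSuperspace 𝒲']
    (f : V →ₗ[k] V') (g : W →ₗ[k] W') : V ⊗[k] W →ₗ[k] V' ⊗[k] W' :=
  TensorProduct.map f (homComponent 𝒲 𝒲' 0 g) +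
    TensorProduct.map (f ∘ₗ parityInv 𝒱) (homComponent 𝒲 𝒲' 1 g)

/-- The flip `v ⊗ w ↦ (-1)^{v̄ w̄} w ⊗ v`. -/
noncomputable def superFlip (𝒱 : ZMod 2 → Submodule k V) [IsSuperspace 𝒱]
    (𝒲 : ZMod 2 → Submodule k W) [IsSuperspace 𝒲] : V ⊗[k] W →ₗ[k] W ⊗[k] V :=
  ∑ r : ZMod 2, ∑ s : ZMod 2, koszul k r s •
    (TensorProduct.comm k V W).toLinearMap ∘ₗ
      TensorProduct.map (parityProj 𝒱 r) (parityProj 𝒲 s)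

theorem parityProj_mem (𝒱 : ZMod 2 → Submodule k V) [IsSuperspace 𝒱] (r : ZMod 2) (v : V) :
    parityProj 𝒱 r v ∈ 𝒱 r :=
  Submodule.projection_apply_mem _ _

theorem parityProj_same (𝒱 : ZMod 2 → Submodule k V) [IsSuperspace 𝒱] {r : ZMod 2} {v : V}
    (hv : v ∈ 𝒱 r) : parityProj 𝒱 r v = v :=
  Submodule.projection_apply_of_mem_left _ hv

theorem parityProj_ne (𝒱 : ZMod 2 → Submodule k V) [IsSuperspace 𝒱] {r s : ZMod 2} {v : V}
    (hv : v ∈ 𝒱 s) (h : s ≠ r) : parityProj 𝒱 r v = 0 := by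
  obtain rfl : s = r + 1 := (by decide : ∀ s r : ZMod 2, s ≠ r → s = r + 1) s r h
  exact Submodule.projection_apply_of_mem_right _ hv

theorem parityProj_add (𝒱 : ZMod 2 → Submodule k V) [h : IsSuperspace 𝒱] (v : V) :
    parityProj 𝒱 0 v + parityProj 𝒱 1 v = v := by
  obtain ⟨a, ha, b, hb, rfl⟩ : ∃ a ∈ 𝒱 0, ∃ b ∈ 𝒱 1, a + b = v := by
    have := h.isCompl.sup_eq_top ▸ Submodule.mem_top (x := v)
    exact Submodule.mem_sup.1 this
  simp [parityProj_same 𝒱 ha, parityProj_same 𝒱 hb, parityProj_ne 𝒱 ha, parityProj_ne 𝒱 hb]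

theorem parityInv_apply (𝒱 : ZMod 2 → Submodule k V) [IsSuperspace 𝒱] {r : ZMod 2} {v : V}
    (hv : v ∈ 𝒱 r) : parityInv 𝒱 v = koszul k r 1 • v := by
  obtain rfl | rfl := zmod_two_cases r
  · simp [parityInv, parityProj_same 𝒱 hv, parityProj_ne 𝒱 hv (r := 1)]
  · simp [parityInv, parityProj_same 𝒱 hv, parityProj_ne 𝒱 hv (r := 0)]

theorem homComponent_apply (𝒱 : ZMod 2 → Submodule k V) [IsSuperspace 𝒱]
    (𝒲 : ZMod 2 → Submodule k W) [IsSuperspace 𝒲] (p : ZMod 2) (f : V →ₗ[k] W) {r : ZMod 2}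
    {v : V} (hv : v ∈ 𝒱 r) : homComponent 𝒱 𝒲 p f v = parityProj 𝒲 (r + p) (f v) := by
  simp only [homComponent, LinearMap.sum_apply, LinearMap.comp_apply]
  rw [Finset.sum_eq_single r]
  · rw [parityProj_same 𝒱 hv]
  · intro s _ hs
    rw [parityProj_ne 𝒱 hv hs.symm]; simp
  · simp

/-- Induction on homogeneous elements. -/
theorem super_induction (𝒱 : ZMod 2 → Submodule k V) [IsSuperspace 𝒱] {P : V → Prop}
    (hP : ∀ v w, P v → P w → P (v + w)) (h : ∀ r, ∀ v ∈ 𝒱 r, P v) (v : V) : P v := by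
  rw [← parityProj_add 𝒱 v]
  exact hP _ _ (h _ _ (parityProj_mem 𝒱 _ _)) (h _ _ (parityProj_mem 𝒱 _ _))

theorem super_ext (𝒱 : ZMod 2 → Submodule k V) [IsSuperspace 𝒱] {f g : V →ₗ[k] W}
    (h : ∀ r, ∀ v ∈ 𝒱 r, f v = g v) : f = g := by
  ext v
  exact super_induction 𝒱 (P := fun v => f v = g v)
    (fun v w hv hw => by simp [hv, hw]) h v

theorem super_ext₂ (𝒱 : ZMod 2 → Submodule k V) [IsSuperspace 𝒱]
    (𝒲 : ZMod 2 → Submodule k W) [IsSuperspace 𝒲] {f g : V ⊗[k] W →ₗ[k] U}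
    (h : ∀ r, ∀ v ∈ 𝒱 r, ∀ s, ∀ w ∈ 𝒲 s, f (v ⊗ₜ w) = g (v ⊗ₜ w)) : f = g := by
  apply TensorProduct.ext
  refine super_ext 𝒱 fun r v hv => super_ext 𝒲 fun s w hw => ?_
  simpa using h r v hv s w hw

theorem homComponent_same (𝒱 : ZMod 2 → Submodule k V) [IsSuperspace 𝒱]
    (𝒲 : ZMod 2 → Submodule k W) [IsSuperspace 𝒲] {p : ZMod 2} {f : V →ₗ[k] W}
    (hf : f ∈ homParity 𝒱 𝒲 p) : homComponent 𝒱 𝒲 p f = f :=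
  super_ext 𝒱 fun r v hv => by
    rw [homComponent_apply 𝒱 𝒲 p f hv, parityProj_same 𝒲 (hf r v hv)]

theorem homComponent_ne (𝒱 : ZMod 2 → Submodule k V) [IsSuperspace 𝒱]
    (𝒲 : ZMod 2 → Submodule k W) [IsSuperspace 𝒲] {p q : ZMod 2} {f : V →ₗ[k] W}
    (hf : f ∈ homParity 𝒱 𝒲 p) (h : p ≠ q) : homComponent 𝒱 𝒲 q f = 0 :=
  super_ext 𝒱 fun r v hv => by
    rw [homComponent_apply 𝒱 𝒲 q f hv, parityProj_ne 𝒲 (hf r v hv) (by simpa using h)]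
    rfl

theorem homParity_disjoint (𝒱 : ZMod 2 → Submodule k V) [IsSuperspace 𝒱]
    (𝒲 : ZMod 2 → Submodule k W) [IsSuperspace 𝒲] :
    Disjoint (homParity 𝒱 𝒲 0) (homParity 𝒱 𝒲 1) := by
  rw [Submodule.disjoint_def]
  intro f h0 h1
  rw [← homComponent_same 𝒱 𝒲 h0, homComponent_ne 𝒱 𝒲 h1 (by decide)]

theorem homParity_comp {𝒱 : ZMod 2 → Submodule k V} {𝒲 : ZMod 2 → Submodule k W}
    {𝒰 : ZMod 2 → Submodule k U} {p q : ZMod 2} {f : V →ₗ[k] W} {g : W →ₗ[k] U}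
    (hf : f ∈ homParity 𝒱 𝒲 p) (hg : g ∈ homParity 𝒲 𝒰 q) :
    g ∘ₗ f ∈ homParity 𝒱 𝒰 (p + q) := fun r v hv => by
  rw [← add_assoc]; exact hg _ _ (hf r v hv)

theorem homParity_id (𝒱 : ZMod 2 → Submodule k V) : LinearMap.id ∈ homParity 𝒱 𝒱 0 :=
  fun r v hv => by simpa using hv

theorem superTensor_apply (𝒱 : ZMod 2 → Submodule k V) [IsSuperspace 𝒱]
    (𝒲 : ZMod 2 → Submodule k W) [IsSuperspace 𝒲]
    (𝒲' : ZMod 2 → Submodule k W') [IsSuperspace 𝒲']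
    (f : V →ₗ[k] V') {g : W →ₗ[k] W'} {q s : ZMod 2} (hg : g ∈ homParity 𝒲 𝒲' q) {v : V}
    (hv : v ∈ 𝒱 s) (x : W) :
    superTensor 𝒱 𝒲 𝒲' f g (v ⊗ₜ x) = koszul k q s • (f v ⊗ₜ g x) := by
  obtain rfl | rfl := zmod_two_cases q
  · simp [superTensor, homComponent_same 𝒲 𝒲' hg, homComponent_ne 𝒲 𝒲' hg (q := 1)]
  · simp [superTensor, homComponent_same 𝒲 𝒲' hg, homComponent_ne 𝒲 𝒲' hg (q := 0),
      parityInv_apply 𝒱 hv, TensorProduct.smul_tmul', koszul_comm s]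

theorem tmul_mem_tensorGrading {𝒱 : ZMod 2 → Submodule k V} {𝒲 : ZMod 2 → Submodule k W}
    {r s : ZMod 2} {v : V} {x : W} (hv : v ∈ 𝒱 r) (hx : x ∈ 𝒲 s) :
    v ⊗ₜ x ∈ tensorGrading 𝒱 𝒲 (r + s) :=
  Submodule.mem_iSup_of_mem r (Submodule.apply_mem_map₂ _ hv (by simpa using hx))

/-- To check that a linear map on a tensor product is homogeneous, it is enough to look at pure
tensors of homogeneous elements. -/
theorem homParity_tensor {𝒱 : ZMod 2 → Submodule k V} {𝒲 : ZMod 2 → Submodule k W}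
    {𝒰 : ZMod 2 → Submodule k U} {p : ZMod 2} {f : V ⊗[k] W →ₗ[k] U}
    (h : ∀ r, ∀ v ∈ 𝒱 r, ∀ s, ∀ x ∈ 𝒲 s, f (v ⊗ₜ x) ∈ 𝒰 (r + s + p)) :
    f ∈ homParity (tensorGrading 𝒱 𝒲) 𝒰 p := by
  intro t z hz
  have : tensorGrading 𝒱 𝒲 t ≤ (𝒰 (t + p)).comap f := by
    refine iSup_le fun r => Submodule.map₂_le.2 fun v hv x hx => ?_
    have := h r v hv _ x hx
    rwa [add_sub_cancel] at this
  exact this hz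

instance tensorGrading_isSuperspace (𝒱 : ZMod 2 → Submodule k V) [IsSuperspace 𝒱]
    (𝒲 : ZMod 2 → Submodule k W) [IsSuperspace 𝒲] : IsSuperspace (tensorGrading 𝒱 𝒲) where
  isCompl := by
    constructor
    · let P : ZMod 2 → V ⊗[k] W →ₗ[k] V ⊗[k] W := fun t =>
        ∑ r : ZMod 2, TensorProduct.map (parityProj 𝒱 r) (parityProj 𝒲 (t - r))
      have key : ∀ t t', ∀ z ∈ tensorGrading 𝒱 𝒲 t', P t z = if t = t' then z else 0 := by
        intro t t' z hz
        have : tensorGrading 𝒱 𝒲 t' ≤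
            LinearMap.eqLocus (P t) (if t = t' then LinearMap.id else 0) := by
          refine iSup_le fun r => Submodule.map₂_le.2 fun v hv x hx => ?_
          simp only [LinearMap.mem_eqLocus, P, TensorProduct.mk_apply, LinearMap.sum_apply,
            TensorProduct.map_tmul]
          rw [Finset.sum_eq_single r]
          · rw [parityProj_same 𝒱 hv]
            split_ifs with h
            · subst h; rw [parityProj_same 𝒲 hx]; simp
            · rw [parityProj_ne 𝒲 hx (by simpa using Ne.symm h)]; simp
          · intro s _ hs
            rw [parityProj_ne 𝒱 hv hs.symm]; simp
          · simp
        have h2 := this hz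
        rw [LinearMap.mem_eqLocus] at h2
        rw [h2]; split_ifs <;> simp
      rw [Submodule.disjoint_def]
      intro z h0 h1
      have a := key 0 0 z h0
      have b := key 0 1 z h1
      simp at a b
      rw [← a, b]
    · rw [codisjoint_iff, eq_top_iff]
      rintro z -
      induction z with
      | zero => exact zero_mem _
      | add x y hx hy => exact add_mem hx hy
      | tmul v x =>
        refine super_induction 𝒱
          (P := fun v => v ⊗ₜ x ∈ tensorGrading 𝒱 𝒲 0 ⊔ tensorGrading 𝒱 𝒲 1)
          (fun v w hv hw => by rw [TensorProduct.add_tmul]; exact add_mem hv hw) ?_ v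
        intro r v hv
        refine super_induction 𝒲
          (P := fun x => v ⊗ₜ x ∈ tensorGrading 𝒱 𝒲 0 ⊔ tensorGrading 𝒱 𝒲 1)
          (fun v w hv hw => by rw [TensorProduct.tmul_add]; exact add_mem hv hw) ?_ x
        intro s x hx
        have := tmul_mem_tensorGrading hv hx
        obtain h | h := zmod_two_cases (r + s)
        · rw [h] at this; exact Submodule.mem_sup_left this
        · rw [h] at this; exact Submodule.mem_sup_right this

instance unitGrading_isSuperspace (k : Type*) [Field k] : IsSuperspace (unitGrading k) where
  isCompl := by simpa [unitGrading] using isCompl_top_bot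

end Superspaces

/-! ### Monoidal supercategories -/

section Supercategories

/-- A supercategory: a `k`-linear category whose morphism spaces are superspaces, with
parity-preserving composition. -/
class Supercategory (k : Type*) [Field k] (C : Type*) [Category C] [Preadditive C]
    [Linear k C] where
  /-- The homogeneous parts of the morphism spaces. -/
  homPart (X Y : C) : ZMod 2 → Submodule k (X ⟶ Y)
  isSuperspace (X Y : C) : IsSuperspace (homPart X Y)
  id_mem (X : C) : 𝟙 X ∈ homPart X X 0
  comp_mem {X Y Z : C} {p q : ZMod 2} {f : X ⟶ Y} {g : Y ⟶ Z} :
    f ∈ homPart X Y p → g ∈ homPart Y Z q → f ≫ g ∈ homPart X Z (p + q)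

open Supercategory

/-- A monoidal supercategory. The tensor product is a superbifunctor, so that it obeys the super
interchange law; the structural isomorphisms are even. -/
class MonoidalSupercategory (k : Type*) [Field k] (C : Type*) [Category C] [Preadditive C]
    [Linear k C] [Supercategory k C] where
  /-- The unit object. -/
  unit : C
  /-- The tensor product of objects. -/
  tensorObj : C → C → C
  /-- The tensor product of morphisms. -/
  tensorHom {X Y X' Y' : C} :
    (X ⟶ Y) →ₗ[k] (X' ⟶ Y') →ₗ[k] (tensorObj X X' ⟶ tensorObj Y Y')
  tensorHom_mem {X Y X' Y' : C} {p q : ZMod 2} {f : X ⟶ Y} {g : X' ⟶ Y'} :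
    f ∈ homPart (k := k) X Y p → g ∈ homPart (k := k) X' Y' q →
      tensorHom f g ∈ homPart (k := k) (tensorObj X X') (tensorObj Y Y') (p + q)
  tensorHom_id (X Y : C) : tensorHom (𝟙 X) (𝟙 Y) = 𝟙 (tensorObj X Y)
  interchange {X Y Z X' Y' Z' : C} {p q : ZMod 2} {f : X ⟶ Y} (g : X' ⟶ Y') (f' : Y ⟶ Z)
    {g' : Y' ⟶ Z'} : f ∈ homPart (k := k) X Y p → g' ∈ homPart (k := k) Y' Z' q →
      tensorHom f g ≫ tensorHom f' g' = koszul k p q • tensorHom (f ≫ f') (g ≫ g')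
  /-- The associator. -/
  assocIso (X Y Z : C) : tensorObj (tensorObj X Y) Z ≅ tensorObj X (tensorObj Y Z)
  /-- The left unitor. -/
  leftUnitor (X : C) : tensorObj unit X ≅ X
  /-- The right unitor. -/
  rightUnitor (X : C) : tensorObj X unit ≅ X
  associator_mem (X Y Z : C) : (assocIso X Y Z).hom ∈ homPart (k := k) _ _ 0
  leftUnitor_mem (X : C) : (leftUnitor X).hom ∈ homPart (k := k) _ _ 0
  rightUnitor_mem (X : C) : (rightUnitor X).hom ∈ homPart (k := k) _ _ 0
  associator_naturality {X Y Z X' Y' Z' : C} (f : X ⟶ X') (g : Y ⟶ Y') (h : Z ⟶ Z') :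
    tensorHom (tensorHom f g) h ≫ (assocIso X' Y' Z').hom =
      (assocIso X Y Z).hom ≫ tensorHom f (tensorHom g h)
  leftUnitor_naturality {X Y : C} (f : X ⟶ Y) :
    tensorHom (𝟙 unit) f ≫ (leftUnitor Y).hom = (leftUnitor X).hom ≫ f
  rightUnitor_naturality {X Y : C} (f : X ⟶ Y) :
    tensorHom f (𝟙 unit) ≫ (rightUnitor Y).hom = (rightUnitor X).hom ≫ f
  pentagon (W X Y Z : C) :
    tensorHom (assocIso W X Y).hom (𝟙 Z) ≫ (assocIso W (tensorObj X Y) Z).hom ≫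
        tensorHom (𝟙 W) (assocIso X Y Z).hom =
      (assocIso (tensorObj W X) Y Z).hom ≫ (assocIso W X (tensorObj Y Z)).hom
  triangle (X Y : C) :
    (assocIso X unit Y).hom ≫ tensorHom (𝟙 X) (leftUnitor Y).hom =
      tensorHom (rightUnitor X).hom (𝟙 Y)

open MonoidalSupercategory

variable (k : Type*) [Field k]
  (C : Type*) [Category C] [Preadditive C] [Linear k C] [Supercategory k C]
  [MonoidalSupercategory k C]
  (D : Type*) [Category D] [Preadditive D] [Linear k D] [Supercategory k D]
  [MonoidalSupercategory k D]
  (E : Type*) [Category E] [Preadditive E] [Linear k E] [Supercategory k E]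
  [MonoidalSupercategory k E]

/-- A (not necessarily strict) monoidal superfunctor. -/
structure MonoidalSuperfunctor extends C ⥤ D where
  map_add {X Y : C} (f g : X ⟶ Y) : map (f + g) = map f + map g
  map_smul {X Y : C} (c : k) (f : X ⟶ Y) : map (c • f) = c • map f
  map_mem {X Y : C} {p : ZMod 2} {f : X ⟶ Y} :
    f ∈ homPart (k := k) X Y p → map f ∈ homPart (k := k) (obj X) (obj Y) p
  /-- The unit constraint. -/
  ε : unit k (C := D) ≅ obj (unit k)
  /-- The tensor constraint. -/
  μ (X Y : C) : tensorObj k (obj X) (obj Y) ≅ obj (tensorObj k X Y)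
  ε_mem : ε.hom ∈ homPart (k := k) _ _ 0
  μ_mem (X Y : C) : (μ X Y).hom ∈ homPart (k := k) _ _ 0
  μ_naturality {X Y X' Y' : C} (f : X ⟶ Y) (g : X' ⟶ Y') :
    tensorHom (k := k) (map f) (map g) ≫ (μ Y Y').hom =
      (μ X X').hom ≫ map (tensorHom (k := k) f g)
  associativity (X Y Z : C) :
    tensorHom (k := k) (μ X Y).hom (𝟙 (obj Z)) ≫ (μ (tensorObj k X Y) Z).hom ≫
        map (assocIso (k := k) X Y Z).hom =
      (assocIso (k := k) (obj X) (obj Y) (obj Z)).hom ≫ tensorHom (k := k) (𝟙 (obj X)) (μ Y Z).hom ≫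
        (μ X (tensorObj k Y Z)).hom
  left_unitality (X : C) :
    (leftUnitor (k := k) (obj X)).hom =
      tensorHom (k := k) ε.hom (𝟙 (obj X)) ≫ (μ (unit k) X).hom ≫ map (leftUnitor (k := k) X).hom
  right_unitality (X : C) :
    (rightUnitor (k := k) (obj X)).hom =
      tensorHom (k := k) (𝟙 (obj X)) ε.hom ≫ (μ X (unit k)).hom ≫ map (rightUnitor (k := k) X).hom

variable {k C D E}

/-- An even monoidal natural isomorphism between monoidal superfunctors. -/
structure MonoidalSuperNatIso (F G : MonoidalSuperfunctor k C D) where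
  /-- The components. -/
  app (X : C) : F.obj X ≅ G.obj X
  app_mem (X : C) : (app X).hom ∈ homPart (k := k) _ _ 0
  naturality {X Y : C} (f : X ⟶ Y) : F.map f ≫ (app Y).hom = (app X).hom ≫ G.map f
  unit : F.ε.hom ≫ (app (MonoidalSupercategory.unit k)).hom = G.ε.hom
  tensor (X Y : C) :
    (F.μ X Y).hom ≫ (app (tensorObj k X Y)).hom =
      tensorHom (k := k) (app X).hom (app Y).hom ≫ (G.μ X Y).hom

theorem tensorHom_comp_id {X Y Z : C} (W : C) {f : X ⟶ Y} {p : ZMod 2} (g : Y ⟶ Z)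
    (hf : f ∈ homPart (k := k) X Y p) :
    tensorHom (k := k) (f ≫ g) (𝟙 W) = tensorHom (k := k) f (𝟙 W) ≫ tensorHom (k := k) g (𝟙 W) := by
  rw [interchange (𝟙 W) g hf (id_mem (k := k) W)]; simp

theorem tensorHom_id_comp {X Y Z : C} (W : C) (f : X ⟶ Y) {g : Y ⟶ Z} {p : ZMod 2}
    (hg : g ∈ homPart (k := k) Y Z p) :
    tensorHom (k := k) (𝟙 W) (f ≫ g) = tensorHom (k := k) (𝟙 W) f ≫ tensorHom (k := k) (𝟙 W) g := by
  rw [interchange f (𝟙 W) (id_mem (k := k) W) hg]; simp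

/-- The composite of two monoidal superfunctors: first `F`, then `G`. -/
def MonoidalSuperfunctor.comp (F : MonoidalSuperfunctor k C D) (G : MonoidalSuperfunctor k D E) :
    MonoidalSuperfunctor k C E where
  toFunctor := F.toFunctor ⋙ G.toFunctor
  map_add f g := by simp [F.map_add, G.map_add]
  map_smul c f := by simp [F.map_smul, G.map_smul]
  map_mem hf := G.map_mem (F.map_mem hf)
  ε := G.ε ≪≫ G.mapIso F.ε
  μ X Y := G.μ (F.obj X) (F.obj Y) ≪≫ G.mapIso (F.μ X Y)
  ε_mem := comp_mem (k := k) (p := 0) (q := 0) G.ε_mem (G.map_mem F.ε_mem)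
  μ_mem X Y := comp_mem (k := k) (p := 0) (q := 0) (G.μ_mem _ _) (G.map_mem (F.μ_mem X Y))
  μ_naturality f g := by
    simp only [Functor.comp_map, Iso.trans_hom, Functor.mapIso_hom]
    rw [← Category.assoc, G.μ_naturality, Category.assoc, Category.assoc, ← G.map_comp,
      F.μ_naturality, G.map_comp]
  associativity X Y Z := by
    simp only [Functor.comp_map, Functor.comp_obj, Iso.trans_hom, Functor.mapIso_hom]
    rw [tensorHom_comp_id _ _ (G.μ_mem _ _), tensorHom_id_comp _ _ (G.map_mem (F.μ_mem Y Z))]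
    have h1 := G.μ_naturality (F.μ X Y).hom (𝟙 (F.obj Z))
    have h2 := G.μ_naturality (𝟙 (F.obj X)) (F.μ Y Z).hom
    rw [G.map_id] at h1 h2
    simp only [Category.assoc]
    rw [reassoc_of% h1, reassoc_of% h2, ← G.map_comp, ← G.map_comp, F.associativity]
    simp only [G.map_comp]
    have h3 := G.associativity (F.obj X) (F.obj Y) (F.obj Z)
    rw [reassoc_of% h3]
  left_unitality X := by
    simp only [Functor.comp_map, Functor.comp_obj, Iso.trans_hom, Functor.mapIso_hom]
    rw [tensorHom_comp_id _ _ G.ε_mem]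
    have h1 := G.μ_naturality F.ε.hom (𝟙 (F.obj X))
    rw [G.map_id] at h1
    simp only [Category.assoc]
    rw [reassoc_of% h1, ← G.map_comp, ← G.map_comp, ← F.left_unitality, G.left_unitality]
  right_unitality X := by
    simp only [Functor.comp_map, Functor.comp_obj, Iso.trans_hom, Functor.mapIso_hom]
    rw [tensorHom_id_comp _ _ (G.map_mem F.ε_mem)]
    have h1 := G.μ_naturality (𝟙 (F.obj X)) F.ε.hom
    rw [G.map_id] at h1
    simp only [Category.assoc]
    rw [reassoc_of% h1, ← G.map_comp, ← G.map_comp, ← F.right_unitality, G.right_unitality]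

end Supercategories

/-! ### The supergroup of a form and its supermodules -/

section Supergroup

section Aux

variable {k : Type*} [Field k] {V W U V' W' V'' W'' : Type*}
  [AddCommGroup V] [Module k V] [AddCommGroup W] [Module k W] [AddCommGroup U] [Module k U]
  [AddCommGroup V'] [Module k V'] [AddCommGroup W'] [Module k W']
  [AddCommGroup V''] [Module k V''] [AddCommGroup W''] [Module k W'']
  (𝒱 : ZMod 2 → Submodule k V) [IsSuperspace 𝒱]
  (𝒲 : ZMod 2 → Submodule k W) [IsSuperspace 𝒲]
  (𝒱' : ZMod 2 → Submodule k V')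
  (𝒲' : ZMod 2 → Submodule k W') [IsSuperspace 𝒲']
  (𝒲'' : ZMod 2 → Submodule k W'') [IsSuperspace 𝒲'']
  (𝒰 : ZMod 2 → Submodule k U) [IsSuperspace 𝒰]

theorem homComponent_map_add (p : ZMod 2) (f g : V →ₗ[k] W) :
    homComponent 𝒱 𝒲 p (f + g) = homComponent 𝒱 𝒲 p f + homComponent 𝒱 𝒲 p g := by
  simp only [homComponent, LinearMap.add_comp, LinearMap.comp_add, Finset.sum_add_distrib]

theorem homComponent_map_smul (p : ZMod 2) (c : k) (f : V →ₗ[k] W) :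
    homComponent 𝒱 𝒲 p (c • f) = c • homComponent 𝒱 𝒲 p f := by
  simp only [homComponent, LinearMap.smul_comp, LinearMap.comp_smul, Finset.smul_sum]

theorem superTensor_add_left (f f' : V →ₗ[k] V') (g : W →ₗ[k] W') :
    superTensor 𝒱 𝒲 𝒲' (f + f') g = superTensor 𝒱 𝒲 𝒲' f g + superTensor 𝒱 𝒲 𝒲' f' g := by
  simp only [superTensor, LinearMap.add_comp, TensorProduct.map_add_left]; abel

theorem superTensor_add_right (f : V →ₗ[k] V') (g g' : W →ₗ[k] W') :
    superTensor 𝒱 𝒲 𝒲' f (g + g') = superTensor 𝒱 𝒲 𝒲' f g + superTensor 𝒱 𝒲 𝒲' f g' := by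
  simp only [superTensor, homComponent_map_add, TensorProduct.map_add_right]; abel

theorem superTensor_smul_left (c : k) (f : V →ₗ[k] V') (g : W →ₗ[k] W') :
    superTensor 𝒱 𝒲 𝒲' (c • f) g = c • superTensor 𝒱 𝒲 𝒲' f g := by
  simp only [superTensor, LinearMap.smul_comp, TensorProduct.map_smul_left, smul_add]

theorem superTensor_smul_right (c : k) (f : V →ₗ[k] V') (g : W →ₗ[k] W') :
    superTensor 𝒱 𝒲 𝒲' f (c • g) = c • superTensor 𝒱 𝒲 𝒲' f g := by
  simp only [superTensor, homComponent_map_smul, TensorProduct.map_smul_right, smul_add]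

variable {𝒱 𝒲 𝒱' 𝒲' 𝒲'' 𝒰}

theorem superTensor_mem {p q : ZMod 2} {f : V →ₗ[k] V'} {g : W →ₗ[k] W'}
    (hf : f ∈ homParity 𝒱 𝒱' p) (hg : g ∈ homParity 𝒲 𝒲' q) :
    superTensor 𝒱 𝒲 𝒲' f g ∈ homParity (tensorGrading 𝒱 𝒲) (tensorGrading 𝒱' 𝒲') (p + q) := by
  refine homParity_tensor fun r v hv s x hx => ?_
  rw [superTensor_apply 𝒱 𝒲 𝒲' f hg hv x]
  have := tmul_mem_tensorGrading (hf r v hv) (hg s x hx)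
  rw [add_add_add_comm] at this
  exact Submodule.smul_mem _ _ this

theorem superTensor_comp [IsSuperspace 𝒱'] {p q q' : ZMod 2} {f : V →ₗ[k] V'} {g : W →ₗ[k] W'}
    (f' : V' →ₗ[k] V'') {g' : W' →ₗ[k] W''}
    (hf : f ∈ homParity 𝒱 𝒱' p) (hg : g ∈ homParity 𝒲 𝒲' q) (hg' : g' ∈ homParity 𝒲' 𝒲'' q') :
    superTensor 𝒱' 𝒲' 𝒲'' f' g' ∘ₗ superTensor 𝒱 𝒲 𝒲' f g =
      koszul k p q' • superTensor 𝒱 𝒲 𝒲'' (f' ∘ₗ f) (g' ∘ₗ g) := by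
  refine super_ext₂ 𝒱 𝒲 fun r v hv s x hx => ?_
  simp only [LinearMap.comp_apply, LinearMap.smul_apply]
  rw [superTensor_apply 𝒱 𝒲 𝒲' f hg hv x, superTensor_apply 𝒱 𝒲 𝒲'' _ (homParity_comp hg hg') hv,
    map_smul, superTensor_apply 𝒱' 𝒲' 𝒲'' _ hg' (hf r v hv)]
  simp only [LinearMap.comp_apply, smul_smul]
  congr 1
  rw [koszul_add_right, koszul_add_left, koszul_comm q' p]; ring

theorem superTensor_id :
    superTensor 𝒱 𝒲 𝒲 (LinearMap.id : V →ₗ[k] V) LinearMap.id = LinearMap.id := by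
  refine super_ext₂ 𝒱 𝒲 fun r v hv s x hx => ?_
  rw [superTensor_apply 𝒱 𝒲 𝒲 _ (homParity_id 𝒲) hv]; simp

/-- The sign operator `v ↦ (-1)^{r v̄} v`. -/
noncomputable def signMap (𝒱 : ZMod 2 → Submodule k V) [IsSuperspace 𝒱] (r : ZMod 2) :
    V →ₗ[k] V := parityProj 𝒱 0 + koszul k r 1 • parityProj 𝒱 1

theorem signMap_apply (r : ZMod 2) {s : ZMod 2} {v : V} (hv : v ∈ 𝒱 s) :
    signMap 𝒱 r v = koszul k r s • v := by
  obtain rfl | rfl := zmod_two_cases s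
  · simp [signMap, parityProj_same 𝒱 hv, parityProj_ne 𝒱 hv (r := 1)]
  · simp [signMap, parityProj_same 𝒱 hv, parityProj_ne 𝒱 hv (r := 0)]

theorem superTensor_eq_map {q : ZMod 2} (f : V →ₗ[k] V') {g : W →ₗ[k] W'}
    (hg : g ∈ homParity 𝒲 𝒲' q) :
    superTensor 𝒱 𝒲 𝒲' f g = TensorProduct.map (f ∘ₗ signMap 𝒱 q) g := by
  refine super_ext₂ 𝒱 𝒲 fun r v hv s x hx => ?_
  rw [superTensor_apply 𝒱 𝒲 𝒲' _ hg hv]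
  simp [signMap_apply q hv, TensorProduct.smul_tmul']

theorem signMap_zero : signMap 𝒱 0 = LinearMap.id := by
  ext v; simp [signMap, parityProj_add]

theorem superTensor_sub_left (f f' : V →ₗ[k] V') (g : W →ₗ[k] W') :
    superTensor 𝒱 𝒲 𝒲' (f - f') g = superTensor 𝒱 𝒲 𝒲' f g - superTensor 𝒱 𝒲 𝒲' f' g := by
  rw [eq_sub_iff_add_eq, ← superTensor_add_left, sub_add_cancel]

theorem superTensor_sub_right (f : V →ₗ[k] V') (g g' : W →ₗ[k] W') :
    superTensor 𝒱 𝒲 𝒲' f (g - g') = superTensor 𝒱 𝒲 𝒲' f g - superTensor 𝒱 𝒲 𝒲' f g' := by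
  rw [eq_sub_iff_add_eq, ← superTensor_add_right, sub_add_cancel]

theorem superTensor_bracket {r s : ZMod 2} {X Y : Module.End k V} {X' Y' : Module.End k W}
    (hX : X ∈ homParity 𝒱 𝒱 r) (hY : Y ∈ homParity 𝒱 𝒱 s)
    (hX' : X' ∈ homParity 𝒲 𝒲 r) (hY' : Y' ∈ homParity 𝒲 𝒲 s) :
    superTensor 𝒱 𝒲 𝒲 (X * Y - koszul k r s • (Y * X)) LinearMap.id +
        superTensor 𝒱 𝒲 𝒲 LinearMap.id (X' * Y' - koszul k r s • (Y' * X')) =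
      ((superTensor 𝒱 𝒲 𝒲 X LinearMap.id + superTensor 𝒱 𝒲 𝒲 LinearMap.id X') *
          (superTensor 𝒱 𝒲 𝒲 Y LinearMap.id + superTensor 𝒱 𝒲 𝒲 LinearMap.id Y') -
        koszul k r s •
          ((superTensor 𝒱 𝒲 𝒲 Y LinearMap.id + superTensor 𝒱 𝒲 𝒲 LinearMap.id Y') *
            (superTensor 𝒱 𝒲 𝒲 X LinearMap.id + superTensor 𝒱 𝒲 𝒲 LinearMap.id X')) :
        Module.End k (V ⊗[k] W)) := by
  have i1 := homParity_id 𝒱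
  have i2 := homParity_id 𝒲
  have i3 := superTensor_comp (f' := X) hY i2 i2
  have i4 := superTensor_comp (f' := X) i1 hY' i2
  have i5 := superTensor_comp (f' := LinearMap.id) hY i2 hX'
  have i6 := superTensor_comp (f' := LinearMap.id) i1 hY' hX'
  have j3 := superTensor_comp (f' := Y) hX i2 i2
  have j4 := superTensor_comp (f' := Y) i1 hX' i2
  have j5 := superTensor_comp (f' := LinearMap.id) hX i2 hY'
  have j6 := superTensor_comp (f' := LinearMap.id) i1 hX' hY'
  simp only [LinearMap.comp_id, LinearMap.id_comp, koszul_zero_left, koszul_zero_right, one_smul]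
    at i3 i4 i5 i6 j3 j4 j5 j6
  simp only [mul_add, add_mul, Module.End.mul_eq_comp, i3, i4, i5, i6, j3, j4, j5, j6,
    superTensor_sub_left, superTensor_sub_right, superTensor_smul_left, superTensor_smul_right,
    smul_add, smul_smul, koszul_mul_self, one_smul, koszul_comm s r]
  abel

theorem parityProj_tensor (r : ZMod 2) :
    parityProj (tensorGrading 𝒱 𝒲) r =
      ∑ s : ZMod 2, TensorProduct.map (parityProj 𝒱 s) (parityProj 𝒲 (r - s)) := by
  refine super_ext₂ 𝒱 𝒲 fun a v hv b x hx => ?_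
  simp only [LinearMap.sum_apply, TensorProduct.map_tmul]
  rw [Finset.sum_eq_single a]
  · rw [parityProj_same 𝒱 hv]
    by_cases h : b = r - a
    · subst h
      have := tmul_mem_tensorGrading hv hx
      rw [add_sub_cancel] at this
      rw [parityProj_same _ this, parityProj_same 𝒲 hx]
    · rw [parityProj_ne 𝒲 hx h, parityProj_ne _ (tmul_mem_tensorGrading hv hx)]
      · simp
      · rintro rfl; simp at h
  · intro s _ hs
    rw [parityProj_ne 𝒱 hv hs.symm]; simp
  · simp

theorem homComponent_mem (p : ZMod 2) (f : V →ₗ[k] W) :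
    homComponent 𝒱 𝒲 p f ∈ homParity 𝒱 𝒲 p := fun r v hv => by
  rw [homComponent_apply 𝒱 𝒲 p f hv]; exact parityProj_mem _ _ _

theorem homComponent_add (f : V →ₗ[k] W) :
    homComponent 𝒱 𝒲 0 f + homComponent 𝒱 𝒲 1 f = f :=
  super_ext 𝒱 fun r v hv => by
    rw [LinearMap.add_apply, homComponent_apply 𝒱 𝒲 _ f hv, homComponent_apply 𝒱 𝒲 _ f hv]
    obtain rfl | rfl := zmod_two_cases r
    · simpa using parityProj_add 𝒲 (f v)
    · rw [add_comm]; simpa [(by decide : (1 : ZMod 2) + 1 = 0)] using parityProj_add 𝒲 (f v)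

/-- Induction on homogeneous linear maps. -/
theorem hom_induction {P : (V →ₗ[k] W) → Prop} (hP : ∀ f g, P f → P g → P (f + g))
    (h : ∀ p, ∀ f ∈ homParity 𝒱 𝒲 p, P f) (f : V →ₗ[k] W) : P f := by
  rw [← homComponent_add (𝒱 := 𝒱) (𝒲 := 𝒲) f]
  exact hP _ _ (h _ _ (homComponent_mem _ _)) (h _ _ (homComponent_mem _ _))

theorem assoc_parity :
    (TensorProduct.assoc k V W U).toLinearMap ∈
      homParity (tensorGrading (tensorGrading 𝒱 𝒲) 𝒰) (tensorGrading 𝒱 (tensorGrading 𝒲 𝒰)) 0 := by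
  refine homParity_tensor fun r z hz s u hu => ?_
  have : (TensorProduct.assoc k V W U).toLinearMap ∘ₗ (TensorProduct.mk k (V ⊗[k] W) U).flip u ∈
      homParity (tensorGrading 𝒱 𝒲) (tensorGrading 𝒱 (tensorGrading 𝒲 𝒰)) s := by
    refine homParity_tensor fun a v hv b w hw => ?_
    have := tmul_mem_tensorGrading hv (tmul_mem_tensorGrading hw hu)
    rwa [← add_assoc] at this
  have := this r z hz
  rwa [add_zero]

theorem lid_parity :
    (TensorProduct.lid k V).toLinearMap ∈ homParity (tensorGrading (unitGrading k) 𝒱) 𝒱 0 := by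
  refine homParity_tensor fun r c hc s v hv => ?_
  obtain rfl | rfl := zmod_two_cases r
  · simpa using Submodule.smul_mem _ c hv
  · have : c = 0 := by simpa [unitGrading] using hc
    simp [this]

theorem rid_parity :
    (TensorProduct.rid k V).toLinearMap ∈ homParity (tensorGrading 𝒱 (unitGrading k)) 𝒱 0 := by
  refine homParity_tensor fun s v hv r c hc => ?_
  obtain rfl | rfl := zmod_two_cases r
  · simpa using Submodule.smul_mem _ c hv
  · have : c = 0 := by simpa [unitGrading] using hc
    simp [this]

theorem superTensor_assoc (𝒰' : ZMod 2 → Submodule k W'') [IsSuperspace 𝒰']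
    (f : V →ₗ[k] V') (g : W →ₗ[k] W') (h : U →ₗ[k] W'') :
    (TensorProduct.assoc k V' W' W'').toLinearMap ∘ₗ
        superTensor (tensorGrading 𝒱 𝒲) 𝒰 𝒰' (superTensor 𝒱 𝒲 𝒲' f g) h =
      superTensor 𝒱 (tensorGrading 𝒲 𝒰) (tensorGrading 𝒲' 𝒰') f (superTensor 𝒲 𝒰 𝒰' g h) ∘ₗ
        (TensorProduct.assoc k V W U).toLinearMap := by
  refine hom_induction (𝒱 := 𝒲) (𝒲 := 𝒲')
    (P := fun g => (TensorProduct.assoc k V' W' W'').toLinearMap ∘ₗ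
        superTensor (tensorGrading 𝒱 𝒲) 𝒰 𝒰' (superTensor 𝒱 𝒲 𝒲' f g) h =
      superTensor 𝒱 (tensorGrading 𝒲 𝒰) (tensorGrading 𝒲' 𝒰') f (superTensor 𝒲 𝒰 𝒰' g h) ∘ₗ
        (TensorProduct.assoc k V W U).toLinearMap) (fun a b ha hb => by
    rw [superTensor_add_right, superTensor_add_left, superTensor_add_left, superTensor_add_right,
      LinearMap.comp_add, LinearMap.add_comp, ha, hb]) (fun q g hg => ?_) g
  refine hom_induction (𝒱 := 𝒰) (𝒲 := 𝒰')
    (P := fun h => (TensorProduct.assoc k V' W' W'').toLinearMap ∘ₗ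
        superTensor (tensorGrading 𝒱 𝒲) 𝒰 𝒰' (superTensor 𝒱 𝒲 𝒲' f g) h =
      superTensor 𝒱 (tensorGrading 𝒲 𝒰) (tensorGrading 𝒲' 𝒰') f (superTensor 𝒲 𝒰 𝒰' g h) ∘ₗ
        (TensorProduct.assoc k V W U).toLinearMap) (fun a b ha hb => by
    rw [superTensor_add_right, superTensor_add_right, superTensor_add_right,
      LinearMap.comp_add, LinearMap.add_comp, ha, hb]) (fun p h hh => ?_) h
  apply TensorProduct.ext
  refine super_ext₂ 𝒱 𝒲 fun r v hv s w hw => LinearMap.ext fun u => ?_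
  simp only [LinearMap.compr₂ₛₗ_apply, TensorProduct.mk_apply, LinearMap.comp_apply,
    LinearEquiv.coe_coe, TensorProduct.assoc_tmul]
  rw [superTensor_apply _ _ _ _ hh (tmul_mem_tensorGrading hv hw), superTensor_apply _ _ _ _ hg hv,
    superTensor_apply _ _ _ _ (superTensor_mem hg hh) hv, superTensor_apply _ _ _ _ hh hw]
  simp only [← TensorProduct.smul_tmul', TensorProduct.tmul_smul, map_smul, smul_smul,
    TensorProduct.assoc_tmul, koszul_add_left, koszul_add_right]
  congr 1; ring

theorem superTensor_lid (f : V →ₗ[k] W) :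
    (TensorProduct.lid k W).toLinearMap ∘ₗ
        superTensor (unitGrading k) 𝒱 𝒲 (LinearMap.id : k →ₗ[k] k) f =
      f ∘ₗ (TensorProduct.lid k V).toLinearMap := by
  refine hom_induction (𝒱 := 𝒱) (𝒲 := 𝒲) (P := fun f => (TensorProduct.lid k W).toLinearMap ∘ₗ
        superTensor (unitGrading k) 𝒱 𝒲 (LinearMap.id : k →ₗ[k] k) f =
      f ∘ₗ (TensorProduct.lid k V).toLinearMap) (fun a b ha hb => by
    rw [superTensor_add_right, LinearMap.comp_add, LinearMap.add_comp, ha, hb]) (fun q f hf => ?_) f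
  refine TensorProduct.ext' fun c v => ?_
  have hc : c ∈ unitGrading k 0 := by simp [unitGrading]
  rw [LinearMap.comp_apply, superTensor_apply _ _ _ _ hf hc]
  simp

theorem superTensor_rid (f : V →ₗ[k] W) :
    (TensorProduct.rid k W).toLinearMap ∘ₗ
        superTensor 𝒱 (unitGrading k) (unitGrading k) f (LinearMap.id : k →ₗ[k] k) =
      f ∘ₗ (TensorProduct.rid k V).toLinearMap := by
  refine TensorProduct.ext' fun v c => ?_
  rw [superTensor_eq_map f (homParity_id (unitGrading k)), signMap_zero]
  simp

theorem superTensor_even (f : V →ₗ[k] V') {g : W →ₗ[k] W'} (hg : g ∈ homParity 𝒲 𝒲' 0) :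
    superTensor 𝒱 𝒲 𝒲' f g = TensorProduct.map f g := by
  rw [superTensor_eq_map f hg, signMap_zero, LinearMap.comp_id]

theorem superTensor_pentagon (𝒵 : ZMod 2 → Submodule k W'') [IsSuperspace 𝒵] :
    (superTensor 𝒱 (tensorGrading (tensorGrading 𝒲 𝒰) 𝒵) (tensorGrading 𝒲 (tensorGrading 𝒰 𝒵))
          (LinearMap.id : V →ₗ[k] V) (TensorProduct.assoc k W U W'').toLinearMap ∘ₗ
        (TensorProduct.assoc k V (W ⊗[k] U) W'').toLinearMap) ∘ₗ
        superTensor (tensorGrading (tensorGrading 𝒱 𝒲) 𝒰) 𝒵 𝒵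
          (TensorProduct.assoc k V W U).toLinearMap (LinearMap.id : W'' →ₗ[k] W'') =
      (TensorProduct.assoc k V W (U ⊗[k] W'')).toLinearMap ∘ₗ
        (TensorProduct.assoc k (V ⊗[k] W) U W'').toLinearMap := by
  rw [superTensor_even _ assoc_parity, superTensor_even _ (homParity_id 𝒵)]
  ext; rfl

theorem superTensor_triangle :
    superTensor 𝒱 (tensorGrading (unitGrading k) 𝒲) 𝒲 (LinearMap.id : V →ₗ[k] V)
        (TensorProduct.lid k W).toLinearMap ∘ₗ (TensorProduct.assoc k V k W).toLinearMap =
      superTensor (tensorGrading 𝒱 (unitGrading k)) 𝒲 𝒲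
        (TensorProduct.rid k V).toLinearMap LinearMap.id := by
  rw [superTensor_even _ lid_parity, superTensor_even _ (homParity_id 𝒲)]
  ext; simp

end Aux

section BaseChange

variable {k : Type*} [Field k] {W W' U U' : Type*}
  [AddCommGroup W] [Module k W] [AddCommGroup W'] [Module k W']
  [AddCommGroup U] [Module k U] [AddCommGroup U'] [Module k U']
  (R : Type*) [CommRing R] [Algebra k R]

/-- The canonical bilinear map `W_R × W'_R → (W ⊗ W')_R`. -/
noncomputable def mulR (x : R ⊗[k] W) (y : R ⊗[k] W') : R ⊗[k] (W ⊗[k] W') :=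
  (TensorProduct.AlgebraTensorModule.distribBaseChange k R W W').symm (x ⊗ₜ[R] y)

/-- The tensor product over `R` of endomorphisms of `W_R` and `W'_R`, as an endomorphism of
`(W ⊗ W')_R`. -/
noncomputable def tensorEnd :
    Module.End R (R ⊗[k] W) × Module.End R (R ⊗[k] W') →* Module.End R (R ⊗[k] (W ⊗[k] W')) where
  toFun p := (TensorProduct.AlgebraTensorModule.distribBaseChange k R W W').symm.toLinearMap ∘ₗ
    TensorProduct.map p.1 p.2 ∘ₗ
      (TensorProduct.AlgebraTensorModule.distribBaseChange k R W W').toLinearMap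
  map_one' := by
    ext x
    simp [TensorProduct.map_one]
  map_mul' p q := by
    refine LinearMap.ext fun x => ?_
    simp [TensorProduct.map_mul]

variable {R}

theorem tensorEnd_mulR (p : Module.End R (R ⊗[k] W)) (q : Module.End R (R ⊗[k] W'))
    (x : R ⊗[k] W) (y : R ⊗[k] W') : tensorEnd R (p, q) (mulR R x y) = mulR R (p x) (q y) := by
  simp [tensorEnd, mulR]

theorem mulR_tmul (r s : R) (x : W) (y : W') :
    mulR R (r ⊗ₜ[k] x) (s ⊗ₜ[k] y) = (r * s) ⊗ₜ[k] (x ⊗ₜ[k] y) := by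
  simp [mulR]

theorem mulR_add_left (x x' : R ⊗[k] W) (y : R ⊗[k] W') :
    mulR R (x + x') y = mulR R x y + mulR R x' y := by simp [mulR, TensorProduct.add_tmul]

theorem mulR_add_right (x : R ⊗[k] W) (y y' : R ⊗[k] W') :
    mulR R x (y + y') = mulR R x y + mulR R x y' := by simp [mulR, TensorProduct.tmul_add]

theorem mulR_zero_left (y : R ⊗[k] W') :
    mulR R (0 : R ⊗[k] W) y = 0 := by simp [mulR]

theorem mulR_zero_right (x : R ⊗[k] W) :
    mulR R x (0 : R ⊗[k] W') = 0 := by simp [mulR]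

/-- Elements `x·y` span `(W ⊗ W')_R`. -/
theorem mulR_induction {P : R ⊗[k] (W ⊗[k] W') → Prop} (hadd : ∀ x y, P x → P y → P (x + y))
    (h : ∀ x y, P (mulR R x y)) (z : R ⊗[k] (W ⊗[k] W')) : P z := by
  obtain ⟨z, rfl⟩ := (TensorProduct.AlgebraTensorModule.distribBaseChange k R W W').symm.surjective z
  induction z with
  | zero => simpa [mulR] using h 0 0
  | add x y hx hy => rw [map_add]; exact hadd _ _ hx hy
  | tmul x y => exact h x y

theorem mulR_ext {M : Type*} [AddCommGroup M] [Module R M] {F G : R ⊗[k] (W ⊗[k] W') →ₗ[R] M}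
    (h : ∀ x y, F (mulR R x y) = G (mulR R x y)) : F = G :=
  LinearMap.ext fun z => mulR_induction (P := fun z => F z = G z)
    (fun x y hx hy => by rw [map_add, map_add, hx, hy]) h z

theorem baseChange_map_mulR (f : W →ₗ[k] U) (g : W' →ₗ[k] U') (x : R ⊗[k] W) (y : R ⊗[k] W') :
    (TensorProduct.map f g).baseChange R (mulR R x y) =
      mulR R (f.baseChange R x) (g.baseChange R y) := by
  induction x with
  | zero => simp [mulR_zero_left]
  | add x x' hx hx' => simp only [mulR_add_left, map_add, hx, hx']
  | tmul r w =>
    induction y with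
    | zero => simp [mulR_zero_right]
    | add x x' hx hx' => simp only [mulR_add_right, map_add, hx, hx']
    | tmul s w' => simp [mulR_tmul]

theorem rTensor_mulR {S : Type*} [CommRing S] [Algebra k S] (φ : R →ₐ[k] S) (x : R ⊗[k] W)
    (y : R ⊗[k] W') :
    (φ.toLinearMap.rTensor (W ⊗[k] W')) (mulR R x y) =
      mulR S (φ.toLinearMap.rTensor W x) (φ.toLinearMap.rTensor W' y) := by
  induction x with
  | zero => simp [mulR_zero_left]
  | add x x' hx hx' => simp only [mulR_add_left, map_add, hx, hx']
  | tmul r w =>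
    induction y with
    | zero => simp [mulR_zero_right]
    | add x x' hx hx' => simp only [mulR_add_right, map_add, hx, hx']
    | tmul s w' => simp [mulR_tmul]

theorem assoc_mulR (x : R ⊗[k] W) (y : R ⊗[k] W') (z : R ⊗[k] U) :
    (TensorProduct.assoc k W W' U).toLinearMap.baseChange R (mulR R (mulR R x y) z) =
      mulR R x (mulR R y z) := by
  induction x with
  | zero => simp [mulR_zero_left]
  | add x x' hx hx' => simp only [mulR_add_left, map_add, hx, hx']
  | tmul r w =>
    induction y with
    | zero => simp [mulR_zero_right, mulR_zero_left]
    | add x x' hx hx' => simp only [mulR_add_right, mulR_add_left, map_add, hx, hx']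
    | tmul s w' =>
      induction z with
      | zero => simp [mulR_zero_right]
      | add x x' hx hx' => simp only [mulR_add_right, map_add, hx, hx']
      | tmul t u => simp [mulR_tmul, mul_assoc]

theorem lid_mulR (x : R ⊗[k] k) (y : R ⊗[k] W) :
    (TensorProduct.lid k W).toLinearMap.baseChange R (mulR R x y) =
      TensorProduct.AlgebraTensorModule.rid k R R x • y := by
  induction x with
  | zero => simp [mulR_zero_left]
  | add x x' hx hx' => simp only [mulR_add_left, map_add, hx, hx', add_smul]
  | tmul r c =>
    induction y with
    | zero => simp [mulR_zero_right]
    | add x x' hx hx' => simp only [mulR_add_right, map_add, hx, hx', smul_add]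
    | tmul s w => simp [mulR_tmul, TensorProduct.smul_tmul', TensorProduct.tmul_smul]

theorem rid_mulR (x : R ⊗[k] W) (y : R ⊗[k] k) :
    (TensorProduct.rid k W).toLinearMap.baseChange R (mulR R x y) =
      TensorProduct.AlgebraTensorModule.rid k R R y • x := by
  induction y with
  | zero => simp [mulR_zero_right]
  | add x x' hx hx' => simp only [mulR_add_right, map_add, hx, hx', add_smul]
  | tmul r c =>
    induction x with
    | zero => simp [mulR_zero_left]
    | add x x' hx hx' => simp only [mulR_add_left, map_add, hx, hx', smul_add]
    | tmul s w => simp [mulR_tmul, TensorProduct.smul_tmul', TensorProduct.tmul_smul, mul_comm]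

theorem tensorEnd_assoc (p : Module.End R (R ⊗[k] W)) (q : Module.End R (R ⊗[k] W'))
    (r : Module.End R (R ⊗[k] U)) :
    (TensorProduct.assoc k W W' U).toLinearMap.baseChange R ∘ₗ
        tensorEnd R (tensorEnd R (p, q), r) =
      tensorEnd R (p, tensorEnd R (q, r)) ∘ₗ
        (TensorProduct.assoc k W W' U).toLinearMap.baseChange R := by
  refine mulR_ext fun z u => ?_
  refine mulR_induction (P := fun z => ((TensorProduct.assoc k W W' U).toLinearMap.baseChange R ∘ₗ
        tensorEnd R (tensorEnd R (p, q), r)) (mulR R z u) =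
      (tensorEnd R (p, tensorEnd R (q, r)) ∘ₗ
        (TensorProduct.assoc k W W' U).toLinearMap.baseChange R) (mulR R z u))
    (fun a b ha hb => by rw [mulR_add_left, map_add, map_add, ha, hb]) (fun x y => ?_) z
  simp only [LinearMap.comp_apply, tensorEnd_mulR, assoc_mulR]

theorem tensorEnd_lid (p : Module.End R (R ⊗[k] W)) :
    (TensorProduct.lid k W).toLinearMap.baseChange R ∘ₗ tensorEnd R (1, p) =
      p ∘ₗ (TensorProduct.lid k W).toLinearMap.baseChange R := by
  refine mulR_ext fun z u => ?_
  simp only [LinearMap.comp_apply, tensorEnd_mulR, lid_mulR, map_smul, Module.End.one_apply]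

theorem tensorEnd_rid (p : Module.End R (R ⊗[k] W)) :
    (TensorProduct.rid k W).toLinearMap.baseChange R ∘ₗ tensorEnd R (p, 1) =
      p ∘ₗ (TensorProduct.rid k W).toLinearMap.baseChange R := by
  refine mulR_ext fun z u => ?_
  simp only [LinearMap.comp_apply, tensorEnd_mulR, rid_mulR, map_smul, Module.End.one_apply]

end BaseChange

section SuperModules

variable {k : Type u} [Field k] (A : Type w) [Ring A] [Algebra k A]
  {V : Type u} [AddCommGroup V] [Module k V] [Module Aᵐᵒᵖ V] [IsScalarTower k Aᵐᵒᵖ V]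
  (𝒱 : ZMod 2 → Submodule k V) [IsSuperspace 𝒱] (Φ : LinearMap.BilinForm k V)

/-- Right multiplication `v ↦ v a`, as a `k`-linear map. -/
def rightMul (k : Type*) [Field k] {A : Type*} [Ring A] [Algebra k A] (V : Type*) [AddCommGroup V]
    [Module k V] [Module Aᵐᵒᵖ V] [IsScalarTower k Aᵐᵒᵖ V] (a : A) : V →ₗ[k] V :=
  Algebra.lsmul k k V (MulOpposite.op a)

/-- The `R`-points of the algebraic group `G_rd(Φ)`, for a commutative `k`-algebra `R`: the even
automorphisms `g` of the right `A_R`-supermodule `V_R = R ⊗ V` with `Φ_R(gx, gy) = Φ_R(x, y)`.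
(Evenness of `g` is expressed by saying that it commutes with the parity projections.) -/
noncomputable def redGroup (R : Type*) [CommRing R] [Algebra k R] :
    Subgroup ((R ⊗[k] V) ≃ₗ[R] (R ⊗[k] V)) where
  carrier := {g |
    (∀ r x, g ((parityProj 𝒱 r).baseChange R x) = (parityProj 𝒱 r).baseChange R (g x)) ∧
    (∀ (a : A) x, g ((rightMul k V a).baseChange R x) = (rightMul k V a).baseChange R (g x)) ∧
    ∀ x y, Φ.baseChange R (g x) (g y) = Φ.baseChange R x y}
  mul_mem' {g h} hg hh := by
    refine ⟨fun r x => ?_, fun a x => ?_, fun x y => ?_⟩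
    · simp only [LinearEquiv.mul_apply, hh.1, hg.1]
    · simp only [LinearEquiv.mul_apply, hh.2.1, hg.2.1]
    · simp only [LinearEquiv.mul_apply, hh.2.2, hg.2.2]
  one_mem' := ⟨fun _ _ => rfl, fun _ _ => rfl, fun _ _ => rfl⟩
  inv_mem' {g} hg := by
    have key : ∀ x, g (g⁻¹ x) = x := fun x => LinearEquiv.apply_symm_apply g x
    refine ⟨fun r x => ?_, fun a x => ?_, fun x y => ?_⟩
    · apply g.injective; rw [key, hg.1, key]
    · apply g.injective; rw [key, hg.2.1, key]
    · rw [← hg.2.2, key, key]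

/-- The homogeneous part of parity `r` of the Lie superalgebra `𝔤(Φ)`: the endomorphisms `X` of
parity `r` of the right `A`-supermodule `V` with `Φ(Xv, w) = -(-1)^{X̄ v̄} Φ(v, Xw)`. -/
def lieAlg (r : ZMod 2) : Submodule k (Module.End k V) where
  carrier := {X | X ∈ homParity 𝒱 𝒱 r ∧ (∀ (a : A) v, X (rightMul k V a v) = rightMul k V a (X v)) ∧
    ∀ s, ∀ v ∈ 𝒱 s, ∀ w, Φ (X v) w = -(koszul k r s * Φ v (X w))}
  add_mem' {X Y} hX hY := by
    refine ⟨add_mem hX.1 hY.1, fun a v => ?_, fun s v hv w => ?_⟩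
    · simp [hX.2.1, hY.2.1]
    · simp [hX.2.2 s v hv, hY.2.2 s v hv]; ring
  zero_mem' := ⟨zero_mem _, by simp, by simp⟩
  smul_mem' c X hX := by
    refine ⟨Submodule.smul_mem _ c hX.1, fun a v => ?_, fun s v hv w => ?_⟩
    · simp [hX.2.1]
    · simp [hX.2.2 s v hv]; ring

variable {A 𝒱 Φ}

/-- The superbracket `[X, Y] = XY - (-1)^{X̄ Ȳ} YX` of `𝔤(Φ)`. -/
def lieBracket {r s : ZMod 2} (X : lieAlg A 𝒱 Φ r) (Y : lieAlg A 𝒱 Φ s) :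
    lieAlg A 𝒱 Φ (r + s) :=
  ⟨X.1 * Y.1 - koszul k r s • (Y.1 * X.1), by
    obtain ⟨X, hX⟩ := X
    obtain ⟨Y, hY⟩ := Y
    refine ⟨sub_mem ?_ (Submodule.smul_mem _ _ (homParity_comp hX.1 hY.1)),
      fun a v => by simp [hX.2.1, hY.2.1], fun t v hv w => ?_⟩
    · rw [add_comm]; exact homParity_comp hY.1 hX.1
    · have h1 := hX.2.2 _ _ (hY.1 t v hv) w
      have h2 := hY.2.2 _ _ (hX.1 t v hv) w
      have h3 := hX.2.2 _ v hv (Y w)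
      have h4 := hY.2.2 _ v hv (X w)
      simp only [LinearMap.sub_apply, LinearMap.smul_apply, Module.End.mul_apply, map_sub, map_smul,
        h1, h2, h3, h4, smul_eq_mul, koszul_add_left, koszul_add_right, koszul_comm s r]
      linear_combination (-(koszul k r t * koszul k s t * Φ v (X (Y w)))) *
        koszul_mul_self (k := k) r s⟩

variable (A 𝒱 Φ)

/-- A finite-dimensional supermodule over the Harish-Chandra superpair
`G(Φ) = (G_rd(Φ), 𝔤(Φ))`: a superspace `W` with

* an even algebraic representation of `G_rd(Φ)`, that is, homomorphisms from the groups of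
  `R`-points to the even automorphisms of `W_R`, natural in the commutative `k`-algebra `R`;
* a representation of the Lie superalgebra `𝔤(Φ)`;

such that the differential of the action of `G_rd(Φ)` is the action of `𝔤(Φ)₀`: if `X ∈ 𝔤(Φ)₀`, then
the point `1 + εX` over the dual numbers acts by `1 + εX`. -/
structure GSMod where
  /-- The underlying vector space `W`. -/
  carrier : Type u
  [addCommGroup : AddCommGroup carrier]
  [module : Module k carrier]
  [finite : FiniteDimensional k carrier]
  /-- The grading of `W`. -/
  grading : ZMod 2 → Submodule k carrier
  [superspace : IsSuperspace grading]
  /-- The action of the group `G_rd(Φ)`. -/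
  grp (R : Type u) [CommRing R] [Algebra k R] :
    redGroup A 𝒱 Φ R →* Module.End R (R ⊗[k] carrier)
  grp_even (R : Type u) [CommRing R] [Algebra k R] (g : redGroup A 𝒱 Φ R) (r : ZMod 2)
    (x : R ⊗[k] carrier) :
    grp R g ((parityProj grading r).baseChange R x) =
      (parityProj grading r).baseChange R (grp R g x)
  /-- Naturality: if `g'` is the image of the point `g` under `φ : R → S`, then the operator by
  which `g'` acts is the base change of the operator by which `g` acts. -/
  grp_naturality (R S : Type u) [CommRing R] [Algebra k R] [CommRing S] [Algebra k S]
    (φ : R →ₐ[k] S) (g : redGroup A 𝒱 Φ R) (g' : redGroup A 𝒱 Φ S) :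
    (∀ x, φ.toLinearMap.rTensor V (g.1 x) = g'.1 (φ.toLinearMap.rTensor V x)) →
      ∀ x, φ.toLinearMap.rTensor carrier (grp R g x) =
        grp S g' (φ.toLinearMap.rTensor carrier x)
  /-- The action of the Lie superalgebra `𝔤(Φ)`. -/
  lie (r : ZMod 2) : lieAlg A 𝒱 Φ r →ₗ[k] Module.End k carrier
  lie_mem (r : ZMod 2) (X : lieAlg A 𝒱 Φ r) : lie r X ∈ homParity grading grading r
  lie_bracket (r s : ZMod 2) (X : lieAlg A 𝒱 Φ r) (Y : lieAlg A 𝒱 Φ s) :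
    lie (r + s) (lieBracket X Y) = lie r X * lie s Y - koszul k r s • (lie s Y * lie r X)
  differential (X : lieAlg A 𝒱 Φ 0) (g : redGroup A 𝒱 Φ (DualNumber k)) :
    (∀ v : V, g.1 (1 ⊗ₜ v) = 1 ⊗ₜ v + DualNumber.eps ⊗ₜ X.1 v) →
      ∀ x : carrier, grp (DualNumber k) g (1 ⊗ₜ x) = 1 ⊗ₜ x + DualNumber.eps ⊗ₜ lie 0 X x

attribute [instance] GSMod.addCommGroup GSMod.module GSMod.finite GSMod.superspace

namespace GSMod

variable {A 𝒱 Φ}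

/-- The morphisms of `G(Φ)`-supermodules that are homogeneous of parity `p`. -/
def homOfParity (W W' : GSMod A 𝒱 Φ) (p : ZMod 2) : Submodule k (W.carrier →ₗ[k] W'.carrier) where
  carrier := {f | f ∈ homParity W.grading W'.grading p ∧
    (∀ (R : Type u) [CommRing R] [Algebra k R] (g : redGroup A 𝒱 Φ R) (x : R ⊗[k] W.carrier),
      f.baseChange R (W.grp R g x) = W'.grp R g (f.baseChange R x)) ∧
    ∀ (r : ZMod 2) (X : lieAlg A 𝒱 Φ r) (x : W.carrier),
      f (W.lie r X x) = koszul k r p • W'.lie r X (f x)}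
  add_mem' {f f'} hf hf' := by
    refine ⟨add_mem hf.1 hf'.1, fun R _ _ g x => ?_, fun r X x => ?_⟩
    · simp only [LinearMap.baseChange_add, LinearMap.add_apply, hf.2.1, hf'.2.1, map_add]
    · simp only [LinearMap.add_apply, hf.2.2, hf'.2.2, map_add, smul_add]
  zero_mem' := ⟨zero_mem _, fun R _ _ g x => by simp, fun r X x => by simp⟩
  smul_mem' c f hf := by
    refine ⟨Submodule.smul_mem _ c hf.1, fun R _ _ g x => ?_, fun r X x => ?_⟩
    · have : ∀ y : R ⊗[k] W.carrier, (c • f).baseChange R y = algebraMap k R c • f.baseChange R y := by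
        intro y
        rw [LinearMap.baseChange_smul, LinearMap.smul_apply, algebraMap_smul]
      rw [this, this, hf.2.1, map_smul]
    · simp only [LinearMap.smul_apply, hf.2.2, map_smul, smul_comm c]

/-- All morphisms of `G(Φ)`-supermodules: sums of an even and an odd one. -/
def homAll (W W' : GSMod A 𝒱 Φ) : Submodule k (W.carrier →ₗ[k] W'.carrier) :=
  homOfParity W W' 0 ⊔ homOfParity W W' 1

theorem homOfParity_le (W W' : GSMod A 𝒱 Φ) (p : ZMod 2) : homOfParity W W' p ≤ homAll W W' := by
  obtain rfl | rfl := zmod_two_cases p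
  · exact le_sup_left
  · exact le_sup_right

theorem homAll_induction {W W' : GSMod A 𝒱 Φ} {P : (W.carrier →ₗ[k] W'.carrier) → Prop}
    (hadd : ∀ f g, P f → P g → P (f + g)) (h : ∀ p, ∀ f ∈ homOfParity W W' p, P f)
    {f : W.carrier →ₗ[k] W'.carrier} (hf : f ∈ homAll W W') : P f := by
  obtain ⟨a, ha, b, hb, rfl⟩ := Submodule.mem_sup.1 hf
  exact hadd _ _ (h _ _ ha) (h _ _ hb)

theorem homOfParity_comp {W W' W'' : GSMod A 𝒱 Φ} {p q : ZMod 2}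
    {f : W.carrier →ₗ[k] W'.carrier} {g : W'.carrier →ₗ[k] W''.carrier}
    (hf : f ∈ homOfParity W W' p) (hg : g ∈ homOfParity W' W'' q) :
    g ∘ₗ f ∈ homOfParity W W'' (p + q) := by
  refine ⟨homParity_comp hf.1 hg.1, fun R _ _ h x => ?_, fun r X x => ?_⟩
  · simp only [LinearMap.baseChange_comp, LinearMap.comp_apply, hf.2.1, hg.2.1]
  · simp only [LinearMap.comp_apply, hf.2.2, hg.2.2, map_smul, koszul_add_right, smul_smul]

theorem homAll_comp {W W' W'' : GSMod A 𝒱 Φ}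
    {f : W.carrier →ₗ[k] W'.carrier} {g : W'.carrier →ₗ[k] W''.carrier}
    (hf : f ∈ homAll W W') (hg : g ∈ homAll W' W'') : g ∘ₗ f ∈ homAll W W'' := by
  refine homAll_induction (P := fun f => g ∘ₗ f ∈ homAll W W'')
    (fun a b ha hb => by rw [LinearMap.comp_add]; exact add_mem ha hb) (fun p f hf => ?_) hf
  refine homAll_induction (P := fun g => g ∘ₗ f ∈ homAll W W'')
    (fun a b ha hb => by rw [LinearMap.add_comp]; exact add_mem ha hb) (fun q g hg => ?_) hg
  exact homOfParity_le _ _ _ (homOfParity_comp hf hg)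

theorem homOfParity_id (W : GSMod A 𝒱 Φ) : LinearMap.id ∈ homOfParity W W 0 :=
  ⟨homParity_id _, fun R _ _ g x => by simp, fun r X x => by simp⟩

instance : Category (GSMod A 𝒱 Φ) where
  Hom W W' := homAll W W'
  id W := ⟨LinearMap.id, homOfParity_le _ _ _ (homOfParity_id W)⟩
  comp f g := ⟨g.1 ∘ₗ f.1, homAll_comp f.2 g.2⟩

/-- The linear map underlying a morphism of `G(Φ)`-supermodules. -/
def lin {W W' : GSMod A 𝒱 Φ} (f : W ⟶ W') : W.carrier →ₗ[k] W'.carrier := f.1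

theorem hom_ext {W W' : GSMod A 𝒱 Φ} {f g : W ⟶ W'} (h : lin f = lin g) : f = g :=
  Subtype.ext h

instance : Preadditive (GSMod A 𝒱 Φ) where
  homGroup W W' := inferInstanceAs (AddCommGroup (homAll W W'))
  add_comp _ _ _ f f' g := Subtype.ext (LinearMap.ext fun x => map_add g.1 (f.1 x) (f'.1 x))
  comp_add _ _ _ _ _ _ := rfl

instance : Linear k (GSMod A 𝒱 Φ) where
  homModule W W' := inferInstanceAs (Module k (homAll W W'))
  smul_comp _ _ _ c f g := Subtype.ext (LinearMap.ext fun x => map_smul g.1 c (f.1 x))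
  comp_smul _ _ _ _ _ _ := rfl

/-- The linear map underlying a morphism depends linearly on the morphism. -/
def linL (W W' : GSMod A 𝒱 Φ) : (W ⟶ W') →ₗ[k] (W.carrier →ₗ[k] W'.carrier) where
  toFun := lin
  map_add' _ _ := rfl
  map_smul' _ _ := rfl

instance : Supercategory k (GSMod A 𝒱 Φ) where
  homPart W W' p := (homOfParity W W' p).comap (linL W W')
  isSuperspace W W' := by
    constructor
    constructor
    · rw [Submodule.disjoint_def]
      intro f h0 h1
      exact Subtype.ext
        (Submodule.disjoint_def.1 (homParity_disjoint W.grading W'.grading) f.1 h0.1 h1.1)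
    · rw [codisjoint_iff, eq_top_iff]
      rintro ⟨f, hf⟩ -
      obtain ⟨a, ha, b, hb, rfl⟩ := Submodule.mem_sup.1 hf
      exact Submodule.mem_sup.2 ⟨⟨a, homOfParity_le _ _ _ ha⟩, ha, ⟨b, homOfParity_le _ _ _ hb⟩, hb,
        rfl⟩
  id_mem W := homOfParity_id W
  comp_mem hf hg := homOfParity_comp hf hg

variable (A 𝒱 Φ) in
/-- The natural supermodule `V`. -/
noncomputable abbrev std [FiniteDimensional k V] : GSMod A 𝒱 Φ where
  carrier := V
  grading := 𝒱
  grp R _ _ := (LinearEquiv.automorphismGroup.toLinearMapMonoidHom).comp (redGroup A 𝒱 Φ R).subtype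
  grp_even _ _ _ g r x := g.2.1 r x
  grp_naturality _ _ _ _ _ _ _ _ _ h := h
  lie r := (lieAlg A 𝒱 Φ r).subtype
  lie_mem _ X := X.2.1
  lie_bracket _ _ _ _ := rfl
  differential _ _ h := h

variable (A 𝒱 Φ) in
/-- The trivial supermodule `k`. -/
noncomputable abbrev triv : GSMod A 𝒱 Φ where
  carrier := k
  grading := unitGrading k
  grp _ _ _ := 1
  grp_even _ _ _ _ _ _ := rfl
  grp_naturality _ _ _ _ _ _ _ _ _ _ _ := rfl
  lie _ := 0
  lie_mem _ _ := zero_mem _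
  lie_bracket _ _ _ _ := by simp
  differential _ _ _ _ := by simp

theorem grp_sign (W : GSMod A 𝒱 Φ) (R : Type u) [CommRing R] [Algebra k R] (g : redGroup A 𝒱 Φ R)
    (r : ZMod 2) (x : R ⊗[k] W.carrier) :
    (signMap W.grading r).baseChange R (W.grp R g x) =
      W.grp R g ((signMap W.grading r).baseChange R x) := by
  have h : ∀ x, (signMap W.grading r).baseChange R x =
      (parityProj W.grading 0).baseChange R x +
        algebraMap k R (koszul k r 1) • (parityProj W.grading 1).baseChange R x := by
    intro x
    rw [signMap, LinearMap.baseChange_add, LinearMap.baseChange_smul, LinearMap.add_apply,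
      LinearMap.smul_apply, algebraMap_smul]
  rw [h, h, map_add, map_smul, W.grp_even, W.grp_even]

/-- The tensor product of supermodules: `g(v ⊗ w) = gv ⊗ gw` for points of the group, and
`X(v ⊗ w) = Xv ⊗ w + (-1)^{X̄ v̄} v ⊗ Xw` for elements of the Lie superalgebra. -/
noncomputable abbrev tensor (W W' : GSMod A 𝒱 Φ) : GSMod A 𝒱 Φ where
  carrier := W.carrier ⊗[k] W'.carrier
  grading := tensorGrading W.grading W'.grading
  grp R _ _ := (tensorEnd R).comp ((W.grp R).prod (W'.grp R))
  grp_even R _ _ g r z := by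
    refine mulR_induction (P := fun z => (tensorEnd R (W.grp R g, W'.grp R g))
        ((parityProj (tensorGrading W.grading W'.grading) r).baseChange R z) =
          (parityProj (tensorGrading W.grading W'.grading) r).baseChange R
            (tensorEnd R (W.grp R g, W'.grp R g) z))
      (fun x y hx hy => by simp only [map_add, hx, hy]) (fun x y => ?_) z
    rw [parityProj_tensor]
    simp only [sum_zmod_two, LinearMap.baseChange_add, LinearMap.add_apply, baseChange_map_mulR,
      map_add, tensorEnd_mulR, W.grp_even, W'.grp_even]
  grp_naturality R S _ _ _ _ φ g g' h z := by
    refine mulR_induction (P := fun z => φ.toLinearMap.rTensor (W.carrier ⊗[k] W'.carrier)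
        (tensorEnd R (W.grp R g, W'.grp R g) z) = tensorEnd S (W.grp S g', W'.grp S g') _)
      (fun x y hx hy => by simp only [map_add, hx, hy]) (fun x y => ?_) z
    simp only [tensorEnd_mulR, rTensor_mulR, W.grp_naturality R S φ g g' h,
      W'.grp_naturality R S φ g g' h]
  lie r :=
    { toFun := fun X =>
        superTensor W.grading W'.grading W'.grading (W.lie r X) LinearMap.id +
          superTensor W.grading W'.grading W'.grading LinearMap.id (W'.lie r X)
      map_add' := fun X Y => by
        rw [map_add, map_add, superTensor_add_left, superTensor_add_right]; abel
      map_smul' := fun c X => by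
        rw [map_smul, map_smul, superTensor_smul_left, superTensor_smul_right, ← smul_add]; rfl }
  lie_mem r X := by
    have h1 := superTensor_mem (W.lie_mem r X) (homParity_id W'.grading)
    have h2 := superTensor_mem (homParity_id W.grading) (W'.lie_mem r X)
    rw [add_zero] at h1
    rw [zero_add] at h2
    exact add_mem h1 h2
  lie_bracket r s X Y := by
    simp only [LinearMap.coe_mk, AddHom.coe_mk, W.lie_bracket, W'.lie_bracket]
    exact superTensor_bracket (W.lie_mem r X) (W.lie_mem s Y) (W'.lie_mem r X) (W'.lie_mem s Y)
  differential X g h z := by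
    induction z with
    | zero => simp
    | add x y hx hy =>
      simp only [TensorProduct.tmul_add, map_add, hx, hy]; abel
    | tmul x y =>
      have h0 : (1 : DualNumber k) ⊗ₜ[k] (x ⊗ₜ[k] y) =
          mulR (DualNumber k) (1 ⊗ₜ[k] x) (1 ⊗ₜ[k] y) := by rw [mulR_tmul, one_mul]
      have h1 : superTensor W.grading W'.grading W'.grading LinearMap.id (W'.lie 0 X) (x ⊗ₜ[k] y) =
          x ⊗ₜ[k] W'.lie 0 X y := by
        rw [superTensor_eq_map _ (W'.lie_mem 0 X)]; simp [signMap, parityProj_add]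
      have h2 : superTensor W.grading W'.grading W'.grading (W.lie 0 X) LinearMap.id (x ⊗ₜ[k] y) =
          W.lie 0 X x ⊗ₜ[k] y := by
        rw [superTensor_eq_map _ (homParity_id W'.grading)]; simp [signMap, parityProj_add]
      simp only [LinearMap.coe_mk, AddHom.coe_mk, LinearMap.add_apply, h1, h2]
      rw [MonoidHom.comp_apply, MonoidHom.prod_apply, h0, tensorEnd_mulR, W.differential X g h,
        W'.differential X g h]
      simp only [mulR_add_left, mulR_add_right, mulR_tmul,
        one_mul, mul_one, DualNumber.eps_mul_eps, TensorProduct.zero_tmul, TensorProduct.tmul_add]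
      abel

theorem tensor_grp (W W' : GSMod A 𝒱 Φ) (R : Type u) [CommRing R] [Algebra k R]
    (g : redGroup A 𝒱 Φ R) (x : R ⊗[k] W.carrier) (y : R ⊗[k] W'.carrier) :
    (tensor W W').grp R g (mulR R x y) = mulR R (W.grp R g x) (W'.grp R g y) :=
  tensorEnd_mulR _ _ x y

theorem tensor_lie (W W' : GSMod A 𝒱 Φ) (r : ZMod 2) (X : lieAlg A 𝒱 Φ r) {s : ZMod 2}
    {x : W.carrier} (hx : x ∈ W.grading s) (y : W'.carrier) :
    (tensor W W').lie r X (x ⊗ₜ[k] y) =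
      W.lie r X x ⊗ₜ[k] y + koszul k r s • (x ⊗ₜ[k] W'.lie r X y) := by
  change superTensor W.grading W'.grading W'.grading (W.lie r X) LinearMap.id (x ⊗ₜ[k] y) +
    superTensor W.grading W'.grading W'.grading LinearMap.id (W'.lie r X) (x ⊗ₜ[k] y) = _
  rw [superTensor_apply _ _ _ _ (homParity_id W'.grading) hx,
    superTensor_apply _ _ _ _ (W'.lie_mem r X) hx]
  simp

theorem homOfParity_tensor {W W' U U' : GSMod A 𝒱 Φ} {p q : ZMod 2}
    {f : W.carrier →ₗ[k] U.carrier} {f' : W'.carrier →ₗ[k] U'.carrier}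
    (hf : f ∈ homOfParity W U p) (hf' : f' ∈ homOfParity W' U' q) :
    superTensor W.grading W'.grading U'.grading f f' ∈
      homOfParity (tensor W W') (tensor U U') (p + q) := by
  refine ⟨superTensor_mem hf.1 hf'.1, fun R _ _ g z => ?_, fun r X z => ?_⟩
  · rw [superTensor_eq_map f hf'.1]
    refine LinearMap.congr_fun (mulR_ext (F := LinearMap.comp
      ((TensorProduct.map (f ∘ₗ signMap W.grading q) f').baseChange R)
        (tensorEnd R (W.grp R g, W'.grp R g)))
      (G := LinearMap.comp (tensorEnd R (U.grp R g, U'.grp R g))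
        ((TensorProduct.map (f ∘ₗ signMap W.grading q) f').baseChange R)) fun x y => ?_) z
    rw [LinearMap.comp_apply, LinearMap.comp_apply, tensorEnd_mulR, baseChange_map_mulR,
      baseChange_map_mulR, tensorEnd_mulR, LinearMap.baseChange_comp,
      LinearMap.comp_apply, LinearMap.comp_apply, grp_sign, hf.2.1, hf'.2.1]
  · revert z
    have : superTensor W.grading W'.grading U'.grading f f' ∘ₗ (tensor W W').lie r X =
        koszul k r (p + q) •
          ((tensor U U').lie r X ∘ₗ superTensor W.grading W'.grading U'.grading f f') := by
      refine super_ext₂ W.grading W'.grading fun s x hx t y hy => ?_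
      change superTensor W.grading W'.grading U'.grading f f' ((tensor W W').lie r X (x ⊗ₜ[k] y)) =
        koszul k r (p + q) • (tensor U U').lie r X
          (superTensor W.grading W'.grading U'.grading f f' (x ⊗ₜ[k] y))
      rw [tensor_lie W W' r X hx, map_add, map_smul,
        superTensor_apply _ _ _ _ hf'.1 (W.lie_mem r X s x hx),
        superTensor_apply _ _ _ _ hf'.1 hx, superTensor_apply _ _ _ _ hf'.1 hx, map_smul,
        tensor_lie U U' r X (hf.1 s x hx), hf.2.2, hf'.2.2]
      simp only [← TensorProduct.smul_tmul', TensorProduct.tmul_smul, smul_add, smul_smul,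
        koszul_add_left, koszul_add_right]
      congr 2
      · rw [koszul_comm q r]; ring
      · linear_combination (-(koszul k r s * koszul k r q * koszul k q s)) *
          koszul_mul_self (k := k) r p
    exact fun z => LinearMap.congr_fun this z

/-- The tensor product of morphisms of supermodules. -/
noncomputable def tensorMap {W U W' U' : GSMod A 𝒱 Φ} :
    (W ⟶ U) →ₗ[k] (W' ⟶ U') →ₗ[k] (tensor W W' ⟶ tensor U U') :=
  LinearMap.mk₂ k
    (fun f f' => ⟨superTensor W.grading W'.grading U'.grading f.1 f'.1, by
      refine homAll_induction
        (P := fun f => superTensor W.grading W'.grading U'.grading f f'.1 ∈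
          homAll (tensor W W') (tensor U U'))
        (fun a b ha hb => by rw [superTensor_add_left]; exact add_mem ha hb) (fun p f hf => ?_) f.2
      refine homAll_induction
        (P := fun f' => superTensor W.grading W'.grading U'.grading f f' ∈
          homAll (tensor W W') (tensor U U'))
        (fun a b ha hb => by rw [superTensor_add_right]; exact add_mem ha hb)
        (fun q f' hf' => ?_) f'.2
      exact homOfParity_le _ _ _ (homOfParity_tensor hf hf')⟩)
    (fun _ _ _ => Subtype.ext (superTensor_add_left _ _ _ _ _ _))
    (fun _ _ _ => Subtype.ext (superTensor_smul_left _ _ _ _ _ _))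
    (fun _ _ _ => Subtype.ext (superTensor_add_right _ _ _ _ _ _))
    (fun _ _ _ => Subtype.ext (superTensor_smul_right _ _ _ _ _ _))

theorem tensorMap_val {W U W' U' : GSMod A 𝒱 Φ} (f : W ⟶ U) (f' : W' ⟶ U') :
    (tensorMap f f').1 = superTensor W.grading W'.grading U'.grading f.1 f'.1 := rfl

/-- An even equivariant linear equivalence, as an isomorphism of supermodules. -/
def isoMk {W W' : GSMod A 𝒱 Φ} (e : W.carrier ≃ₗ[k] W'.carrier)
    (h : e.toLinearMap ∈ homOfParity W W' 0) (h' : e.symm.toLinearMap ∈ homOfParity W' W 0) :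
    W ≅ W' where
  hom := ⟨e, homOfParity_le _ _ _ h⟩
  inv := ⟨e.symm, homOfParity_le _ _ _ h'⟩
  hom_inv_id := Subtype.ext (LinearMap.ext fun x => e.symm_apply_apply x)
  inv_hom_id := Subtype.ext (LinearMap.ext fun x => e.apply_symm_apply x)

theorem symm_mem {W W' : GSMod A 𝒱 Φ} {e : W.carrier ≃ₗ[k] W'.carrier}
    (h : e.toLinearMap ∈ homOfParity W W' 0) : e.symm.toLinearMap ∈ homOfParity W' W 0 := by
  refine ⟨fun r y hy => ?_, fun R _ _ g y => ?_, fun r X y => ?_⟩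
  · have hz : ∀ t, parityProj W'.grading t y = e (parityProj W.grading t (e.symm y)) := by
      have h1 : ∀ t, ∀ x, parityProj W'.grading t (e x) = e (parityProj W.grading t x) := by
        intro t
        refine super_induction W.grading (fun a b ha hb => by simp only [map_add, ha, hb]) ?_
        intro s x hx
        have hex := h.1 s x hx
        rw [add_zero] at hex
        by_cases hst : s = t
        · subst hst
          rw [parityProj_same _ hx]; exact parityProj_same _ hex
        · rw [parityProj_ne _ hx hst, map_zero]; exact parityProj_ne _ hex hst
      intro t
      rw [← h1, e.apply_symm_apply]
    have := hz r
    rw [parityProj_same _ hy] at this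
    rw [add_zero]
    have h2 : e.symm y = parityProj W.grading r (e.symm y) := by
      rw [LinearEquiv.symm_apply_eq]; exact this
    change e.symm y ∈ _
    rw [h2]; exact parityProj_mem _ _ _
  · have key : ∀ z, e.symm.toLinearMap.baseChange R (e.toLinearMap.baseChange R z) = z := by
      intro z
      rw [← LinearMap.comp_apply, ← LinearMap.baseChange_comp]; simp
    have key' : ∀ z, e.toLinearMap.baseChange R (e.symm.toLinearMap.baseChange R z) = z := by
      intro z
      rw [← LinearMap.comp_apply, ← LinearMap.baseChange_comp]; simp
    rw [← key (W.grp R g _), h.2.1, key']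
  · have := h.2.2 r X (e.symm y)
    simp only [koszul_zero_right, one_smul, LinearEquiv.coe_coe, e.apply_symm_apply] at this
    simp only [koszul_zero_right, one_smul, LinearEquiv.coe_coe]
    rw [LinearEquiv.symm_apply_eq, this]

theorem assoc_mem (W W' W'' : GSMod A 𝒱 Φ) :
    (TensorProduct.assoc k W.carrier W'.carrier W''.carrier).toLinearMap ∈
      homOfParity (tensor (tensor W W') W'') (tensor W (tensor W' W'')) 0 := by
  refine ⟨assoc_parity, fun R _ _ g z => LinearMap.congr_fun (tensorEnd_assoc _ _ _) z,
    fun r X z => ?_⟩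
  rw [koszul_zero_right, one_smul]
  refine LinearMap.congr_fun (f := (TensorProduct.assoc k W.carrier W'.carrier
      W''.carrier).toLinearMap ∘ₗ (superTensor (tensorGrading W.grading W'.grading) W''.grading
        W''.grading (superTensor W.grading W'.grading W'.grading (W.lie r X) LinearMap.id +
          superTensor W.grading W'.grading W'.grading LinearMap.id (W'.lie r X)) LinearMap.id +
        superTensor (tensorGrading W.grading W'.grading) W''.grading W''.grading LinearMap.id
          (W''.lie r X)))
    (g := (superTensor W.grading (tensorGrading W'.grading W''.grading)
      (tensorGrading W'.grading W''.grading) (W.lie r X) LinearMap.id +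
        superTensor W.grading (tensorGrading W'.grading W''.grading)
          (tensorGrading W'.grading W''.grading) LinearMap.id
          (superTensor W'.grading W''.grading W''.grading (W'.lie r X) LinearMap.id +
            superTensor W'.grading W''.grading W''.grading LinearMap.id (W''.lie r X))) ∘ₗ
      (TensorProduct.assoc k W.carrier W'.carrier W''.carrier).toLinearMap) ?_ z
  have e1 : (LinearMap.id : W.carrier ⊗[k] W'.carrier →ₗ[k] W.carrier ⊗[k] W'.carrier) =
      superTensor W.grading W'.grading W'.grading LinearMap.id LinearMap.id := superTensor_id.symm
  have e2 : (LinearMap.id : W'.carrier ⊗[k] W''.carrier →ₗ[k] W'.carrier ⊗[k] W''.carrier) =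
      superTensor W'.grading W''.grading W''.grading LinearMap.id LinearMap.id :=
    superTensor_id.symm
  rw [e1, e2, superTensor_add_left, superTensor_add_right, LinearMap.comp_add, LinearMap.comp_add,
    superTensor_assoc, superTensor_assoc, superTensor_assoc, LinearMap.add_comp,
    LinearMap.add_comp, add_assoc]

theorem lid_mem (W : GSMod A 𝒱 Φ) :
    (TensorProduct.lid k W.carrier).toLinearMap ∈ homOfParity (tensor (triv A 𝒱 Φ) W) W 0 := by
  refine ⟨lid_parity, fun R _ _ g z => LinearMap.congr_fun (tensorEnd_lid _) z, fun r X z => ?_⟩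
  rw [koszul_zero_right, one_smul]
  refine LinearMap.congr_fun (f := (TensorProduct.lid k W.carrier).toLinearMap ∘ₗ
      (superTensor (unitGrading k) W.grading W.grading 0 LinearMap.id +
        superTensor (unitGrading k) W.grading W.grading LinearMap.id (W.lie r X)))
    (g := W.lie r X ∘ₗ (TensorProduct.lid k W.carrier).toLinearMap) ?_ z
  have : superTensor (unitGrading k) W.grading W.grading (0 : k →ₗ[k] k) LinearMap.id = 0 := by
    simp [superTensor]
  rw [this, zero_add, superTensor_lid]

theorem rid_mem (W : GSMod A 𝒱 Φ) :
    (TensorProduct.rid k W.carrier).toLinearMap ∈ homOfParity (tensor W (triv A 𝒱 Φ)) W 0 := by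
  refine ⟨rid_parity, fun R _ _ g z => LinearMap.congr_fun (tensorEnd_rid _) z, fun r X z => ?_⟩
  rw [koszul_zero_right, one_smul]
  refine LinearMap.congr_fun (f := (TensorProduct.rid k W.carrier).toLinearMap ∘ₗ
      (superTensor W.grading (unitGrading k) (unitGrading k) (W.lie r X) LinearMap.id +
        superTensor W.grading (unitGrading k) (unitGrading k) LinearMap.id 0))
    (g := W.lie r X ∘ₗ (TensorProduct.rid k W.carrier).toLinearMap) ?_ z
  have : superTensor W.grading (unitGrading k) (unitGrading k) (LinearMap.id : _ →ₗ[k] W.carrier)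
      (0 : k →ₗ[k] k) = 0 := by
    simp [superTensor, homComponent]
  rw [this, add_zero, superTensor_rid]

noncomputable instance : MonoidalSupercategory k (GSMod A 𝒱 Φ) where
  unit := triv A 𝒱 Φ
  tensorObj := tensor
  tensorHom := tensorMap
  tensorHom_mem hf hg := homOfParity_tensor hf hg
  tensorHom_id _ _ := Subtype.ext superTensor_id
  interchange {X Y Z X' Y' Z' p q f} g f' {g'} hf hg' := Subtype.ext (by
    refine homAll_induction (P := fun g => superTensor Y.grading Y'.grading Z'.grading f'.1 g'.1 ∘ₗ
        superTensor X.grading X'.grading Y'.grading f.1 g = koszul k p q •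
          superTensor X.grading X'.grading Z'.grading (f'.1 ∘ₗ f.1) (g'.1 ∘ₗ g))
      (fun a b ha hb => by
        rw [superTensor_add_right, LinearMap.comp_add, ha, hb, LinearMap.comp_add,
          superTensor_add_right, smul_add]) (fun s g hg => ?_) g.2
    exact superTensor_comp f'.1 hf.1 hg.1 hg'.1)
  assocIso W W' W'' := isoMk _ (assoc_mem W W' W'') (symm_mem (assoc_mem W W' W''))
  leftUnitor W := isoMk _ (lid_mem W) (symm_mem (lid_mem W))
  rightUnitor W := isoMk _ (rid_mem W) (symm_mem (rid_mem W))
  associator_mem W W' W'' := assoc_mem W W' W''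
  leftUnitor_mem := lid_mem
  rightUnitor_mem := rid_mem
  associator_naturality f g h := Subtype.ext (superTensor_assoc _ f.1 g.1 h.1)
  leftUnitor_naturality f := Subtype.ext (superTensor_lid f.1)
  rightUnitor_naturality f := Subtype.ext (superTensor_rid f.1)
  pentagon _ _ _ _ := Subtype.ext (superTensor_pentagon _)
  triangle _ _ := Subtype.ext superTensor_triangle

end GSMod

end SuperModules

end Supergroup

/-! ### Involutive superalgebras -/

section Involutive

variable {k : Type*} [Field k] {A : Type*} [Ring A] [Algebra k A]

/-- An anti-involution of the superalgebra `A`: a parity-preserving linear map `a ↦ a^⋆` with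
`(ab)^⋆ = (-1)^{ā b̄} b^⋆ a^⋆` and `(a^⋆)^⋆ = a`. -/
structure AntiInvolution (𝒜 : ZMod 2 → Submodule k A) where
  /-- The underlying linear map. -/
  toFun : A →ₗ[k] A
  map_mem {r : ZMod 2} {a : A} : a ∈ 𝒜 r → toFun a ∈ 𝒜 r
  map_mul {r s : ZMod 2} {a b : A} : a ∈ 𝒜 r → b ∈ 𝒜 s →
    toFun (a * b) = koszul k r s • (toFun b * toFun a)
  involutive (a : A) : toFun (toFun a) = a

end Involutive

section Actions

variable {k : Type*} [Field k] {A : Type*} [Ring A] [Algebra k A]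
  (𝒜 : ZMod 2 → Submodule k A) [IsSuperspace 𝒜]
  {V : Type*} [AddCommGroup V] [Module k V] [Module Aᵐᵒᵖ V] [IsScalarTower k Aᵐᵒᵖ V]
  (𝒱 : ZMod 2 → Submodule k V) [IsSuperspace 𝒱]

/-- The supertrace `str_V(a) = ∑_v (-1)^{v̄} v^*(va)` of the action of `a` on the right
`A`-supermodule `V`. -/
noncomputable def supertrace (a : A) : k :=
  LinearMap.trace k V (parityInv 𝒱 ∘ₗ rightMul k V a)

/-- The linear map `ρ_a : v ↦ (-1)^{ā v̄} v a`, extended linearly to all `a`. -/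
noncomputable def rho (a : A) : V →ₗ[k] V :=
  ∑ r : ZMod 2, rightMul k V (parityProj 𝒜 r a) ∘ₗ signMap 𝒱 r

/-- The grading of `A^{m|n}`, as the space of maps `Fin m ⊕ Fin n → A`: the last `n` coordinates
are parity shifted. -/
def freeGrading (m n : ℕ) (r : ZMod 2) : Submodule k (Fin m ⊕ Fin n → A) where
  carrier := {x | (∀ i, x (Sum.inl i) ∈ 𝒜 r) ∧ ∀ j, x (Sum.inr j) ∈ 𝒜 (r + 1)}
  add_mem' hx hy := ⟨fun i => add_mem (hx.1 i) (hy.1 i), fun j => add_mem (hx.2 j) (hy.2 j)⟩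
  zero_mem' := ⟨fun _ => zero_mem _, fun _ => zero_mem _⟩
  smul_mem' c _ hx :=
    ⟨fun i => Submodule.smul_mem _ c (hx.1 i), fun j => Submodule.smul_mem _ c (hx.2 j)⟩

end Actions

/-! ### The diagrammatic supercategory -/

section Brauer

variable {k : Type u} [Field k] {A : Type w} [Ring A] [Algebra k A]

/-- Formal linear combinations of homogeneous string diagrams from `m` strands (at the bottom) to
`n` strands (at the top). In `comp f g` the diagram `g` is on top of `f`; in `tensor f g` the
diagram `f` is to the left of `g`. The last index is the parity. The equations between the indices
are there so that no diagram has to be transported along an equality. -/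
inductive Diag (𝒜 : ZMod 2 → Submodule k A) (σ : ZMod 2) : ℕ → ℕ → ZMod 2 → Type (max u w)
  | id {m n : ℕ} (h : m = n) : Diag 𝒜 σ m n 0
  | comp {l m n : ℕ} {r s t : ZMod 2} (f : Diag 𝒜 σ l m r) (g : Diag 𝒜 σ m n s)
      (h : r + s = t) : Diag 𝒜 σ l n t
  | tensor {m n m' n' a b : ℕ} {r s t : ZMod 2} (f : Diag 𝒜 σ m n r) (g : Diag 𝒜 σ m' n' s)
      (ha : m + m' = a) (hb : n + n' = b) (h : r + s = t) : Diag 𝒜 σ a b t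
  | cross : Diag 𝒜 σ 2 2 0
  | cap : Diag 𝒜 σ 2 0 σ
  | cup : Diag 𝒜 σ 0 2 σ
  | tok {r : ZMod 2} (a : A) (ha : a ∈ 𝒜 r) : Diag 𝒜 σ 1 1 r
  | zero {m n : ℕ} {r : ZMod 2} : Diag 𝒜 σ m n r
  | add {m n : ℕ} {r : ZMod 2} (f g : Diag 𝒜 σ m n r) : Diag 𝒜 σ m n r
  | smul {m n : ℕ} {r : ZMod 2} (c : k) (f : Diag 𝒜 σ m n r) : Diag 𝒜 σ m n r

variable {𝒜 : ZMod 2 → Submodule k A}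

namespace Diag

variable {σ : ZMod 2}

/-- The diagram `f ⊗ 1`, with one identity strand to the right. -/
abbrev strandRight {m n : ℕ} {r : ZMod 2} (f : Diag 𝒜 σ m n r) : Diag 𝒜 σ (m + 1) (n + 1) r :=
  tensor f (id (rfl : 1 = 1)) rfl rfl (add_zero r)

/-- The diagram `1 ⊗ f`, with one identity strand to the left. -/
abbrev strandLeft {m n : ℕ} {r : ZMod 2} (f : Diag 𝒜 σ m n r) : Diag 𝒜 σ (1 + m) (1 + n) r :=
  tensor (id (rfl : 1 = 1)) f rfl rfl (zero_add r)

/-- The bubble with a token `a` on its right side. -/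
def bubble {r : ZMod 2} (a : A) (ha : a ∈ 𝒜 r) : Diag 𝒜 σ 0 0 r :=
  comp (comp cup (strandLeft (tok a ha)) rfl) cap
    (by rw [add_right_comm, CharTwo.add_self_eq_zero, zero_add])

end Diag

open Diag in
/-- The relations between diagrams: the axioms of a strict monoidal `k`-linear supercategory, the
defining relations, and, if `d` is an element of `k` (and not `none`), the relations
that evaluate the bubbles with specialization parameter `d`. -/
inductive DiagRel [SetLike.GradedMonoid 𝒜] [IsSuperspace 𝒜] (inv : AntiInvolution 𝒜) (σ : ZMod 2)
    (d : Option k) :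
    ∀ {m n : ℕ} {r : ZMod 2}, Diag 𝒜 σ m n r → Diag 𝒜 σ m n r → Prop
  /- congruence -/
  | comp_congr_left {l m n r s t} {f f' : Diag 𝒜 σ l m r} (g : Diag 𝒜 σ m n s) (h : r + s = t) :
      DiagRel inv σ d f f' → DiagRel inv σ d (comp f g h) (comp f' g h)
  | comp_congr_right {l m n r s t} (f : Diag 𝒜 σ l m r) {g g' : Diag 𝒜 σ m n s} (h : r + s = t) :
      DiagRel inv σ d g g' → DiagRel inv σ d (comp f g h) (comp f g' h)
  | tensor_congr_left {m n m' n' a b r s t} {f f' : Diag 𝒜 σ m n r} (g : Diag 𝒜 σ m' n' s)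
      (ha : m + m' = a) (hb : n + n' = b) (h : r + s = t) :
      DiagRel inv σ d f f' → DiagRel inv σ d (tensor f g ha hb h) (tensor f' g ha hb h)
  | tensor_congr_right {m n m' n' a b r s t} (f : Diag 𝒜 σ m n r) {g g' : Diag 𝒜 σ m' n' s}
      (ha : m + m' = a) (hb : n + n' = b) (h : r + s = t) :
      DiagRel inv σ d g g' → DiagRel inv σ d (tensor f g ha hb h) (tensor f g' ha hb h)
  | add_congr_left {m n r} {f f' : Diag 𝒜 σ m n r} (g : Diag 𝒜 σ m n r) :
      DiagRel inv σ d f f' → DiagRel inv σ d (add f g) (add f' g)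
  | add_congr_right {m n r} (f : Diag 𝒜 σ m n r) {g g' : Diag 𝒜 σ m n r} :
      DiagRel inv σ d g g' → DiagRel inv σ d (add f g) (add f g')
  | smul_congr {m n r} (c : k) {f f' : Diag 𝒜 σ m n r} :
      DiagRel inv σ d f f' → DiagRel inv σ d (smul c f) (smul c f')
  /- vector spaces -/
  | add_assoc {m n r} (f g h : Diag 𝒜 σ m n r) :
      DiagRel inv σ d (add (add f g) h) (add f (add g h))
  | add_comm {m n r} (f g : Diag 𝒜 σ m n r) : DiagRel inv σ d (add f g) (add g f)
  | zero_add {m n r} (f : Diag 𝒜 σ m n r) : DiagRel inv σ d (add zero f) f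
  | zero_smul {m n r} (f : Diag 𝒜 σ m n r) : DiagRel inv σ d (smul 0 f) zero
  | one_smul {m n r} (f : Diag 𝒜 σ m n r) : DiagRel inv σ d (smul 1 f) f
  | mul_smul {m n r} (c c' : k) (f : Diag 𝒜 σ m n r) :
      DiagRel inv σ d (smul (c * c') f) (smul c (smul c' f))
  | add_smul {m n r} (c c' : k) (f : Diag 𝒜 σ m n r) :
      DiagRel inv σ d (smul (c + c') f) (add (smul c f) (smul c' f))
  | smul_add {m n r} (c : k) (f g : Diag 𝒜 σ m n r) :
      DiagRel inv σ d (smul c (add f g)) (add (smul c f) (smul c g))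
  /- bilinearity -/
  | comp_add {l m n r s t} (f : Diag 𝒜 σ l m r) (g g' : Diag 𝒜 σ m n s) (h : r + s = t) :
      DiagRel inv σ d (comp f (add g g') h) (add (comp f g h) (comp f g' h))
  | add_comp {l m n r s t} (f f' : Diag 𝒜 σ l m r) (g : Diag 𝒜 σ m n s) (h : r + s = t) :
      DiagRel inv σ d (comp (add f f') g h) (add (comp f g h) (comp f' g h))
  | comp_smul {l m n r s t} (f : Diag 𝒜 σ l m r) (c : k) (g : Diag 𝒜 σ m n s) (h : r + s = t) :
      DiagRel inv σ d (comp f (smul c g) h) (smul c (comp f g h))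
  | smul_comp {l m n r s t} (c : k) (f : Diag 𝒜 σ l m r) (g : Diag 𝒜 σ m n s) (h : r + s = t) :
      DiagRel inv σ d (comp (smul c f) g h) (smul c (comp f g h))
  | tensor_add {m n m' n' a b r s t} (f : Diag 𝒜 σ m n r) (g g' : Diag 𝒜 σ m' n' s)
      (ha : m + m' = a) (hb : n + n' = b) (h : r + s = t) :
      DiagRel inv σ d (tensor f (add g g') ha hb h) (add (tensor f g ha hb h) (tensor f g' ha hb h))
  | add_tensor {m n m' n' a b r s t} (f f' : Diag 𝒜 σ m n r) (g : Diag 𝒜 σ m' n' s)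
      (ha : m + m' = a) (hb : n + n' = b) (h : r + s = t) :
      DiagRel inv σ d (tensor (add f f') g ha hb h) (add (tensor f g ha hb h) (tensor f' g ha hb h))
  | tensor_smul {m n m' n' a b r s t} (f : Diag 𝒜 σ m n r) (c : k) (g : Diag 𝒜 σ m' n' s)
      (ha : m + m' = a) (hb : n + n' = b) (h : r + s = t) :
      DiagRel inv σ d (tensor f (smul c g) ha hb h) (smul c (tensor f g ha hb h))
  | smul_tensor {m n m' n' a b r s t} (c : k) (f : Diag 𝒜 σ m n r) (g : Diag 𝒜 σ m' n' s)
      (ha : m + m' = a) (hb : n + n' = b) (h : r + s = t) :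
      DiagRel inv σ d (tensor (smul c f) g ha hb h) (smul c (tensor f g ha hb h))
  /- strict monoidal supercategories -/
  | id_comp {m n r} (f : Diag 𝒜 σ m n r) : DiagRel inv σ d (comp (id rfl) f (_root_.zero_add r)) f
  | comp_id {m n r} (f : Diag 𝒜 σ m n r) : DiagRel inv σ d (comp f (id rfl) (add_zero r)) f
  | comp_assoc {l m n p r s t rs st v} (f : Diag 𝒜 σ l m r) (g : Diag 𝒜 σ m n s)
      (g' : Diag 𝒜 σ n p t) (h₁ : r + s = rs) (h₂ : rs + t = v) (h₃ : s + t = st)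
      (h₄ : r + st = v) :
      DiagRel inv σ d (comp (comp f g h₁) g' h₂) (comp f (comp g g' h₃) h₄)
  | tensor_id {m n a b} (ha : m + n = a) (hb : m + n = b) :
      DiagRel inv σ d (tensor (id (rfl : m = m)) (id (rfl : n = n)) ha hb (add_zero 0))
        (id (ha.symm.trans hb))
  | interchange {l m n l' m' n' a b c r s r' s' rs rs' v w t} (f : Diag 𝒜 σ l m r)
      (g : Diag 𝒜 σ l' m' s) (f' : Diag 𝒜 σ m n r') (g' : Diag 𝒜 σ m' n' s')
      (ha : l + l' = a) (hb : m + m' = b) (hc : n + n' = c) (h₁ : r + s = rs)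
      (h₂ : r' + s' = rs') (h₃ : rs + rs' = t) (h₄ : r + r' = v) (h₅ : s + s' = w)
      (h₆ : v + w = t) :
      DiagRel inv σ d (comp (tensor f g ha hb h₁) (tensor f' g' hb hc h₂) h₃)
        (smul (koszul k r s') (tensor (comp f f' h₄) (comp g g' h₅) ha hc h₆))
  | tensor_assoc {m n m' n' m'' n'' a a' b b' c e r s t rs st v} (f : Diag 𝒜 σ m n r)
      (g : Diag 𝒜 σ m' n' s) (g' : Diag 𝒜 σ m'' n'' t)
      (ha : m + m' = a) (ha' : n + n' = a') (hb : m' + m'' = b) (hb' : n' + n'' = b')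
      (h₁ : a + m'' = c) (h₂ : a' + n'' = e) (h₃ : m + b = c) (h₄ : n + b' = e)
      (h₅ : r + s = rs) (h₆ : rs + t = v) (h₇ : s + t = st) (h₈ : r + st = v) :
      DiagRel inv σ d (tensor (tensor f g ha ha' h₅) g' h₁ h₂ h₆)
        (tensor f (tensor g g' hb hb' h₇) h₃ h₄ h₈)
  | unit_tensor {m n r} (f : Diag 𝒜 σ m n r) :
      DiagRel inv σ d
        (tensor (id (rfl : 0 = 0)) f (Nat.zero_add m) (Nat.zero_add n) (_root_.zero_add r)) f
  | tensor_unit {m n r} (f : Diag 𝒜 σ m n r) :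
      DiagRel inv σ d (tensor f (id (rfl : 0 = 0)) (Nat.add_zero m) (Nat.add_zero n) (add_zero r)) f
  /- the Brauer relations -/
  | cross_cross : DiagRel inv σ d (comp cross cross (add_zero 0)) (id rfl)
  | braid : DiagRel inv σ d
      (comp (comp (strandRight cross) (strandLeft cross) (add_zero 0)) (strandRight cross)
        (add_zero 0))
      (comp (comp (strandLeft cross) (strandRight cross) (add_zero 0)) (strandLeft cross)
        (add_zero 0))
  | snake : DiagRel inv σ d
      (comp (strandRight cup) (strandLeft cap) (CharTwo.add_self_eq_zero σ)) (id rfl)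
  | snake' : DiagRel inv σ d (id rfl)
      (smul (koszul k σ 1)
        (comp (strandLeft cup) (strandRight cap) (CharTwo.add_self_eq_zero σ)))
  | cross_cap : DiagRel inv σ d (comp cross cap (_root_.zero_add σ)) cap
  | slide : DiagRel inv σ d (comp (strandRight cross) (strandLeft cap) (_root_.zero_add σ))
      (comp (strandLeft cross) (strandRight cap) (_root_.zero_add σ))
  /- the token relations -/
  | tok_one : DiagRel inv σ d (tok (1 : A) SetLike.GradedOne.one_mem) (id rfl)
  | tok_add {r a b} (ha : a ∈ 𝒜 r) (hb : b ∈ 𝒜 r) :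
      DiagRel inv σ d (add (tok a ha) (tok b hb)) (tok (a + b) (add_mem ha hb))
  | tok_smul {r a} (c : k) (ha : a ∈ 𝒜 r) :
      DiagRel inv σ d (smul c (tok a ha)) (tok (c • a) (Submodule.smul_mem _ c ha))
  | tok_mul {r s a b} (ha : a ∈ 𝒜 r) (hb : b ∈ 𝒜 s) :
      DiagRel inv σ d (comp (tok b hb) (tok a ha) (_root_.add_comm s r))
        (tok (a * b) (SetLike.GradedMul.mul_mem ha hb))
  | tok_cross {r a} (ha : a ∈ 𝒜 r) :
      DiagRel inv σ d (comp (strandRight (tok a ha)) cross (add_zero r))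
        (comp cross (strandLeft (tok a ha)) (_root_.zero_add r))
  | tok_cap {r a} (ha : a ∈ 𝒜 r) :
      DiagRel inv σ d (comp (strandRight (tok a ha)) cap rfl)
        (comp (strandLeft (tok (inv.toFun a) (inv.map_mem ha))) cap rfl)
  /- the specialization relation -/
  | bubble_even {a} (ha : a ∈ 𝒜 0) (c : k) (hc : d = some c) :
      DiagRel inv σ d (bubble a ha) (smul (c * supertrace 𝒜 a) (id rfl))
  | bubble_odd {a} (ha : a ∈ 𝒜 1) (c : k) (hc : d = some c) : DiagRel inv σ d (bubble a ha) zero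

variable [SetLike.GradedMonoid 𝒜] [IsSuperspace 𝒜] (inv : AntiInvolution 𝒜) (σ : ZMod 2)
  (d : Option k)

/-- The homogeneous morphisms of parity `r` from `m` to `n` strands. -/
def DiagSpace (m n : ℕ) (r : ZMod 2) : Type (max u w) := Quot (DiagRel inv σ d (m := m) (n := n) (r := r))

variable {inv σ d}

/-- The class of a diagram. -/
def DiagSpace.mk {m n : ℕ} {r : ZMod 2} (f : Diag 𝒜 σ m n r) : DiagSpace inv σ d m n r :=
  Quot.mk _ f

namespace DiagSpace

theorem ind {m n : ℕ} {r : ZMod 2} {P : DiagSpace inv σ d m n r → Prop}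
    (h : ∀ f, P (mk f)) (x : DiagSpace inv σ d m n r) : P x := Quot.ind h x

theorem sound {m n : ℕ} {r : ZMod 2} {f g : Diag 𝒜 σ m n r} (h : DiagRel inv σ d f g) :
    (mk f : DiagSpace inv σ d m n r) = mk g := Quot.sound h

instance (m n : ℕ) (r : ZMod 2) : Add (DiagSpace inv σ d m n r) :=
  ⟨Quot.map₂ Diag.add (fun f _ _ h => .add_congr_right f h) (fun _ _ g h => .add_congr_left g h)⟩

instance (m n : ℕ) (r : ZMod 2) : Zero (DiagSpace inv σ d m n r) := ⟨mk .zero⟩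

instance (m n : ℕ) (r : ZMod 2) : SMul k (DiagSpace inv σ d m n r) :=
  ⟨fun c => Quot.map (Diag.smul c) (fun _ _ h => .smul_congr c h)⟩

instance (m n : ℕ) (r : ZMod 2) : Neg (DiagSpace inv σ d m n r) := ⟨fun x => (-1 : k) • x⟩

theorem mk_add {m n : ℕ} {r : ZMod 2} (f g : Diag 𝒜 σ m n r) :
    (mk (f.add g) : DiagSpace inv σ d m n r) = mk f + mk g := rfl

theorem mk_smul {m n : ℕ} {r : ZMod 2} (c : k) (f : Diag 𝒜 σ m n r) :
    (mk (f.smul c) : DiagSpace inv σ d m n r) = c • mk f := rfl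

private theorem zero_add' {m n : ℕ} {r : ZMod 2} (x : DiagSpace inv σ d m n r) : 0 + x = x :=
  ind (P := fun x => 0 + x = x) (fun f => sound (.zero_add f)) x

private theorem add_comm' {m n : ℕ} {r : ZMod 2} (x y : DiagSpace inv σ d m n r) :
    x + y = y + x := by
  induction x using ind; induction y using ind; exact sound (.add_comm _ _)

instance (m n : ℕ) (r : ZMod 2) : AddCommGroup (DiagSpace inv σ d m n r) where
  add_assoc x y z := by
    induction x using ind; induction y using ind; induction z using ind
    exact sound (.add_assoc _ _ _)
  zero_add := zero_add'
  add_zero x := by rw [add_comm', zero_add']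
  add_comm := add_comm'
  nsmul := nsmulRec
  zsmul := zsmulRec
  neg_add_cancel x := by
    induction x using ind with
    | h f =>
      have h1 : (mk (f.smul 1) : DiagSpace inv σ d m n r) = mk f := sound (.one_smul f)
      have h2 : (mk (f.smul (-1 + 1)) : DiagSpace inv σ d m n r) =
        mk ((f.smul (-1)).add (f.smul 1)) := sound (.add_smul _ _ f)
      rw [neg_add_cancel, mk_add, h1, sound (.zero_smul f)] at h2
      exact h2.symm

instance (m n : ℕ) (r : ZMod 2) : Module k (DiagSpace inv σ d m n r) where
  one_smul x := by induction x using ind; exact sound (.one_smul _)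
  mul_smul c c' x := by induction x using ind; exact sound (.mul_smul _ _ _)
  smul_zero c := by
    have h : (0 : DiagSpace inv σ d m n r) = (0 : k) • mk .zero := (sound (.zero_smul _)).symm
    rw [h, ← mk_smul, ← mk_smul, ← sound (.mul_smul c 0 _), mul_zero]
  smul_add c x y := by
    induction x using ind; induction y using ind; exact sound (.smul_add _ _ _)
  add_smul c c' x := by induction x using ind; exact sound (.add_smul _ _ _)
  zero_smul x := by induction x using ind; exact sound (.zero_smul _)

/-- Composition of homogeneous morphisms. -/
def comp {l m n : ℕ} {r s t : ZMod 2} (h : r + s = t) :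
    DiagSpace inv σ d l m r →ₗ[k] DiagSpace inv σ d m n s →ₗ[k] DiagSpace inv σ d l n t :=
  LinearMap.mk₂ k
    (Quot.map₂ (fun f g => Diag.comp f g h) (fun f _ _ e => .comp_congr_right f h e)
      (fun _ _ g e => .comp_congr_left g h e))
    (fun x y z => by
      induction x using ind; induction y using ind; induction z using ind
      exact sound (.add_comp _ _ _ h))
    (fun c x y => by induction x using ind; induction y using ind; exact sound (.smul_comp c _ _ h))
    (fun x y z => by
      induction x using ind; induction y using ind; induction z using ind
      exact sound (.comp_add _ _ _ h))
    (fun c x y => by induction x using ind; induction y using ind; exact sound (.comp_smul _ c _ h))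

/-- Tensor product of homogeneous morphisms. -/
def tensor {m n m' n' : ℕ} {r s t : ZMod 2} (h : r + s = t) :
    DiagSpace inv σ d m n r →ₗ[k] DiagSpace inv σ d m' n' s →ₗ[k]
      DiagSpace inv σ d (m + m') (n + n') t :=
  LinearMap.mk₂ k
    (Quot.map₂ (fun f g => Diag.tensor f g rfl rfl h)
      (fun f _ _ e => .tensor_congr_right f rfl rfl h e)
      (fun _ _ g e => .tensor_congr_left g rfl rfl h e))
    (fun x y z => by
      induction x using ind; induction y using ind; induction z using ind
      exact sound (.add_tensor _ _ _ rfl rfl h))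
    (fun c x y => by
      induction x using ind; induction y using ind; exact sound (.smul_tensor c _ _ rfl rfl h))
    (fun x y z => by
      induction x using ind; induction y using ind; induction z using ind
      exact sound (.tensor_add _ _ _ rfl rfl h))
    (fun c x y => by
      induction x using ind; induction y using ind; exact sound (.tensor_smul _ c _ rfl rfl h))

end DiagSpace

variable (inv σ d)

/-- All morphisms from `m` to `n` strands: pairs consisting of an even and an odd one. -/
abbrev BrauerHom (m n : ℕ) : Type (max u w) := ∀ r : ZMod 2, DiagSpace inv σ d m n r

variable {inv σ d}

namespace BrauerHom

/-- The morphism represented by a diagram. -/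
def of {m n : ℕ} {r : ZMod 2} (f : Diag 𝒜 σ m n r) : BrauerHom inv σ d m n :=
  Pi.single r (DiagSpace.mk f)

/-- The bilinear extension to all morphisms of a family of bilinear maps on homogeneous ones. -/
def extend {m n m' n' a b : ℕ}
    (B : ∀ r s : ZMod 2, DiagSpace inv σ d m n r →ₗ[k] DiagSpace inv σ d m' n' s →ₗ[k]
      DiagSpace inv σ d a b (r + s)) :
    BrauerHom inv σ d m n →ₗ[k] BrauerHom inv σ d m' n' →ₗ[k] BrauerHom inv σ d a b :=
  ∑ r : ZMod 2, ∑ s : ZMod 2,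
    ((B r s).compr₂ (LinearMap.single k (DiagSpace inv σ d a b) (r + s))).compl₁₂
      (LinearMap.proj r) (LinearMap.proj s)

theorem extend_single {m n m' n' a b : ℕ}
    (B : ∀ r s : ZMod 2, DiagSpace inv σ d m n r →ₗ[k] DiagSpace inv σ d m' n' s →ₗ[k]
      DiagSpace inv σ d a b (r + s)) (r s : ZMod 2) (x : DiagSpace inv σ d m n r)
      (y : DiagSpace inv σ d m' n' s) :
    extend B (Pi.single r x) (Pi.single s y) = Pi.single (r + s) (B r s x y) := by
  simp only [extend, LinearMap.sum_apply, LinearMap.compl₁₂_apply, LinearMap.compr₂_apply,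
    LinearMap.proj_apply, LinearMap.coe_single]
  rw [Finset.sum_eq_single r, Finset.sum_eq_single s]
  · simp
  · intro s' _ hs'
    rw [Pi.single_eq_of_ne hs']; simp
  · simp
  · intro r' _ hr'
    refine Finset.sum_eq_zero fun s' _ => ?_
    rw [Pi.single_eq_of_ne hr']; simp
  · simp

/-- Composition of morphisms. -/
def comp {l m n : ℕ} :
    BrauerHom inv σ d l m →ₗ[k] BrauerHom inv σ d m n →ₗ[k] BrauerHom inv σ d l n :=
  extend fun _ _ => DiagSpace.comp rfl

/-- Tensor product of morphisms. -/
def tensor {m n m' n' : ℕ} :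
    BrauerHom inv σ d m n →ₗ[k] BrauerHom inv σ d m' n' →ₗ[k]
      BrauerHom inv σ d (m + m') (n + n') :=
  extend fun _ _ => DiagSpace.tensor rfl

theorem comp_of {l m n : ℕ} {r s t : ZMod 2} (f : Diag 𝒜 σ l m r) (g : Diag 𝒜 σ m n s)
    (h : r + s = t) :
    comp (of f : BrauerHom inv σ d l m) (of g) = of (Diag.comp f g h) := by
  subst h; exact extend_single _ r s _ _

theorem tensor_of {m n m' n' : ℕ} {r s t : ZMod 2} (f : Diag 𝒜 σ m n r) (g : Diag 𝒜 σ m' n' s)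
    (h : r + s = t) :
    tensor (of f : BrauerHom inv σ d m n) (of g) = of (Diag.tensor f g rfl rfl h) := by
  subst h; exact extend_single _ r s _ _

theorem of_eq {m n : ℕ} {r : ZMod 2} {f g : Diag 𝒜 σ m n r} (h : DiagRel inv σ d f g) :
    (of f : BrauerHom inv σ d m n) = of g := by rw [of, DiagSpace.sound h, of]

theorem of_smul {m n : ℕ} {r : ZMod 2} (c : k) (f : Diag 𝒜 σ m n r) :
    (of (f.smul c) : BrauerHom inv σ d m n) = c • of f := by
  rw [of, DiagSpace.mk_smul, of, Pi.single_smul]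

theorem of_zero {m n : ℕ} {r : ZMod 2} :
    (of (Diag.zero : Diag 𝒜 σ m n r) : BrauerHom inv σ d m n) = 0 := Pi.single_zero r

theorem induction {m n : ℕ} {P : BrauerHom inv σ d m n → Prop}
    (hadd : ∀ f g, P f → P g → P (f + g)) (h : ∀ r (f : Diag 𝒜 σ m n r), P (of f))
    (f : BrauerHom inv σ d m n) : P f := by
  have key : f = Pi.single 0 (f 0) + Pi.single 1 (f 1) := by
    funext r
    obtain rfl | rfl := zmod_two_cases r <;> simp
  rw [key]
  have hs : ∀ r (x : DiagSpace inv σ d m n r), P (Pi.single r x) := fun r x => by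
    induction x using DiagSpace.ind with
    | h f => exact h r f
  exact hadd _ _ (hs _ _) (hs _ _)

theorem hom_ext {m n : ℕ} {M : Type*} [AddCommGroup M] [Module k M]
    {F G : BrauerHom inv σ d m n →ₗ[k] M} (h : ∀ r (f : Diag 𝒜 σ m n r), F (of f) = G (of f)) :
    F = G :=
  LinearMap.ext fun f => induction (P := fun f => F f = G f)
    (fun a b ha hb => by rw [map_add, map_add, ha, hb]) h f

/-- The identity, for numbers of strands that are equal. -/
abbrev idOf {m n : ℕ} (h : m = n) : BrauerHom inv σ d m n := of (Diag.id h)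

theorem id_comp {m n : ℕ} (f : BrauerHom inv σ d m n) : comp (idOf rfl) f = f := by
  induction f using induction with
  | hadd f g hf hg => rw [map_add, hf, hg]
  | h r f => rw [comp_of _ _ (zero_add r)]; exact of_eq (.id_comp f)

theorem comp_id {m n : ℕ} (f : BrauerHom inv σ d m n) : comp f (idOf rfl) = f := by
  induction f using induction with
  | hadd f g hf hg => rw [map_add, LinearMap.add_apply, hf, hg]
  | h r f => rw [comp_of _ _ (add_zero r)]; exact of_eq (.comp_id f)

theorem idOf_comp_idOf {l m n : ℕ} (h : l = m) (h' : m = n) :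
    comp (idOf h : BrauerHom inv σ d l m) (idOf h') = idOf (h.trans h') := by
  subst h h'; exact id_comp _

theorem tensor_idOf {m n m' n' : ℕ} (h : m = n) (h' : m' = n') :
    tensor (idOf h : BrauerHom inv σ d m n) (idOf h') = idOf (by rw [h, h']) := by
  subst h h'
  rw [tensor_of _ _ (add_zero 0)]
  exact of_eq (.tensor_id rfl rfl)

theorem comp_assoc {l m n p : ℕ} (f : BrauerHom inv σ d l m) (g : BrauerHom inv σ d m n)
    (h : BrauerHom inv σ d n p) : comp (comp f g) h = comp f (comp g h) := by
  induction f using induction with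
  | hadd f g hf hg => simp only [map_add, LinearMap.add_apply, hf, hg]
  | h r f =>
  induction g using induction with
  | hadd f g hf hg => simp only [map_add, LinearMap.add_apply, hf, hg]
  | h s g =>
  induction h using induction with
  | hadd f g hf hg => simp only [map_add, hf, hg]
  | h t h =>
  rw [comp_of f g rfl, comp_of g h rfl, comp_of _ _ rfl, comp_of _ _ (add_assoc r s t).symm]
  exact of_eq (.comp_assoc _ _ _ _ _ _ _)

theorem tensor_assoc {m n m' n' m'' n'' : ℕ} (f : BrauerHom inv σ d m n)
    (g : BrauerHom inv σ d m' n') (h : BrauerHom inv σ d m'' n'') :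
    comp (tensor (tensor f g) h) (idOf (Nat.add_assoc n n' n'')) =
      comp (idOf (Nat.add_assoc m m' m'')) (tensor f (tensor g h)) := by
  induction f using induction with
  | hadd f g hf hg => simp only [map_add, LinearMap.add_apply, hf, hg]
  | h r f =>
  induction g using induction with
  | hadd f g hf hg => simp only [map_add, LinearMap.add_apply, hf, hg]
  | h s g =>
  induction h using induction with
  | hadd f g hf hg => simp only [map_add, LinearMap.add_apply, hf, hg]
  | h t h =>
  rw [tensor_of f g rfl, tensor_of g h rfl, tensor_of _ _ rfl, tensor_of _ _ (add_assoc r s t).symm]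
  have key : ∀ {a b : ℕ} (ha : m + m' + m'' = a) (hb : n + n' + n'' = b)
      (ha' : m + (m' + m'') = a) (hb' : n + (n' + n'') = b),
      comp (of (Diag.tensor (Diag.tensor f g rfl rfl rfl) h rfl rfl rfl) :
        BrauerHom inv σ d _ _) (idOf hb) =
      comp (idOf ha) (of (Diag.tensor f (Diag.tensor g h rfl rfl rfl) ha' hb'
        (add_assoc r s t).symm)) := by
    intro a b ha hb ha' hb'
    subst ha hb
    rw [id_comp, comp_id]
    exact of_eq (.tensor_assoc _ _ _ _ _ _ _ _ _ _ _ _ _ _ _)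
  exact key _ _ rfl rfl

theorem unit_tensor {m n : ℕ} (f : BrauerHom inv σ d m n) :
    comp (tensor (idOf (rfl : 0 = 0)) f) (idOf (Nat.zero_add n)) =
      comp (idOf (Nat.zero_add m)) f := by
  induction f using induction with
  | hadd f g hf hg => simp only [map_add, LinearMap.add_apply, hf, hg]
  | h r f =>
  rw [tensor_of _ _ (zero_add r), ← of_eq (.unit_tensor f)]
  have key : ∀ {a b : ℕ} (ha : 0 + m = a) (hb : 0 + n = b),
      comp (of (Diag.tensor (Diag.id (rfl : 0 = 0)) f rfl rfl (zero_add r)) :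
        BrauerHom inv σ d _ _) (idOf hb) =
      comp (idOf ha) (of (Diag.tensor (Diag.id (rfl : 0 = 0)) f ha hb (zero_add r))) := by
    intro a b ha hb
    subst ha hb
    rw [id_comp, comp_id]
  exact key _ _

theorem tensor_unit {m n : ℕ} (f : BrauerHom inv σ d m n) :
    tensor f (idOf (rfl : 0 = 0)) = f := by
  induction f using induction with
  | hadd f g hf hg => simp only [map_add, LinearMap.add_apply, hf, hg]
  | h r f =>
  rw [tensor_of _ _ (add_zero r)]
  exact of_eq (.tensor_unit f)

theorem tensor_unit' {m n : ℕ} (f : BrauerHom inv σ d m n) :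
    comp (tensor f (idOf (rfl : 0 = 0))) (idOf (Nat.add_zero n)) =
      comp (idOf (Nat.add_zero m)) f :=
  (comp_id _).trans ((tensor_unit f).trans (id_comp f).symm)

variable (inv σ d) in
/-- The morphisms that are homogeneous of parity `r`. -/
def part (m n : ℕ) (r : ZMod 2) : Submodule k (BrauerHom inv σ d m n) :=
  LinearMap.range (LinearMap.single k (DiagSpace inv σ d m n) r)

theorem of_mem {m n : ℕ} {r : ZMod 2} (f : Diag 𝒜 σ m n r) :
    (of f : BrauerHom inv σ d m n) ∈ part inv σ d m n r := ⟨_, rfl⟩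

theorem exists_of {m n : ℕ} {r : ZMod 2} {f : BrauerHom inv σ d m n}
    (hf : f ∈ part inv σ d m n r) : ∃ f' : Diag 𝒜 σ m n r, f = of f' := by
  obtain ⟨x, rfl⟩ := hf
  induction x using DiagSpace.ind with
  | h f => exact ⟨f, rfl⟩

instance (m n : ℕ) : IsSuperspace (part inv σ d m n) where
  isCompl := by
    constructor
    · rw [Submodule.disjoint_def]
      rintro _ ⟨x, rfl⟩ ⟨y, h⟩
      have h0 := congrFun h 0
      simp only [LinearMap.coe_single, Pi.single_eq_same] at h0
      rw [Pi.single_eq_of_ne (by decide)] at h0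
      rw [← h0, map_zero]
    · rw [codisjoint_iff, eq_top_iff]
      intro f _
      induction f using induction with
      | hadd f g hf hg => exact add_mem (hf trivial) (hg trivial)
      | h r f =>
        obtain rfl | rfl := zmod_two_cases r
        · exact Submodule.mem_sup_left (of_mem f)
        · exact Submodule.mem_sup_right (of_mem f)

theorem comp_mem {l m n : ℕ} {r s : ZMod 2} {f : BrauerHom inv σ d l m}
    {g : BrauerHom inv σ d m n} (hf : f ∈ part inv σ d l m r) (hg : g ∈ part inv σ d m n s) :
    comp f g ∈ part inv σ d l n (r + s) := by
  obtain ⟨f, rfl⟩ := exists_of hf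
  obtain ⟨g, rfl⟩ := exists_of hg
  rw [comp_of f g rfl]; exact of_mem _

theorem tensor_mem {m n m' n' : ℕ} {r s : ZMod 2} {f : BrauerHom inv σ d m n}
    {g : BrauerHom inv σ d m' n'} (hf : f ∈ part inv σ d m n r) (hg : g ∈ part inv σ d m' n' s) :
    tensor f g ∈ part inv σ d (m + m') (n + n') (r + s) := by
  obtain ⟨f, rfl⟩ := exists_of hf
  obtain ⟨g, rfl⟩ := exists_of hg
  rw [tensor_of f g rfl]; exact of_mem _

theorem interchange {l m n l' m' n' : ℕ} {p q : ZMod 2} {f : BrauerHom inv σ d l m}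
    (g : BrauerHom inv σ d l' m') (f' : BrauerHom inv σ d m n) {g' : BrauerHom inv σ d m' n'}
    (hf : f ∈ part inv σ d l m p) (hg' : g' ∈ part inv σ d m' n' q) :
    comp (tensor f g) (tensor f' g') = koszul k p q • tensor (comp f f') (comp g g') := by
  obtain ⟨f, rfl⟩ := exists_of hf
  obtain ⟨g', rfl⟩ := exists_of hg'
  induction g using induction with
  | hadd f g hf hg => simp only [map_add, LinearMap.add_apply, hf, hg, smul_add]
  | h s g =>
  induction f' using induction with
  | hadd f g hf hg => simp only [map_add, LinearMap.add_apply, hf, hg, smul_add]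
  | h r f' =>
  rw [tensor_of f g rfl, tensor_of f' g' rfl, comp_of _ _ rfl, comp_of f f' rfl, comp_of g g' rfl,
    tensor_of _ _ (add_add_add_comm p r s q), ← of_smul]
  exact of_eq (.interchange _ _ _ _ _ _ _ _ _ _ _ _ _)

end BrauerHom

/-- The strict monoidal supercategory of diagrams. For `d = none` it is generated, as a strict
monoidal supercategory, by one object, crossing, cap, cup and tokens, subject to the Brauer and token
relations; for `d = some c` it is the quotient with specialization parameter `c`. Its objects are
the tensor powers of the generating object. -/
@[ext]
structure Brauer (inv : AntiInvolution 𝒜) (σ : ZMod 2) (d : Option k) where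
  /-- The object is the tensor power of the generating object with this exponent. -/
  strands : ℕ

namespace Brauer

instance : Category (Brauer inv σ d) where
  Hom X Y := BrauerHom inv σ d X.strands Y.strands
  id _ := BrauerHom.idOf rfl
  comp f g := BrauerHom.comp f g
  id_comp := BrauerHom.id_comp
  comp_id := BrauerHom.comp_id
  assoc := BrauerHom.comp_assoc

instance : Preadditive (Brauer inv σ d) where
  homGroup X Y := inferInstanceAs (AddCommGroup (BrauerHom inv σ d X.strands Y.strands))
  add_comp _ _ _ f f' g := LinearMap.map_add₂ BrauerHom.comp f f' g
  comp_add _ _ _ f g g' := (BrauerHom.comp f).map_add g g'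

instance : Linear k (Brauer inv σ d) where
  homModule X Y := inferInstanceAs (Module k (BrauerHom inv σ d X.strands Y.strands))
  smul_comp _ _ _ c f g := LinearMap.map_smul₂ BrauerHom.comp c f g
  comp_smul _ _ _ f c g := (BrauerHom.comp f).map_smul c g

instance : Supercategory k (Brauer inv σ d) where
  homPart X Y := BrauerHom.part inv σ d X.strands Y.strands
  isSuperspace X Y := inferInstanceAs (IsSuperspace (BrauerHom.part inv σ d X.strands Y.strands))
  id_mem _ := BrauerHom.of_mem _
  comp_mem := BrauerHom.comp_mem

/-- The identity morphism between objects that are equal. -/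
def idIso {X Y : Brauer inv σ d} (h : X.strands = Y.strands) : X ≅ Y where
  hom := BrauerHom.idOf h
  inv := BrauerHom.idOf h.symm
  hom_inv_id := BrauerHom.idOf_comp_idOf _ _
  inv_hom_id := BrauerHom.idOf_comp_idOf _ _

instance : MonoidalSupercategory k (Brauer inv σ d) where
  unit := ⟨0⟩
  tensorObj X Y := ⟨X.strands + Y.strands⟩
  tensorHom := BrauerHom.tensor
  tensorHom_mem := BrauerHom.tensor_mem
  tensorHom_id _ _ := BrauerHom.tensor_idOf _ _
  interchange := BrauerHom.interchange
  assocIso X Y Z := idIso (Nat.add_assoc _ _ _)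
  leftUnitor X := idIso (Nat.zero_add _)
  rightUnitor X := idIso (Nat.add_zero _)
  associator_mem _ _ _ := BrauerHom.of_mem _
  leftUnitor_mem _ := BrauerHom.of_mem _
  rightUnitor_mem _ := BrauerHom.of_mem _
  associator_naturality := BrauerHom.tensor_assoc
  leftUnitor_naturality := BrauerHom.unit_tensor
  rightUnitor_naturality := BrauerHom.tensor_unit'
  pentagon W X Y Z := by
    change BrauerHom.comp (BrauerHom.tensor (BrauerHom.idOf _) (BrauerHom.idOf _))
      (BrauerHom.comp (BrauerHom.idOf _) (BrauerHom.tensor (BrauerHom.idOf _) (BrauerHom.idOf _))) =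
      BrauerHom.comp (BrauerHom.idOf _) (BrauerHom.idOf _)
    simp only [BrauerHom.tensor_idOf, BrauerHom.idOf_comp_idOf]
  triangle X Y := by
    change BrauerHom.comp (BrauerHom.idOf _)
      (BrauerHom.tensor (BrauerHom.idOf _) (BrauerHom.idOf _)) =
      BrauerHom.tensor (BrauerHom.idOf _) (BrauerHom.idOf _)
    simp only [BrauerHom.tensor_idOf, BrauerHom.idOf_comp_idOf]

open MonoidalSupercategory

variable (inv σ d)

/-- The generating object. -/
def go : Brauer inv σ d := ⟨1⟩

/-- The crossing. -/
def cross : tensorObj k (go inv σ d) (go inv σ d) ⟶ tensorObj k (go inv σ d) (go inv σ d) :=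
  (BrauerHom.of Diag.cross : BrauerHom inv σ d 2 2)

/-- The cap. -/
def cap : tensorObj k (go inv σ d) (go inv σ d) ⟶ unit k :=
  (BrauerHom.of Diag.cap : BrauerHom inv σ d 2 0)

/-- The cup. -/
def cup : unit k ⟶ tensorObj k (go inv σ d) (go inv σ d) :=
  (BrauerHom.of Diag.cup : BrauerHom inv σ d 0 2)

variable {σ} in
/-- The token labelled by an element `a` of `A`. -/
noncomputable def token (a : A) : go inv σ d ⟶ go inv σ d :=
  fun r => DiagSpace.mk (Diag.tok (parityProj 𝒜 r a) (parityProj_mem 𝒜 r a))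

/-- The bubble with a token labelled by an element `a` of `A` on its right side. -/
noncomputable def bubble (a : A) : (unit k : Brauer inv σ d) ⟶ unit k :=
  cup inv σ d ≫ tensorHom (k := k) (𝟙 (go inv σ d)) (token inv d a) ≫ cap inv σ d

end Brauer

end Brauer

/-! ### The quotient superfunctor -/

section Quotient

variable {k : Type u} [Field k] {A : Type w} [Ring A] [Algebra k A]
  {𝒜 : ZMod 2 → Submodule k A} [SetLike.GradedMonoid 𝒜] [IsSuperspace 𝒜]
  {inv : AntiInvolution 𝒜} {σ : ZMod 2}

theorem DiagRel.of_none (d : Option k) {m n : ℕ} {r : ZMod 2} {f g : Diag 𝒜 σ m n r}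
    (h : DiagRel inv σ none f g) : DiagRel inv σ d f g := by
  induction h with
  | bubble_even _ _ hc => exact (Option.some_ne_none _ hc.symm).elim
  | bubble_odd _ _ hc => exact (Option.some_ne_none _ hc.symm).elim
  | comp_congr_left _ _ _ ih => exact .comp_congr_left _ _ ih
  | comp_congr_right _ _ _ ih => exact .comp_congr_right _ _ ih
  | tensor_congr_left _ _ _ _ _ ih => exact .tensor_congr_left _ _ _ _ ih
  | tensor_congr_right _ _ _ _ _ ih => exact .tensor_congr_right _ _ _ _ ih
  | add_congr_left _ _ ih => exact .add_congr_left _ ih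
  | add_congr_right _ _ ih => exact .add_congr_right _ ih
  | smul_congr _ _ ih => exact .smul_congr _ ih
  | tok_cap ha => exact .tok_cap ha
  | _ => constructor

namespace Brauer

/-- The quotient map on homogeneous morphisms. -/
def quotSpace (d : Option k) (m n : ℕ) (r : ZMod 2) :
    DiagSpace inv σ none m n r →ₗ[k] DiagSpace inv σ d m n r where
  toFun := Quot.map (fun f => f) fun _ _ h => h.of_none d
  map_add' x y := by
    induction x using DiagSpace.ind; induction y using DiagSpace.ind; rfl
  map_smul' c x := by induction x using DiagSpace.ind; rfl

/-- The quotient map on morphisms. -/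
def quotHom (d : Option k) (m n : ℕ) : BrauerHom inv σ none m n →ₗ[k] BrauerHom inv σ d m n :=
  LinearMap.pi fun r => quotSpace d m n r ∘ₗ LinearMap.proj r

theorem quotHom_of (d : Option k) {m n : ℕ} {r : ZMod 2} (f : Diag 𝒜 σ m n r) :
    quotHom d m n (BrauerHom.of f : BrauerHom inv σ none m n) = BrauerHom.of f := by
  funext s
  by_cases h : s = r
  · subst h
    simp [quotHom, BrauerHom.of]
    rfl
  · simp [quotHom, BrauerHom.of, Pi.single_eq_of_ne h]

theorem quotHom_comp (d : Option k) {l m n : ℕ} (f : BrauerHom inv σ none l m)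
    (g : BrauerHom inv σ none m n) :
    quotHom d l n (BrauerHom.comp f g) = BrauerHom.comp (quotHom d l m f) (quotHom d m n g) := by
  induction f using BrauerHom.induction with
  | hadd f g hf hg => simp only [map_add, LinearMap.add_apply, hf, hg]
  | h r f =>
  induction g using BrauerHom.induction with
  | hadd f g hf hg => simp only [map_add, hf, hg]
  | h s g =>
  rw [quotHom_of, quotHom_of, BrauerHom.comp_of f g rfl, BrauerHom.comp_of f g rfl, quotHom_of]

theorem quotHom_tensor (d : Option k) {m n m' n' : ℕ} (f : BrauerHom inv σ none m n)
    (g : BrauerHom inv σ none m' n') :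
    quotHom d _ _ (BrauerHom.tensor f g) =
      BrauerHom.tensor (quotHom d _ _ f) (quotHom d _ _ g) := by
  induction f using BrauerHom.induction with
  | hadd f g hf hg => simp only [map_add, LinearMap.add_apply, hf, hg]
  | h r f =>
  induction g using BrauerHom.induction with
  | hadd f g hf hg => simp only [map_add, hf, hg]
  | h s g =>
  rw [quotHom_of, quotHom_of, BrauerHom.tensor_of f g rfl, BrauerHom.tensor_of f g rfl, quotHom_of]

variable (inv σ) in
/-- The quotient superfunctor from the supercategory without specialization relation to the one with
specialization parameter `c`. It is the identity on objects, and sends the class of every diagram to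
the class of the same diagram. -/
def quotFunctor (c : k) :
    MonoidalSuperfunctor k (Brauer inv σ none) (Brauer inv σ (some c)) where
  obj X := ⟨X.strands⟩
  map {X Y} f := quotHom (some c) X.strands Y.strands f
  map_id _ := quotHom_of _ _
  map_comp := quotHom_comp _
  map_add {X Y} f g := (quotHom (some c) X.strands Y.strands).map_add f g
  map_smul {X Y} a f := (quotHom (some c) X.strands Y.strands).map_smul a f
  map_mem {X Y p f} hf := by
    obtain ⟨f', rfl⟩ := BrauerHom.exists_of hf
    change quotHom (some c) X.strands Y.strands (BrauerHom.of f') ∈ BrauerHom.part inv σ _ _ _ p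
    rw [quotHom_of]
    exact BrauerHom.of_mem f'
  ε := Iso.refl _
  μ X Y := Iso.refl _
  ε_mem := BrauerHom.of_mem _
  μ_mem _ _ := BrauerHom.of_mem _
  μ_naturality f g :=
    (BrauerHom.comp_id _).trans ((quotHom_tensor _ f g).symm.trans (BrauerHom.id_comp _).symm)
  associativity X Y Z := by
    change BrauerHom.comp (BrauerHom.tensor (BrauerHom.idOf _) (BrauerHom.idOf _))
      (BrauerHom.comp (BrauerHom.idOf _) (quotHom (some c) _ _ (BrauerHom.idOf _))) =
      BrauerHom.comp (BrauerHom.idOf _) (BrauerHom.comp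
        (BrauerHom.tensor (BrauerHom.idOf _) (BrauerHom.idOf _)) (BrauerHom.idOf _))
    simp only [quotHom_of, BrauerHom.tensor_idOf, BrauerHom.idOf_comp_idOf]
  left_unitality X := by
    change BrauerHom.idOf _ = BrauerHom.comp (BrauerHom.tensor (BrauerHom.idOf _) (BrauerHom.idOf _))
      (BrauerHom.comp (BrauerHom.idOf _) (quotHom (some c) _ _ (BrauerHom.idOf _)))
    simp only [quotHom_of, BrauerHom.tensor_idOf, BrauerHom.idOf_comp_idOf]
  right_unitality X := by
    change BrauerHom.idOf _ = BrauerHom.comp (BrauerHom.tensor (BrauerHom.idOf _) (BrauerHom.idOf _))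
      (BrauerHom.comp (BrauerHom.idOf _) (quotHom (some c) _ _ (BrauerHom.idOf _)))
    simp only [quotHom_of, BrauerHom.tensor_idOf, BrauerHom.idOf_comp_idOf]

end Brauer

end Quotient

/-! ### Incarnation superfunctors -/

section Incarnation

variable {k : Type u} [Field k] {A : Type w} [Ring A] [Algebra k A]
  {𝒜 : ZMod 2 → Submodule k A} [SetLike.GradedMonoid 𝒜] [IsSuperspace 𝒜]
  {inv : AntiInvolution 𝒜} {σ : ZMod 2}
  {V : Type u} [AddCommGroup V] [Module k V] [FiniteDimensional k V] [Module Aᵐᵒᵖ V]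
  [IsScalarTower k Aᵐᵒᵖ V] {𝒱 : ZMod 2 → Submodule k V} [IsSuperspace 𝒱]
  {Φ : LinearMap.BilinForm k V}

open MonoidalSupercategory

variable (F : MonoidalSuperfunctor k (Brauer inv σ none) (GSMod A 𝒱 Φ))
  (e : F.obj (Brauer.go inv σ none) ≅ GSMod.std A 𝒱 Φ)

/-- The linear operator on `V ⊗ V` given by `F(crossing)`, under the identifications
`F(go ⊗ go) = F(go) ⊗ F(go) = V ⊗ V`. -/
noncomputable def crossOn : V ⊗[k] V →ₗ[k] V ⊗[k] V :=
  GSMod.lin (tensorHom (k := k) e.inv e.inv ≫ (F.μ _ _).hom ≫ F.map (Brauer.cross inv σ none) ≫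
    (F.μ _ _).inv ≫ tensorHom (k := k) e.hom e.hom)

/-- The linear map `V ⊗ V → k` given by `F(cap)`. -/
noncomputable def capOn : V ⊗[k] V →ₗ[k] k :=
  GSMod.lin (tensorHom (k := k) e.inv e.inv ≫ (F.μ _ _).hom ≫ F.map (Brauer.cap inv σ none) ≫
    F.ε.inv)

/-- The linear map `k → V ⊗ V` given by `F(cup)`. -/
noncomputable def cupOn : k →ₗ[k] V ⊗[k] V :=
  GSMod.lin (F.ε.hom ≫ F.map (Brauer.cup inv σ none) ≫ (F.μ _ _).inv ≫
    tensorHom (k := k) e.hom e.hom)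

/-- The linear operator on `V` given by `F(token a)`. -/
noncomputable def tokenOn (a : A) : V →ₗ[k] V :=
  GSMod.lin (e.inv ≫ F.map (Brauer.token inv none a) ≫ e.hom)

/-- The condition that the monoidal superfunctor `F`, together with the even isomorphism
`e : F(go) ≅ V`, sends the crossing to `ν flip`, the cap to `Φ` and the token `a` to
`ρ_{a^⋆}`. -/
structure IsIncarnation (ν : k) : Prop where
  even : e.hom ∈ Supercategory.homPart (k := k) _ _ 0
  cross : crossOn F e = ν • superFlip 𝒱 𝒱
  cap : capOn F e = TensorProduct.lift Φ
  token (a : A) : tokenOn F e a = rho 𝒜 𝒱 (inv.toFun a)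

end Incarnation

set_option linter.unusedSectionVars false

/-! ### Generalities on monoidal supercategories -/

section SupercategoryLemmas

open Supercategory MonoidalSupercategory

variable {k : Type*} [Field k]
  {C : Type*} [Category C] [Preadditive C] [Linear k C] [Supercategory k C]
  {D : Type*} [Category D] [Preadditive D] [Linear k D] [Supercategory k D]

/-! A monoidal category presented by generators and relations is easy to map out of: one chooses
images of the generators and verifies the relations. Here the images of crossing, cap and tokens are
prescribed, and the image of the cup is forced. Indeed the snake relation says that cup and cap are
inverse to each other, and a nondegenerate form has only one inverse copairing, namely the signed
sum of `v ⊗ v^∨` over dual bases (`eq_sum_of_zigzag`). This single remark gives the formula for the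
cup and also the cup's share of the uniqueness statement.

Existence. The relations translate the hypotheses on `Φ` one by one. `ν ^ 2 = 1` gives the
involutivity of the crossing; supersymmetry says that the cap absorbs a crossing; the fact that `Φ`
is supported in total parity `σ` makes the signs agree when a strand slides past a cap and in the
second snake relation; adjointness moves tokens across the cap; and `a ↦ ρ_{a⋆}` is multiplicative
because the anti-involution and the right action both reverse products (`GeneratorImages.eval_eq`).
Equivariance of the images is the definition of `G(Φ)`: its points and its Lie superalgebra preserve
`Φ` and commute with `A`, and whatever preserves `Φ` preserves the inverse copairing
(`copairing_mem`). The target is not strict. This is handled by `TensorPowers`, a model of the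
powers of `V` with a multiplication that is strictly associative and unital on vectors; a diagram is
evaluated by recursion on its construction, and every relation becomes an identity between products
of at most three vectors of `V` or a formal identity of Koszul signs.

Uniqueness. An even isomorphism on the generating object propagates through the constraints to all
tensor powers (`Brauer.powIso`), and is monoidal by the coherence axioms (`Brauer.powIso_add`).
Naturality passes through composition, tensor products and linear combinations, so only the
generators need to be inspected (`Brauer.powIso_naturality`). Conversely the unit and tensor axioms
determine a monoidal transformation from its component at the generating object.

Bubbles. The image of a bubble is the scalar obtained by pairing `v` with `v^∨ a⋆`; adjointness and
supersymmetry turn it into `ν` times a supertrace (`form_rho_copairing`). For `V ≅ A^{m|n}` the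
supertrace is `m - n` times that of `A` (`supertrace_free`), so the specialization relations hold.
The quotient superfunctor is bijective on objects, surjective on morphisms and has identity
constraints, hence the factorization exists and is unique as an equality of superfunctors. -/

theorem exists_homPart_add {X Y : C} (f : X ⟶ Y) :
    ∃ a ∈ homPart (k := k) X Y 0, ∃ b ∈ homPart (k := k) X Y 1, a + b = f := by
  have := isSuperspace (k := k) X Y
  exact ⟨_, parityProj_mem _ _ f, _, parityProj_mem _ _ f, parityProj_add _ f⟩

theorem homPart_eq_zero {X Y : C} {f : X ⟶ Y} (h0 : f ∈ homPart (k := k) X Y 0)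
    (h1 : f ∈ homPart (k := k) X Y 1) : f = 0 :=
  Submodule.disjoint_def.1 (isSuperspace (k := k) X Y).isCompl.disjoint f h0 h1

theorem comp_mem_even {X Y Z : C} {f : X ⟶ Y} {g : Y ⟶ Z} (hf : f ∈ homPart (k := k) X Y 0)
    (hg : g ∈ homPart (k := k) Y Z 0) : f ≫ g ∈ homPart (k := k) X Z 0 :=
  comp_mem (p := 0) (q := 0) hf hg

/-- The inverse of an even isomorphism is even. -/
theorem inv_mem_even {X Y : C} {e : X ≅ Y} (h : e.hom ∈ homPart (k := k) X Y 0) :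
    e.inv ∈ homPart (k := k) Y X 0 := by
  -- Split the inverse as `a + b` with `a` even and `b` odd. Then `e.hom ≫ b` is odd, but it is also
  -- `𝟙 - e.hom ≫ a`, which is even; so it vanishes, and cancelling `e.hom` gives `b = 0`.
  obtain ⟨a, ha, b, hb, hab⟩ := exists_homPart_add (k := k) e.inv
  have key : e.hom ≫ a + e.hom ≫ b = 𝟙 X := by
    rw [← Preadditive.comp_add, hab, e.hom_inv_id]
  have h1 : e.hom ≫ b ∈ homPart (k := k) X X 1 := comp_mem (p := 0) (q := 1) h hb
  have h0 : e.hom ≫ b ∈ homPart (k := k) X X 0 := by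
    rw [← eq_sub_iff_add_eq'] at key
    rw [key]
    exact sub_mem (id_mem X) (comp_mem_even h ha)
  have h2 : b = 0 := by
    have h3 := homPart_eq_zero h0 h1
    rw [← Category.id_comp b, ← e.inv_hom_id, Category.assoc, h3, Limits.comp_zero]
  rw [← hab, h2, add_zero]
  exact ha

variable [MonoidalSupercategory k C] [MonoidalSupercategory k D]

/-- The sign in the interchange law involves only `f` and `g'`. If one of them is even, the sign is
trivial on both homogeneous components of the other, so no homogeneity has to be assumed there. All
coherence arguments below use interchange in this sign-free form, since the structural morphisms are
even. -/
theorem tensorHom_comp_of_left_even {X Y Z X' Y' Z' : C} {f : X ⟶ Y} (g : X' ⟶ Y')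
    (f' : Y ⟶ Z) (g' : Y' ⟶ Z') (hf : f ∈ homPart (k := k) X Y 0) :
    tensorHom (k := k) f g ≫ tensorHom (k := k) f' g' =
      tensorHom (k := k) (f ≫ f') (g ≫ g') := by
  obtain ⟨a, ha, b, hb, rfl⟩ := exists_homPart_add (k := k) g'
  rw [map_add, Preadditive.comp_add, Preadditive.comp_add, map_add, interchange g f' hf ha,
    interchange g f' hf hb]
  simp

theorem tensorHom_comp_of_right_even {X Y Z X' Y' Z' : C} (f : X ⟶ Y) (g : X' ⟶ Y')
    (f' : Y ⟶ Z) {g' : Y' ⟶ Z'} (hg' : g' ∈ homPart (k := k) Y' Z' 0) :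
    tensorHom (k := k) f g ≫ tensorHom (k := k) f' g' =
      tensorHom (k := k) (f ≫ f') (g ≫ g') := by
  obtain ⟨a, ha, b, hb, rfl⟩ := exists_homPart_add (k := k) f
  rw [map_add, LinearMap.add_apply, Preadditive.add_comp, Preadditive.add_comp, map_add,
    LinearMap.add_apply, interchange g f' ha hg', interchange g f' hb hg']
  simp

theorem tensorHom_mem_even {X Y X' Y' : C} {f : X ⟶ Y} {g : X' ⟶ Y'}
    (hf : f ∈ homPart (k := k) X Y 0) (hg : g ∈ homPart (k := k) X' Y' 0) :
    tensorHom (k := k) f g ∈ homPart (k := k) _ _ 0 :=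
  tensorHom_mem (p := 0) (q := 0) hf hg

/-- The tensor product of two even isomorphisms. -/
@[simps]
def tensorIso {X Y X' Y' : C} (e : X ≅ Y) (e' : X' ≅ Y')
    (h : e.hom ∈ homPart (k := k) X Y 0) :
    tensorObj k X X' ≅ tensorObj k Y Y' where
  hom := tensorHom (k := k) e.hom e'.hom
  inv := tensorHom (k := k) e.inv e'.inv
  hom_inv_id := by
    rw [tensorHom_comp_of_left_even _ _ _ h, e.hom_inv_id, e'.hom_inv_id, tensorHom_id]
  inv_hom_id := by
    rw [tensorHom_comp_of_left_even _ _ _ (inv_mem_even h), e.inv_hom_id, e'.inv_hom_id,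
      tensorHom_id]

namespace MonoidalSuperfunctor

theorem ε_inv_mem (F : MonoidalSuperfunctor k C D) : F.ε.inv ∈ homPart (k := k) _ _ 0 :=
  inv_mem_even F.ε_mem

theorem μ_inv_mem (F : MonoidalSuperfunctor k C D) (X Y : C) :
    (F.μ X Y).inv ∈ homPart (k := k) _ _ 0 :=
  inv_mem_even (F.μ_mem X Y)

theorem map_tensorHom (F : MonoidalSuperfunctor k C D) {X Y X' Y' : C} (f : X ⟶ Y) (g : X' ⟶ Y') :
    F.map (tensorHom (k := k) f g) =
      (F.μ X X').inv ≫ tensorHom (k := k) (F.map f) (F.map g) ≫ (F.μ Y Y').hom := by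
  rw [F.μ_naturality, Iso.inv_hom_id_assoc]

/-- The types of the constraints depend on the object maps, hence the heterogeneous equalities. This
serves the strict uniqueness of the factorization through the quotient. -/
theorem ext' {F G : MonoidalSuperfunctor k C D} (h : F.toFunctor = G.toFunctor)
    (hε : HEq F.ε G.ε) (hμ : HEq F.μ G.μ) : F = G := by
  cases F; cases G; cases h; cases hε; cases hμ; rfl

/-- The linear map on morphisms given by a monoidal superfunctor. -/
def mapL (F : MonoidalSuperfunctor k C D) (X Y : C) :
    (X ⟶ Y) →ₗ[k] (F.obj X ⟶ F.obj Y) where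
  toFun f := F.map f
  map_add' := F.map_add
  map_smul' := F.map_smul

end MonoidalSuperfunctor

theorem MonoidalSuperNatIso.ext' {F G : MonoidalSuperfunctor k C D} {η θ : MonoidalSuperNatIso F G}
    (h : ∀ X, (η.app X).hom = (θ.app X).hom) : η = θ := by
  have : η.app = θ.app := funext fun X => Iso.ext (h X)
  cases η; cases θ; cases this; rfl

end SupercategoryLemmas

/-! ### Linear maps out of the diagrammatic morphism spaces -/

section Lift

variable {k : Type u} [Field k] {A : Type w} [Ring A] [Algebra k A]
  {𝒜 : ZMod 2 → Submodule k A} [SetLike.GradedMonoid 𝒜] [IsSuperspace 𝒜]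
  {inv : AntiInvolution 𝒜} {σ : ZMod 2} {d : Option k}

namespace BrauerHom

theorem of_add {m n : ℕ} {r : ZMod 2} (f g : Diag 𝒜 σ m n r) :
    (of (f.add g) : BrauerHom inv σ d m n) = of f + of g := by
  rw [of, DiagSpace.mk_add, Pi.single_add]; rfl

variable {M : Type*} [AddCommGroup M] [Module k M] {m n : ℕ}

/-- The linear map on diagrammatic morphisms induced by a function on diagrams that is compatible
with the relations and the linear structure. -/
def lift (φ : ∀ r, Diag 𝒜 σ m n r → M)
    (hrel : ∀ r (f g : Diag 𝒜 σ m n r), DiagRel inv σ d f g → φ r f = φ r g)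
    (hadd : ∀ r (f g : Diag 𝒜 σ m n r), φ r (f.add g) = φ r f + φ r g)
    (hsmul : ∀ r (c : k) (f : Diag 𝒜 σ m n r), φ r (f.smul c) = c • φ r f) :
    BrauerHom inv σ d m n →ₗ[k] M :=
  ∑ r : ZMod 2,
    ({ toFun := Quot.lift (φ r) (hrel r)
       map_add' := fun x y => by
        induction x using DiagSpace.ind; induction y using DiagSpace.ind; exact hadd r _ _
       map_smul' := fun c x => by induction x using DiagSpace.ind; exact hsmul r c _ } :
      DiagSpace inv σ d m n r →ₗ[k] M) ∘ₗ LinearMap.proj r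

theorem lift_of (φ : ∀ r, Diag 𝒜 σ m n r → M)
    (hrel : ∀ r (f g : Diag 𝒜 σ m n r), DiagRel inv σ d f g → φ r f = φ r g)
    (hadd : ∀ r (f g : Diag 𝒜 σ m n r), φ r (f.add g) = φ r f + φ r g)
    (hsmul : ∀ r (c : k) (f : Diag 𝒜 σ m n r), φ r (f.smul c) = c • φ r f)
    {r : ZMod 2} (f : Diag 𝒜 σ m n r) : lift φ hrel hadd hsmul (of f) = φ r f := by
  simp only [lift, LinearMap.sum_apply, LinearMap.comp_apply, LinearMap.proj_apply]
  rw [Finset.sum_eq_single r]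
  · simp only [of, Pi.single_eq_same]; rfl
  · intro s _ hs
    rw [of, Pi.single_eq_of_ne hs, map_zero]
  · simp

/-- The token labelled by a homogeneous element, as a morphism. -/
theorem token_of {r : ZMod 2} {a : A} (ha : a ∈ 𝒜 r) :
    (Brauer.token inv d a : BrauerHom inv σ d 1 1) = of (Diag.tok a ha) := by
  funext s
  by_cases h : s = r
  · subst h
    simp only [of, Pi.single_eq_same, Brauer.token]
    congr 1
    congr 1
    exact parityProj_same 𝒜 ha
  · simp only [of, Pi.single_eq_of_ne h, Brauer.token]
    have h0 : parityProj 𝒜 s a = 0 := parityProj_ne 𝒜 ha (Ne.symm h)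
    -- A token labelled by zero is zero because scalars can be pulled out of labels. The label is
    -- kept as a variable since the diagram contains a proof that depends on it.
    have key : ∀ (b : A) (hb : b ∈ 𝒜 s), b = 0 →
        (DiagSpace.mk (Diag.tok b hb) : DiagSpace inv σ d 1 1 s) = 0 := by
      intro b hb hb0
      have h1 := DiagSpace.sound (inv := inv) (σ := σ) (d := d) (DiagRel.tok_smul (0 : k) hb)
      rw [DiagSpace.mk_smul, zero_smul] at h1
      rw [h1]
      congr 2
      rw [hb0, smul_zero]
    exact key _ _ h0

end BrauerHom

end Lift

/-! ### Monoidal natural isomorphisms of superfunctors on the diagram category -/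

section NatIso

open Supercategory MonoidalSupercategory

variable {k : Type u} [Field k] {A : Type w} [Ring A] [Algebra k A]
  {𝒜 : ZMod 2 → Submodule k A} [SetLike.GradedMonoid 𝒜] [IsSuperspace 𝒜]
  {inv : AntiInvolution 𝒜} {σ : ZMod 2} {d : Option k}
  {D : Type*} [Category D] [Preadditive D] [Linear k D] [Supercategory k D]
  [MonoidalSupercategory k D]

namespace Brauer

/-- The object with `n` strands. -/
abbrev pow (inv : AntiInvolution 𝒜) (σ : ZMod 2) (d : Option k) (n : ℕ) : Brauer inv σ d := ⟨n⟩

/-- The unitors and associators of the diagram category are identity diagrams between equal numbers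
of strands. Whenever the two numbers agree by computation, as `n + 0` and `n`, or `m + n + 1` and `m
+ (n + 1)`, this removes them from the coherence axioms. -/
theorem map_idOf (F : MonoidalSuperfunctor k (Brauer inv σ d) D) {n : ℕ} (h : n = n) :
    F.map (X := pow inv σ d n) (Y := pow inv σ d n) (BrauerHom.of (Diag.id h)) = 𝟙 _ :=
  F.map_id (pow inv σ d n)

/-- Right unitality solved for the tensor constraint: the base of the induction on the right-hand
exponent. -/
theorem right_unitality_pow (F : MonoidalSuperfunctor k (Brauer inv σ d) D) (n : ℕ) :
    (F.μ (pow inv σ d n) (pow inv σ d 0)).hom =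
      tensorHom (k := k) (𝟙 _) F.ε.inv ≫ (rightUnitor (k := k) (F.obj (pow inv σ d n))).hom := by
  have h := F.right_unitality (pow inv σ d n)
  have h2 : F.map (rightUnitor (k := k) (pow inv σ d n)).hom = 𝟙 (F.obj (pow inv σ d n)) :=
    map_idOf F _
  rw [h2] at h
  rw [h, ← Category.assoc, tensorHom_comp_of_left_even _ _ _ (id_mem _), F.ε.inv_hom_id,
    Category.id_comp, tensorHom_id]
  exact ((Category.id_comp _).trans (Category.comp_id _)).symm

/-- Associativity solved for one tensor constraint: the recursion that expresses all constraints by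
those whose second factor is a single strand. -/
theorem associativity_pow (F : MonoidalSuperfunctor k (Brauer inv σ d) D) (m n : ℕ) :
    (F.μ (pow inv σ d m) (pow inv σ d (n + 1))).hom =
      tensorHom (k := k) (𝟙 _) (F.μ (pow inv σ d n) (pow inv σ d 1)).inv ≫
        (assocIso (k := k) _ _ _).inv ≫
          tensorHom (k := k) (F.μ (pow inv σ d m) (pow inv σ d n)).hom (𝟙 _) ≫
            (F.μ (pow inv σ d (m + n)) (pow inv σ d 1)).hom := by
  have h := F.associativity (pow inv σ d m) (pow inv σ d n) (pow inv σ d 1)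
  have h2 : F.map (assocIso (k := k) (pow inv σ d m) (pow inv σ d n) (pow inv σ d 1)).hom =
    𝟙 (F.obj (pow inv σ d (m + n + 1))) := map_idOf F _
  rw [h2] at h
  have h3 := (congrArg (tensorHom (k := k) (𝟙 (F.obj (pow inv σ d m)))
    (F.μ (pow inv σ d n) (pow inv σ d 1)).inv ≫ (assocIso (k := k) _ _ _).inv ≫ ·) h).symm
  simp only [Iso.inv_hom_id_assoc] at h3
  rw [← Category.assoc, tensorHom_comp_of_left_even _ _ _ (id_mem _), Iso.inv_hom_id,
    Category.id_comp, tensorHom_id, Category.id_comp] at h3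
  refine h3.trans ?_
  congr 3
  exact Category.comp_id _

variable (F G : MonoidalSuperfunctor k (Brauer inv σ d) D)
  (e : F.obj (pow inv σ d 1) ≅ G.obj (pow inv σ d 1)) (he : e.hom ∈ homPart (k := k) _ _ 0)

/-- The isomorphisms between the values of two monoidal superfunctors that are induced by an
isomorphism on the generating object; evenness is recorded along the way. -/
def powIsoAux : ∀ n : ℕ, { i : F.obj (pow inv σ d n) ≅ G.obj (pow inv σ d n) //
    i.hom ∈ homPart (k := k) _ _ 0 }
  | 0 => ⟨F.ε.symm ≪≫ G.ε, comp_mem_even F.ε_inv_mem G.ε_mem⟩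
  | n + 1 => ⟨(F.μ (pow inv σ d n) (pow inv σ d 1)).symm ≪≫
      tensorIso (powIsoAux n).1 e (powIsoAux n).2 ≪≫ G.μ (pow inv σ d n) (pow inv σ d 1),
      comp_mem_even (F.μ_inv_mem _ _)
        (comp_mem_even (tensorHom_mem_even (powIsoAux n).2 he) (G.μ_mem _ _))⟩

/-- The isomorphisms between the values of two monoidal superfunctors that are induced by an
isomorphism on the generating object. -/
def powIso (n : ℕ) : F.obj (pow inv σ d n) ≅ G.obj (pow inv σ d n) := (powIsoAux F G e he n).1

theorem powIso_mem (n : ℕ) : (powIso F G e he n).hom ∈ homPart (k := k) _ _ 0 :=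
  (powIsoAux F G e he n).2

theorem powIso_zero : F.ε.hom ≫ (powIso F G e he 0).hom = G.ε.hom :=
  F.ε.hom_inv_id_assoc _

theorem powIso_succ (n : ℕ) : (F.μ (pow inv σ d n) (pow inv σ d 1)).hom ≫
      (powIso F G e he (n + 1)).hom =
    tensorHom (k := k) (powIso F G e he n).hom e.hom ≫
      (G.μ (pow inv σ d n) (pow inv σ d 1)).hom :=
  (F.μ (pow inv σ d n) (pow inv σ d 1)).hom_inv_id_assoc _

theorem left_unitality_go (F : MonoidalSuperfunctor k (Brauer inv σ d) D) :
    (leftUnitor (k := k) (F.obj (pow inv σ d 1))).hom =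
      tensorHom (k := k) F.ε.hom (𝟙 _) ≫ (F.μ (pow inv σ d 0) (pow inv σ d 1)).hom := by
  have h := F.left_unitality (pow inv σ d 1)
  have h2 : F.map (leftUnitor (k := k) (pow inv σ d 1)).hom = 𝟙 (F.obj (pow inv σ d 1)) :=
    map_idOf F _
  rw [h2] at h
  refine h.trans ?_
  congr 1
  exact Category.comp_id _

/-- Not a matter of unfolding: the recursion builds one strand as zero strands tensored with one
strand. Left unitality of both superfunctors cancels the resulting unit constraints. -/
theorem powIso_one : (powIso F G e he 1).hom = e.hom := by
  have h := powIso_succ F G e he 0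
  replace h : (F.μ (pow inv σ d 0) (pow inv σ d 1)).hom ≫ (powIso F G e he 1).hom =
    tensorHom (k := k) (powIso F G e he 0).hom e.hom ≫
      (G.μ (pow inv σ d 0) (pow inv σ d 1)).hom := h
  have h1 : tensorHom (k := k) F.ε.hom (𝟙 _) ≫ _ = tensorHom (k := k) F.ε.hom (𝟙 _) ≫ _ :=
    congrArg (tensorHom (k := k) F.ε.hom (𝟙 _) ≫ ·) h
  rw [← Category.assoc, ← left_unitality_go, ← Category.assoc,
    tensorHom_comp_of_left_even _ _ _ F.ε_mem, powIso_zero, Category.id_comp] at h1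
  have h2 : tensorHom (k := k) G.ε.hom e.hom =
      tensorHom (k := k) (𝟙 _) e.hom ≫ tensorHom (k := k) G.ε.hom (𝟙 _) := by
    rw [tensorHom_comp_of_left_even _ _ _ (id_mem _), Category.id_comp, Category.comp_id]
  rw [h2, Category.assoc] at h1
  have h3 : tensorHom (k := k) G.ε.hom (𝟙 _) ≫ (G.μ (pow inv σ d 0) (pow inv σ d 1)).hom =
    (leftUnitor (k := k) (G.obj (pow inv σ d 1))).hom := (left_unitality_go G).symm
  rw [h3, leftUnitor_naturality] at h1
  exact (cancel_epi _).1 h1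

/-- The isomorphisms are constructed to respect the constraints that add one strand on the right.
The general constraints follow by induction on `n`: right unitality for `n = 0`, and for the step
the recursion `associativity_pow`, which holds for `F` and for `G` alike. -/
theorem powIso_add (m n : ℕ) : (F.μ (pow inv σ d m) (pow inv σ d n)).hom ≫
      (powIso F G e he (m + n)).hom =
    tensorHom (k := k) (powIso F G e he m).hom (powIso F G e he n).hom ≫
      (G.μ (pow inv σ d m) (pow inv σ d n)).hom := by
  induction n with
  | zero =>
    rw [right_unitality_pow, right_unitality_pow, ← Category.assoc,
      tensorHom_comp_of_left_even _ _ _ (powIso_mem F G e he m), Category.assoc]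
    have h0 : (powIso F G e he 0).hom ≫ G.ε.inv = F.ε.inv := by
      rw [← cancel_epi F.ε.hom, ← Category.assoc, powIso_zero]; simp
    rw [h0, Category.comp_id]
    have h1 := rightUnitor_naturality (k := k) (powIso F G e he m).hom
    refine (congrArg (tensorHom (k := k) (𝟙 _) F.ε.inv ≫ ·) h1.symm).trans ?_
    rw [← Category.assoc, tensorHom_comp_of_left_even _ _ _ (id_mem _), Category.id_comp,
      Category.comp_id]
  | succ n ih =>
    have hs := powIso_succ F G e he n
    have hs' : (F.μ (pow inv σ d (m + n)) (pow inv σ d 1)).hom ≫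
      (powIso F G e he (m + (n + 1))).hom = _ := powIso_succ F G e he (m + n)
    rw [associativity_pow F m n, associativity_pow G m n]
    simp only [Category.assoc]
    rw [hs']
    slice_lhs 3 4 => rw [tensorHom_comp_of_left_even _ _ _ (F.μ_mem _ _), ih, Category.id_comp]
    have h1 : tensorHom (k := k) (powIso F G e he m).hom (powIso F G e he (n + 1)).hom ≫
        tensorHom (k := k) (𝟙 _) (G.μ (pow inv σ d n) (pow inv σ d 1)).inv =
        tensorHom (k := k) (𝟙 _) (F.μ (pow inv σ d n) (pow inv σ d 1)).inv ≫
        tensorHom (k := k) (powIso F G e he m).hom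
          (tensorHom (k := k) (powIso F G e he n).hom e.hom) := by
      rw [tensorHom_comp_of_left_even _ _ _ (powIso_mem F G e he m),
        tensorHom_comp_of_left_even _ _ _ (id_mem _), Category.id_comp, Category.comp_id]
      congr 1
      rw [Iso.comp_inv_eq, Category.assoc, ← hs, Iso.inv_hom_id_assoc]
    have h2 : tensorHom (k := k) (powIso F G e he m).hom
          (tensorHom (k := k) (powIso F G e he n).hom e.hom) ≫ (assocIso (k := k) _ _ _).inv =
        (assocIso (k := k) _ _ _).inv ≫ tensorHom (k := k) (tensorHom (k := k)
          (powIso F G e he m).hom (powIso F G e he n).hom) e.hom := by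
      rw [Iso.comp_inv_eq, Category.assoc, associator_naturality, Iso.inv_hom_id_assoc]
    rw [← Category.assoc (tensorHom (k := k) (powIso F G e he m).hom _), h1, Category.assoc,
      ← Category.assoc (tensorHom (k := k) (powIso F G e he m).hom _), h2, Category.assoc]
    congr 2
    rw [← Category.assoc, tensorHom_comp_of_right_even _ _ _ (id_mem _), Category.comp_id]

/-- The isomorphisms `powIso` are natural if they commute with the images of the generators. -/
theorem powIso_naturality
    (hcross : F.map (cross inv σ d) ≫ (powIso F G e he 2).hom =
      (powIso F G e he 2).hom ≫ G.map (cross inv σ d))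
    (hcap : F.map (cap inv σ d) ≫ (powIso F G e he 0).hom =
      (powIso F G e he 2).hom ≫ G.map (cap inv σ d))
    (hcup : F.map (cup inv σ d) ≫ (powIso F G e he 2).hom =
      (powIso F G e he 0).hom ≫ G.map (cup inv σ d))
    (htok : ∀ a : A, F.map (token inv d a) ≫ e.hom = e.hom ≫ G.map (token inv d a))
    {X Y : Brauer inv σ d} (f : X ⟶ Y) :
    F.map f ≫ (powIso F G e he Y.strands).hom = (powIso F G e he X.strands).hom ≫ G.map f := by
  -- Classes of diagrams span the morphism spaces, so induction on the construction of a diagram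
  -- suffices. The relations play no part, since both sides are already defined on classes.
  suffices key : ∀ {m n : ℕ} {r : ZMod 2} (f : Diag 𝒜 σ m n r),
      F.map (X := pow inv σ d m) (Y := pow inv σ d n) (BrauerHom.of f) ≫
          (powIso F G e he n).hom =
        (powIso F G e he m).hom ≫
          G.map (X := pow inv σ d m) (Y := pow inv σ d n) (BrauerHom.of f) by
    refine BrauerHom.induction (P := fun f : BrauerHom inv σ d X.strands Y.strands =>
      F.map (X := X) (Y := Y) f ≫ (powIso F G e he Y.strands).hom =
        (powIso F G e he X.strands).hom ≫ G.map (X := X) (Y := Y) f) (fun f g hf hg => ?_)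
      (fun r f => key f) f
    have h1 := F.map_add (X := X) (Y := Y) f g
    have h2 := G.map_add (X := X) (Y := Y) f g
    refine (congrArg (· ≫ (powIso F G e he Y.strands).hom) h1).trans
      (Eq.trans ?_ (congrArg ((powIso F G e he X.strands).hom ≫ ·) h2.symm))
    change (_ + _) ≫ _ = _ ≫ (_ + _)
    rw [Preadditive.add_comp, Preadditive.comp_add, hf, hg]
  intro m n r f
  induction f with
  | id h =>
    subst h
    rw [map_idOf, map_idOf, Category.comp_id, Category.id_comp]
  | @comp l m n r s t f g h ihf ihg =>
    have h1 : (BrauerHom.of (Diag.comp f g h) : pow inv σ d l ⟶ pow inv σ d n) =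
        CategoryStruct.comp (X := pow inv σ d l) (Y := pow inv σ d m) (Z := pow inv σ d n)
        (BrauerHom.of f) (BrauerHom.of g) := (BrauerHom.comp_of f g h).symm
    rw [h1, F.map_comp, G.map_comp, Category.assoc, ihg, ← Category.assoc, ihf, Category.assoc]
  | @tensor m n m' n' a b r s t f g ha hb h ihf ihg =>
    subst ha hb
    have h1 : (BrauerHom.of (Diag.tensor f g rfl rfl h) :
          pow inv σ d (m + m') ⟶ pow inv σ d (n + n')) =
        tensorHom (k := k) (X := pow inv σ d m) (Y := pow inv σ d n) (X' := pow inv σ d m')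
          (Y' := pow inv σ d n') (BrauerHom.of f) (BrauerHom.of g) :=
      (BrauerHom.tensor_of f g h).symm
    have h2 := powIso_add F G e he n n'
    have h3 := powIso_add F G e he m m'
    rw [h1]
    refine (congrArg (· ≫ (powIso F G e he (n + n')).hom) (F.map_tensorHom _ _)).trans
      (Eq.trans ?_ (congrArg ((powIso F G e he (m + m')).hom ≫ ·) (G.map_tensorHom _ _).symm))
    -- By monoidality the isomorphism on a tensor product is a conjugate of the tensor product of
    -- two even isomorphisms, which pass through the interchange law without signs.
    have h4 : (powIso F G e he (m + m')).hom = (F.μ (pow inv σ d m) (pow inv σ d m')).inv ≫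
        tensorHom (k := k) (powIso F G e he m).hom (powIso F G e he m').hom ≫
        (G.μ (pow inv σ d m) (pow inv σ d m')).hom := by
      rw [← h3, Iso.inv_hom_id_assoc]
    have h5 : (powIso F G e he (n + n')).hom = (F.μ (pow inv σ d n) (pow inv σ d n')).inv ≫
        tensorHom (k := k) (powIso F G e he n).hom (powIso F G e he n').hom ≫
        (G.μ (pow inv σ d n) (pow inv σ d n')).hom := by
      rw [← h2, Iso.inv_hom_id_assoc]
    rw [h4, h5]
    simp only [Category.assoc, Iso.hom_inv_id_assoc]
    congr 1
    rw [← Category.assoc, ← Category.assoc,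
      tensorHom_comp_of_right_even _ _ _ (powIso_mem F G e he n'),
      tensorHom_comp_of_left_even _ _ _ (powIso_mem F G e he m), ihf, ihg]
  | cross => exact hcross
  | cap => exact hcap
  | cup => exact hcup
  | tok a ha =>
    rw [powIso_one, ← BrauerHom.token_of ha]
    exact htok a
  | @zero m n r =>
    have h1 : (BrauerHom.of (Diag.zero : Diag 𝒜 σ m n r) : pow inv σ d m ⟶ pow inv σ d n) = 0 :=
      BrauerHom.of_zero
    have hF := (F.mapL (pow inv σ d m) (pow inv σ d n)).map_zero
    have hG := (G.mapL (pow inv σ d m) (pow inv σ d n)).map_zero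
    change F.map 0 = 0 at hF
    change G.map 0 = 0 at hG
    rw [h1, hF, hG, Limits.zero_comp, Limits.comp_zero]
  | @add m n r f g ihf ihg =>
    have h1 : (BrauerHom.of (Diag.add f g) : pow inv σ d m ⟶ pow inv σ d n) =
      (BrauerHom.of f : pow inv σ d m ⟶ pow inv σ d n) + BrauerHom.of g := BrauerHom.of_add f g
    rw [h1, F.map_add, G.map_add, Preadditive.add_comp, Preadditive.comp_add, ihf, ihg]
  | @smul m n r c f ih =>
    have h1 : (BrauerHom.of (Diag.smul c f) : pow inv σ d m ⟶ pow inv σ d n) =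
      c • (BrauerHom.of f : pow inv σ d m ⟶ pow inv σ d n) := BrauerHom.of_smul c f
    rw [h1, F.map_smul, G.map_smul, Linear.smul_comp, Linear.comp_smul, ih]

/-- The monoidal natural isomorphism determined by an isomorphism on the generating object that
is compatible with the images of the generating morphisms. -/
def natIso
    (hcross : F.map (cross inv σ d) ≫ (powIso F G e he 2).hom =
      (powIso F G e he 2).hom ≫ G.map (cross inv σ d))
    (hcap : F.map (cap inv σ d) ≫ (powIso F G e he 0).hom =
      (powIso F G e he 2).hom ≫ G.map (cap inv σ d))
    (hcup : F.map (cup inv σ d) ≫ (powIso F G e he 2).hom =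
      (powIso F G e he 0).hom ≫ G.map (cup inv σ d))
    (htok : ∀ a : A, F.map (token inv d a) ≫ e.hom = e.hom ≫ G.map (token inv d a)) :
    MonoidalSuperNatIso F G where
  app X := powIso F G e he X.strands
  app_mem X := powIso_mem F G e he X.strands
  naturality f := powIso_naturality F G e he hcross hcap hcup htok f
  unit := powIso_zero F G e he
  tensor X Y := powIso_add F G e he X.strands Y.strands

/-- A monoidal natural transformation is determined by its component at the generating object. -/
theorem natIso_ext {F G : MonoidalSuperfunctor k (Brauer inv σ d) D} (η θ : MonoidalSuperNatIso F G)
    (h : (η.app (go inv σ d)).hom = (θ.app (go inv σ d)).hom) : η = θ := by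
  refine MonoidalSuperNatIso.ext' ?_
  rintro ⟨n⟩
  -- The unit axiom fixes the component at zero strands; the tensor axiom, with an invertible
  -- constraint, fixes the component at `n + 1` strands by those at `n` and at one.
  induction n with
  | zero =>
    have h1 := η.unit.trans θ.unit.symm
    exact (cancel_epi _).1 h1
  | succ n ih =>
    have h1 := η.tensor (pow inv σ d n) (go inv σ d)
    have h2 := θ.tensor (pow inv σ d n) (go inv σ d)
    rw [ih, h, ← h2] at h1
    exact (cancel_epi (F.μ (pow inv σ d n) (go inv σ d)).hom).1 h1

end Brauer

end NatIso

/-! ### Factorization through the specialized diagram category -/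

section Descend

open Supercategory MonoidalSupercategory

variable {k : Type u} [Field k] {A : Type w} [Ring A] [Algebra k A]
  {𝒜 : ZMod 2 → Submodule k A} [SetLike.GradedMonoid 𝒜] [IsSuperspace 𝒜]
  {inv : AntiInvolution 𝒜} {σ : ZMod 2} {c : k}
  {D : Type*} [Category D] [Preadditive D] [Linear k D] [Supercategory k D]
  [MonoidalSupercategory k D]

namespace Brauer

variable (F : MonoidalSuperfunctor k (Brauer inv σ none) D)

/-- The value of a monoidal superfunctor on the class of a diagram. -/
def mapDiag {m n : ℕ} (r : ZMod 2) (f : Diag 𝒜 σ m n r) :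
    F.obj (pow inv σ none m) ⟶ F.obj (pow inv σ none n) :=
  F.map (X := pow inv σ none m) (Y := pow inv σ none n) (BrauerHom.of f)

theorem mapDiag_comp {l m n : ℕ} {r s t : ZMod 2} (f : Diag 𝒜 σ l m r) (g : Diag 𝒜 σ m n s)
    (h : r + s = t) :
    mapDiag F t (Diag.comp f g h) = mapDiag F r f ≫ mapDiag F s g := by
  have h1 : (BrauerHom.of (Diag.comp f g h) : pow inv σ none l ⟶ pow inv σ none n) =
      CategoryStruct.comp (X := pow inv σ none l) (Y := pow inv σ none m) (Z := pow inv σ none n)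
      (BrauerHom.of f) (BrauerHom.of g) := (BrauerHom.comp_of f g h).symm
  rw [mapDiag, h1, F.map_comp]; rfl

theorem mapDiag_tensor {m n m' n' : ℕ} {r s t : ZMod 2} (f : Diag 𝒜 σ m n r)
    (g : Diag 𝒜 σ m' n' s) (h : r + s = t) :
    mapDiag F t (Diag.tensor f g rfl rfl h) =
      (F.μ (pow inv σ none m) (pow inv σ none m')).inv ≫
        tensorHom (k := k) (mapDiag F r f) (mapDiag F s g) ≫
          (F.μ (pow inv σ none n) (pow inv σ none n')).hom := by
  have h1 : (BrauerHom.of (Diag.tensor f g rfl rfl h) :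
        pow inv σ none (m + m') ⟶ pow inv σ none (n + n')) =
      tensorHom (k := k) (X := pow inv σ none m) (Y := pow inv σ none n) (X' := pow inv σ none m')
        (Y' := pow inv σ none n') (BrauerHom.of f) (BrauerHom.of g) :=
    (BrauerHom.tensor_of f g h).symm
  rw [mapDiag, h1]
  exact F.map_tensorHom _ _

theorem mapDiag_add {m n : ℕ} {r : ZMod 2} (f g : Diag 𝒜 σ m n r) :
    mapDiag F r (f.add g) = mapDiag F r f + mapDiag F r g := by
  have h1 : (BrauerHom.of (Diag.add f g) : pow inv σ none m ⟶ pow inv σ none n) =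
      (BrauerHom.of f : pow inv σ none m ⟶ pow inv σ none n) + BrauerHom.of g :=
    BrauerHom.of_add f g
  rw [mapDiag, h1, F.map_add]; rfl

theorem mapDiag_smul {m n : ℕ} {r : ZMod 2} (a : k) (f : Diag 𝒜 σ m n r) :
    mapDiag F r (f.smul a) = a • mapDiag F r f := by
  have h1 : (BrauerHom.of (Diag.smul a f) : pow inv σ none m ⟶ pow inv σ none n) =
      a • (BrauerHom.of f : pow inv σ none m ⟶ pow inv σ none n) := BrauerHom.of_smul a f
  rw [mapDiag, h1, F.map_smul]; rfl

theorem mapDiag_zero {m n : ℕ} {r : ZMod 2} : mapDiag F r (Diag.zero : Diag 𝒜 σ m n r) = 0 := by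
  have h1 : (BrauerHom.of (Diag.zero : Diag 𝒜 σ m n r) :
    pow inv σ none m ⟶ pow inv σ none n) = 0 := BrauerHom.of_zero
  rw [mapDiag, h1]
  exact (F.mapL (pow inv σ none m) (pow inv σ none n)).map_zero

theorem mapDiag_id {n : ℕ} : mapDiag F 0 (Diag.id (rfl : n = n) : Diag 𝒜 σ n n 0) = 𝟙 _ :=
  map_idOf F _

/-- The condition that a monoidal superfunctor satisfies the specialization relations with
parameter `c`. -/
def RespectsBubbles (c : k) : Prop :=
  (∀ (a : A) (ha : a ∈ 𝒜 0), mapDiag F _ (Diag.bubble a ha) = (c * supertrace 𝒜 a) • 𝟙 _) ∧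
    ∀ (a : A) (ha : a ∈ 𝒜 1), mapDiag F _ (Diag.bubble a ha) = 0

variable {F}

/-- A specialization relation can occur deep inside a diagram, so the congruence rules have to be
treated again by induction. Every other relation apart from the two bubble relations already holds
in the unspecialized category. -/
theorem RespectsBubbles.mapDiag_eq (hF : RespectsBubbles F c) {m n : ℕ} {r : ZMod 2}
    {f g : Diag 𝒜 σ m n r} (h : DiagRel inv σ (some c) f g) :
    mapDiag F r f = mapDiag F r g := by
  have base : ∀ {m n : ℕ} {r : ZMod 2} {f g : Diag 𝒜 σ m n r}, DiagRel inv σ none f g →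
      mapDiag F r f = mapDiag F r g := fun h => by rw [mapDiag, BrauerHom.of_eq h, mapDiag]
  induction h with
  | comp_congr_left g h _ ih => rw [mapDiag_comp, mapDiag_comp, ih]
  | comp_congr_right f h _ ih => rw [mapDiag_comp, mapDiag_comp, ih]
  | tensor_congr_left g ha hb h _ ih => subst ha hb; rw [mapDiag_tensor, mapDiag_tensor, ih]
  | tensor_congr_right f ha hb h _ ih => subst ha hb; rw [mapDiag_tensor, mapDiag_tensor, ih]
  | add_congr_left g _ ih => rw [mapDiag_add, mapDiag_add, ih]
  | add_congr_right f _ ih => rw [mapDiag_add, mapDiag_add, ih]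
  | smul_congr a _ ih => rw [mapDiag_smul, mapDiag_smul, ih]
  | bubble_even ha c' hc =>
    obtain rfl := Option.some.inj hc
    rw [hF.1, mapDiag_smul, mapDiag_id]
  | bubble_odd ha c' hc => rw [hF.2, mapDiag_zero]
  | tok_cap ha => exact base (.tok_cap ha)
  | _ => exact base (by constructor)

/-- The map on morphisms induced on the specialized diagram category. -/
def descendHom (hF : RespectsBubbles F c) (m n : ℕ) :
    BrauerHom inv σ (some c) m n →ₗ[k] (F.obj (pow inv σ none m) ⟶ F.obj (pow inv σ none n)) :=
  BrauerHom.lift (mapDiag F) (fun _ _ _ h => hF.mapDiag_eq h) (fun _ => mapDiag_add F)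
    (fun _ => mapDiag_smul F)

theorem descendHom_of (hF : RespectsBubbles F c) {m n : ℕ} {r : ZMod 2} (f : Diag 𝒜 σ m n r) :
    descendHom hF m n (BrauerHom.of f) = mapDiag F r f :=
  BrauerHom.lift_of _ _ _ _ f

theorem descendHom_quotHom (hF : RespectsBubbles F c) {m n : ℕ} (f : BrauerHom inv σ none m n) :
    descendHom hF m n (quotHom (some c) m n f) =
      F.map (X := pow inv σ none m) (Y := pow inv σ none n) f := by
  refine LinearMap.congr_fun (f := (descendHom hF m n) ∘ₗ quotHom (some c) m n)
    (g := F.mapL (pow inv σ none m) (pow inv σ none n)) ?_ f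
  refine BrauerHom.hom_ext fun r f => ?_
  rw [LinearMap.comp_apply, quotHom_of, descendHom_of]
  rfl

/-- Lifting morphisms along this surjection reduces functoriality, naturality of the constraints and
uniqueness of the factorization to the corresponding facts about `F`. -/
theorem quotHom_surjective (d : Option k) (m n : ℕ) :
    Function.Surjective (quotHom d m n : BrauerHom inv σ none m n → BrauerHom inv σ d m n) := by
  refine BrauerHom.induction ?_ fun r f => ⟨BrauerHom.of f, quotHom_of d f⟩
  rintro _ _ ⟨f, rfl⟩ ⟨g, rfl⟩
  exact ⟨f + g, map_add _ _ _⟩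

/-- The factorization of a monoidal superfunctor that satisfies the specialization relations. -/
def descend (hF : RespectsBubbles F c) : MonoidalSuperfunctor k (Brauer inv σ (some c)) D where
  obj X := F.obj ⟨X.strands⟩
  map {X Y} f := descendHom hF X.strands Y.strands f
  map_id X := (descendHom_of hF _).trans (mapDiag_id F)
  map_comp {X Y Z} f g := by
    obtain ⟨f, rfl⟩ := quotHom_surjective (some c) _ _ f
    obtain ⟨g, rfl⟩ := quotHom_surjective (some c) _ _ g
    refine (congrArg (descendHom hF X.strands Z.strands) (quotHom_comp (some c) f g).symm).trans ?_
    rw [descendHom_quotHom, descendHom_quotHom, descendHom_quotHom]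
    exact F.map_comp (X := ⟨X.strands⟩) (Y := ⟨Y.strands⟩) (Z := ⟨Z.strands⟩) f g
  map_add {X Y} f g := (descendHom hF X.strands Y.strands).map_add f g
  map_smul {X Y} a f := (descendHom hF X.strands Y.strands).map_smul a f
  map_mem {X Y p f} hf := by
    obtain ⟨f', rfl⟩ := BrauerHom.exists_of hf
    rw [descendHom_of]
    exact F.map_mem (BrauerHom.of_mem f')
  ε := F.ε
  μ X Y := F.μ ⟨X.strands⟩ ⟨Y.strands⟩
  ε_mem := F.ε_mem
  μ_mem X Y := F.μ_mem _ _
  μ_naturality {X Y X' Y'} f g := by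
    obtain ⟨f, rfl⟩ := quotHom_surjective (some c) _ _ f
    obtain ⟨g, rfl⟩ := quotHom_surjective (some c) _ _ g
    have h : descendHom hF (X.strands + X'.strands) (Y.strands + Y'.strands)
        (BrauerHom.tensor (quotHom (some c) _ _ f) (quotHom (some c) _ _ g)) = _ :=
      (congrArg (descendHom hF _ _) (quotHom_tensor (some c) f g).symm).trans
        (descendHom_quotHom hF _)
    refine Eq.trans ?_ (congrArg ((F.μ ⟨X.strands⟩ ⟨X'.strands⟩).hom ≫ ·) h.symm)
    rw [descendHom_quotHom, descendHom_quotHom]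
    exact F.μ_naturality (X := ⟨X.strands⟩) (Y := ⟨Y.strands⟩) (X' := ⟨X'.strands⟩)
      (Y' := ⟨Y'.strands⟩) f g
  associativity X Y Z := by
    have h := F.associativity ⟨X.strands⟩ ⟨Y.strands⟩ ⟨Z.strands⟩
    refine Eq.trans ?_ h
    congr 2
    exact descendHom_of hF _
  left_unitality X := by
    refine (F.left_unitality ⟨X.strands⟩).trans ?_
    congr 2
    exact (descendHom_of hF _).symm
  right_unitality X := by
    refine (F.right_unitality ⟨X.strands⟩).trans ?_
    congr 2
    exact (descendHom_of hF _).symm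

/-- The quotient superfunctor is the identity on strand numbers and has identity constraints. The
constraints of the composite therefore differ from those of `F` only by the image of an identity,
and a strict equality results. -/
theorem quotFunctor_comp_descend (hF : RespectsBubbles F c) :
    (quotFunctor inv σ c).comp (descend hF) = F := by
  refine MonoidalSuperfunctor.ext' (Functor.hext (fun _ => rfl) fun X Y f => heq_of_eq ?_)
    (heq_of_eq (Iso.ext ?_)) (heq_of_eq (funext fun X => funext fun Y => Iso.ext ?_))
  · exact descendHom_quotHom hF f
  · change F.ε.hom ≫ (descend hF).map (𝟙 _) = _
    rw [(descend hF).map_id]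
    exact Category.comp_id _
  · change (F.μ _ _).hom ≫ (descend hF).map (𝟙 _) = _
    rw [(descend hF).map_id]
    exact Category.comp_id _

/-- Objects and constraints of `F'` can be read off from the composite, and its values on morphisms
as well, by surjectivity of `quotHom`. -/
theorem eq_descend (F' : MonoidalSuperfunctor k (Brauer inv σ (some c)) D)
    (hF : RespectsBubbles F c) (h : (quotFunctor inv σ c).comp F' = F) : F' = descend hF := by
  subst h
  refine MonoidalSuperfunctor.ext' (Functor.hext (fun _ => rfl) fun X Y f => heq_of_eq ?_)
    (heq_of_eq (Iso.ext ?_)) (heq_of_eq (funext fun X => funext fun Y => Iso.ext ?_))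
  · obtain ⟨f, rfl⟩ := quotHom_surjective (some c) _ _ f
    exact (descendHom_quotHom hF f).symm
  · change _ = F'.ε.hom ≫ F'.map (𝟙 _)
    rw [F'.map_id]
    exact (Category.comp_id _).symm
  · change _ = (F'.μ _ _).hom ≫ F'.map (𝟙 _)
    rw [F'.map_id]
    exact (Category.comp_id _).symm

/-- A monoidal superfunctor that satisfies the specialization relations factors uniquely through
the specialized diagram category. -/
theorem existsUnique_descend (hF : RespectsBubbles F c) :
    ∃! F' : MonoidalSuperfunctor k (Brauer inv σ (some c)) D,
      (quotFunctor inv σ c).comp F' = F :=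
  ⟨descend hF, quotFunctor_comp_descend hF, fun F' h => eq_descend F' hF h⟩

end Brauer

end Descend

/-! ### Linear algebra of supersymmetric forms -/

section Forms

variable {k : Type*} [Field k]

theorem koszul_self (r : ZMod 2) : koszul k r r = koszul k r 1 := by
  obtain rfl | rfl := zmod_two_cases r <;> simp

variable {V : Type*} [AddCommGroup V] [Module k V] [FiniteDimensional k V]
  (𝒱 : ZMod 2 → Submodule k V) [IsSuperspace 𝒱]

theorem exists_homogeneous_basis :
    ∃ (n : ℕ) (b : Module.Basis (Fin n) k V) (p : Fin n → ZMod 2), ∀ i, b i ∈ 𝒱 (p i) := by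
  let b₀ := Module.finBasis k (𝒱 0)
  let b₁ := Module.finBasis k (𝒱 1)
  let b := ((b₀.prod b₁).map
    (Submodule.prodEquivOfIsCompl (𝒱 0) (𝒱 1) IsSuperspace.isCompl)).reindex finSumFinEquiv
  refine ⟨_, b, fun i => Sum.elim (fun _ => 0) (fun _ => 1) (finSumFinEquiv.symm i), fun i => ?_⟩
  obtain ⟨j, rfl⟩ := finSumFinEquiv.surjective i
  rcases j with j | j
  · simp [b]
  · simp [b]

theorem signMap_signMap (r : ZMod 2) (v : V) : signMap 𝒱 r (signMap 𝒱 r v) = v := by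
  refine super_induction 𝒱 (P := fun v => signMap 𝒱 r (signMap 𝒱 r v) = v)
    (fun a b ha hb => by rw [map_add, map_add, ha, hb]) (fun s v hv => ?_) v
  rw [signMap_apply r hv, map_smul, signMap_apply r hv, smul_smul, koszul_mul_self, one_smul]

variable {𝒱} {Φ : LinearMap.BilinForm k V} {n : ℕ} {b : Module.Basis (Fin n) k V}
  {b' : Fin n → V}

theorem form_dual_eq_coord (hb : ∀ i j, Φ (b' i) (b j) = if i = j then 1 else 0) (i : Fin n) :
    Φ (b' i) = b.coord i :=
  b.ext fun j => by simp [hb, Finsupp.single_apply, eq_comm]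

theorem sum_form_smul_basis (hb : ∀ i j, Φ (b' i) (b j) = if i = j then 1 else 0) (x : V) :
    ∑ j, Φ (b' j) x • b j = x := by
  simp only [form_dual_eq_coord hb, Module.Basis.coord_apply, b.sum_repr]

/-- Both sides have the same pairing with every `b i` on the right, and nondegeneracy separates
vectors. The preceding expansion in the basis `b` needs only that the functionals `Φ (b' i)` are the
coordinates. -/
theorem sum_form_smul_dual (hΦ : Φ.Nondegenerate)
    (hb : ∀ i j, Φ (b' i) (b j) = if i = j then 1 else 0) (x : V) :
    ∑ j, Φ x (b j) • b' j = x := by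
  rw [← sub_eq_zero]
  refine hΦ.1 _ fun y => ?_
  have : Φ (∑ j, Φ x (b j) • b' j - x) = 0 := by
    refine b.ext fun i => ?_
    simp [hb]
  rw [this]; rfl

theorem lift_form_mem {σ : ZMod 2}
    (hΦσ : ∀ r s : ZMod 2, r + s ≠ σ → ∀ v ∈ 𝒱 r, ∀ w ∈ 𝒱 s, Φ v w = 0) :
    TensorProduct.lift Φ ∈ homParity (tensorGrading 𝒱 𝒱) (unitGrading k) σ := by
  refine homParity_tensor fun r v hv s x hx => ?_
  rw [TensorProduct.lift.tmul]
  by_cases h : r + s = σ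
  · rw [h, CharTwo.add_self_eq_zero]; simp [unitGrading]
  · rw [hΦσ r s h v hv x hx]; exact zero_mem _

/-- The component of `b' i` of the wrong parity `p i + σ + 1` is orthogonal to every `b j`. If `p j
= p i`, this is the parity of `Φ`. Otherwise `j ≠ i`, so all of `b' i` is orthogonal to `b j`, and
its component of parity `p i + σ` is so by parity. -/
theorem dual_mem {σ : ZMod 2} (hΦ : Φ.Nondegenerate)
    (hΦσ : ∀ r s : ZMod 2, r + s ≠ σ → ∀ v ∈ 𝒱 r, ∀ w ∈ 𝒱 s, Φ v w = 0)
    (hb : ∀ i j, Φ (b' i) (b j) = if i = j then 1 else 0) {p : Fin n → ZMod 2}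
    (hp : ∀ i, b i ∈ 𝒱 (p i)) (i : Fin n) : b' i ∈ 𝒱 (p i + σ) := by
  have key : parityProj 𝒱 (p i + σ + 1) (b' i) = 0 := by
    refine hΦ.1 _ fun y => ?_
    have : Φ (parityProj 𝒱 (p i + σ + 1) (b' i)) = 0 := by
      refine b.ext fun j => ?_
      rw [LinearMap.zero_apply]
      by_cases hj : p j = p i
      · refine hΦσ _ _ ?_ _ (parityProj_mem _ _ _) _ (hp j)
        rw [hj]
        exact (by decide : ∀ p s : ZMod 2, p + s + 1 + p ≠ s) _ _
      · have h1 : Φ (b' i) (b j) = 0 := by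
          rw [hb, if_neg]; rintro rfl; exact hj rfl
        have h2 : ∀ r, p j = r + 1 → r = p i → Φ (parityProj 𝒱 (r + σ) (b' i)) (b j) = 0 := by
          intro r hr _
          refine hΦσ _ _ ?_ _ (parityProj_mem _ _ _) _ (hp j)
          rw [hr]
          exact (by decide : ∀ r s : ZMod 2, r + s + (r + 1) ≠ s) _ _
        have h3 : p j = p i + 1 := (by decide : ∀ s r : ZMod 2, s ≠ r → s = r + 1) _ _ hj
        have h4 : parityProj 𝒱 (p i + σ) (b' i) + parityProj 𝒱 (p i + σ + 1) (b' i) = b' i := by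
          have h5 := parityProj_add 𝒱 (b' i)
          obtain h | h := zmod_two_cases (p i + σ)
          · rw [h, zero_add]; exact h5
          · rw [h, CharTwo.add_self_eq_zero, add_comm]; exact h5
        rw [← h4, map_add, LinearMap.add_apply, h2 _ h3 rfl, zero_add] at h1
        exact h1
    rw [this]; rfl
  have h4 : parityProj 𝒱 (p i + σ) (b' i) + parityProj 𝒱 (p i + σ + 1) (b' i) = b' i := by
    have h5 := parityProj_add 𝒱 (b' i)
    obtain h | h := zmod_two_cases (p i + σ)
    · rw [h, zero_add]; exact h5
    · rw [h, CharTwo.add_self_eq_zero, add_comm]; exact h5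
  rw [← h4, key, add_zero]
  exact parityProj_mem _ _ _

/-- The contraction `u ⊗ v ⊗ w ↦ (-1)^{σ ū} Φ(v, w) u`. -/
theorem contract_tmul {σ : ZMod 2}
    (hΦσ : ∀ r s : ZMod 2, r + s ≠ σ → ∀ v ∈ 𝒱 r, ∀ w ∈ 𝒱 s, Φ v w = 0) (u v w : V) :
    TensorProduct.rid k V (superTensor 𝒱 (tensorGrading 𝒱 𝒱) (unitGrading k) LinearMap.id
      (TensorProduct.lift Φ) (u ⊗ₜ (v ⊗ₜ w))) = Φ v w • signMap 𝒱 σ u := by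
  rw [superTensor_eq_map _ (lift_form_mem hΦσ)]
  simp

/-- A copairing that satisfies the zigzag identity is given by dual bases. -/
theorem eq_sum_of_zigzag {σ : ZMod 2} (hΦ : Φ.Nondegenerate)
    (hΦσ : ∀ r s : ZMod 2, r + s ≠ σ → ∀ v ∈ 𝒱 r, ∀ w ∈ 𝒱 s, Φ v w = 0)
    (hb : ∀ i j, Φ (b' i) (b j) = if i = j then 1 else 0) {p : Fin n → ZMod 2}
    (hp : ∀ i, b i ∈ 𝒱 (p i)) {z : V ⊗[k] V}
    (hz : ∀ w, TensorProduct.rid k V (superTensor 𝒱 (tensorGrading 𝒱 𝒱) (unitGrading k)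
      LinearMap.id (TensorProduct.lift Φ) (TensorProduct.assoc k V V V (z ⊗ₜ w))) = w) :
    z = ∑ i, koszul k σ (p i) • (b i ⊗ₜ[k] b' i) := by
  -- An identity valid for every `z`: for `z = u ⊗ v`, contracting `v` with `b j` leaves `Φ v (b j)`
  -- times `u` up to the sign of moving the form past `u`, the outer `signMap` cancels that sign,
  -- and the sum over `j` rebuilds `v` from the dual basis. The zigzag hypothesis then replaces each
  -- contraction by `b j`.
  have key : ∀ z : V ⊗[k] V, z = ∑ j, signMap 𝒱 σ (TensorProduct.rid k V
      (superTensor 𝒱 (tensorGrading 𝒱 𝒱) (unitGrading k) LinearMap.id (TensorProduct.lift Φ)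
        (TensorProduct.assoc k V V V (z ⊗ₜ b j)))) ⊗ₜ[k] b' j := by
    intro z
    induction z with
    | zero => simp
    | add x y hx hy =>
      conv_lhs => rw [hx, hy]
      rw [← Finset.sum_add_distrib]
      refine Finset.sum_congr rfl fun j _ => ?_
      simp only [TensorProduct.add_tmul, map_add]
    | tmul u v =>
      simp only [TensorProduct.assoc_tmul, contract_tmul hΦσ, map_smul, signMap_signMap,
        TensorProduct.smul_tmul]
      rw [← TensorProduct.tmul_sum, sum_form_smul_dual hΦ hb]
  rw [key z]
  refine Finset.sum_congr rfl fun j _ => ?_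
  rw [hz, signMap_apply σ (hp j), TensorProduct.smul_tmul']

end Forms

/-! ### Supertraces and the value of a bubble -/

section Supertrace

variable {k : Type*} [Field k] {A : Type*} [Ring A] [Algebra k A]
  {𝒜 : ZMod 2 → Submodule k A} [IsSuperspace 𝒜]
  {V : Type*} [AddCommGroup V] [Module k V] [Module Aᵐᵒᵖ V] [IsScalarTower k Aᵐᵒᵖ V]
  {𝒱 : ZMod 2 → Submodule k V} [IsSuperspace 𝒱]

theorem rightMul_apply (a : A) (v : V) : rightMul k V a v = MulOpposite.op a • v := rfl

theorem rightMul_add (a b : A) : rightMul k V (a + b) = rightMul k V a + rightMul k V b := by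
  ext v; simp [rightMul_apply, add_smul]

theorem supertrace_add (a b : A) :
    supertrace 𝒱 (a + b) = supertrace 𝒱 a + supertrace 𝒱 b := by
  rw [supertrace, rightMul_add, LinearMap.comp_add, map_add]; rfl

theorem rho_add (a b : A) : rho 𝒜 𝒱 (a + b) = rho 𝒜 𝒱 a + rho 𝒜 𝒱 b := by
  simp only [rho, map_add, rightMul_add, LinearMap.add_comp, Finset.sum_add_distrib]

theorem rho_eq {r : ZMod 2} {a : A} (ha : a ∈ 𝒜 r) :
    rho 𝒜 𝒱 a = rightMul k V a ∘ₗ signMap 𝒱 r := by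
  rw [rho, Finset.sum_eq_single r]
  · rw [parityProj_same 𝒜 ha]
  · intro s _ hs
    rw [parityProj_ne 𝒜 ha hs.symm]
    ext v; simp [rightMul_apply]
  · simp

theorem rho_apply {r s : ZMod 2} {a : A} (ha : a ∈ 𝒜 r) {v : V} (hv : v ∈ 𝒱 s) :
    rho 𝒜 𝒱 a v = koszul k r s • (MulOpposite.op a • v) := by
  rw [rho_eq ha, LinearMap.comp_apply, signMap_apply r hv, map_smul, rightMul_apply]

theorem rho_mem (hV : ∀ r s : ZMod 2, ∀ a ∈ 𝒜 r, ∀ v ∈ 𝒱 s, MulOpposite.op a • v ∈ 𝒱 (r + s))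
    {r : ZMod 2} {a : A} (ha : a ∈ 𝒜 r) : rho 𝒜 𝒱 a ∈ homParity 𝒱 𝒱 r := fun s v hv => by
  rw [rho_apply ha hv, add_comm]
  exact Submodule.smul_mem _ _ (hV r s a ha v hv)

variable {Φ : LinearMap.BilinForm k V} {n : ℕ} {b : Module.Basis (Fin n) k V}
  {b' : Fin n → V} {p : Fin n → ZMod 2}

theorem supertrace_eq_sum [FiniteDimensional k V]
    (hb : ∀ i j, Φ (b' i) (b j) = if i = j then 1 else 0)
    (hp : ∀ i, b i ∈ 𝒱 (p i)) (a : A) :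
    supertrace 𝒱 a = ∑ i, koszul k (p i) 1 * Φ (b' i) (MulOpposite.op a • b i) := by
  have h1 : ∀ x i, b.repr x i = Φ (b' i) x := fun x i => by
    rw [form_dual_eq_coord hb, Module.Basis.coord_apply]
  -- Cyclicity of the trace lets the sign operator act before `a`, that is, on the basis vectors,
  -- whose parities are known.
  rw [supertrace, LinearMap.trace_comp_comm', LinearMap.trace_eq_matrix_trace k b, Matrix.trace]
  refine Finset.sum_congr rfl fun i _ => ?_
  rw [Matrix.diag_apply, LinearMap.toMatrix_apply, h1, LinearMap.comp_apply,
    parityInv_apply 𝒱 (hp i), map_smul, map_smul, rightMul_apply, smul_eq_mul]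

/-- The composite of the copairing, the action of a token and the pairing is a supertrace. -/
theorem form_rho_copairing [FiniteDimensional k V] {inv : AntiInvolution 𝒜} {ν : k} {σ : ZMod 2}
    (hV : ∀ r s : ZMod 2, ∀ a ∈ 𝒜 r, ∀ v ∈ 𝒱 s, MulOpposite.op a • v ∈ 𝒱 (r + s))
    (hΦσ : ∀ r s : ZMod 2, r + s ≠ σ → ∀ v ∈ 𝒱 r, ∀ w ∈ 𝒱 s, Φ v w = 0)
    (hΦν : ∀ r s : ZMod 2, ∀ v ∈ 𝒱 r, ∀ w ∈ 𝒱 s, Φ v w = ν * koszul k r s * Φ w v)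
    (hΦA : ∀ r s : ZMod 2, ∀ a ∈ 𝒜 r, ∀ w ∈ 𝒱 s, ∀ v : V,
      Φ (MulOpposite.op a • v) w = koszul k r s * Φ v (MulOpposite.op (inv.toFun a) • w))
    (hΦ : Φ.Nondegenerate) (hb : ∀ i j, Φ (b' i) (b j) = if i = j then 1 else 0)
    (hp : ∀ i, b i ∈ 𝒱 (p i)) (a : A) :
    TensorProduct.lift Φ (superTensor 𝒱 𝒱 𝒱 LinearMap.id (rho 𝒜 𝒱 (inv.toFun a))
      (∑ i, koszul k σ (p i) • (b i ⊗ₜ[k] b' i))) = ν * supertrace 𝒱 a := by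
  refine super_induction 𝒜 (P := fun a => TensorProduct.lift Φ (superTensor 𝒱 𝒱 𝒱 LinearMap.id
    (rho 𝒜 𝒱 (inv.toFun a)) (∑ i, koszul k σ (p i) • (b i ⊗ₜ[k] b' i))) = ν * supertrace 𝒱 a)
    (fun x y hx hy => ?_) (fun r a ha => ?_) a
  · rw [map_add, rho_add, superTensor_add_right, LinearMap.add_apply, map_add, hx, hy,
      supertrace_add, mul_add]
  rw [supertrace_eq_sum hb hp, map_sum, map_sum, Finset.mul_sum]
  refine Finset.sum_congr rfl fun i _ => ?_
  have hb'i := dual_mem hΦ hΦσ hb hp i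
  have ha' := inv.map_mem ha
  rw [map_smul, map_smul, superTensor_apply 𝒱 𝒱 𝒱 _ (rho_mem hV ha') (hp i), map_smul,
    TensorProduct.lift.tmul, LinearMap.id_apply, rho_apply ha' hb'i, map_smul]
  have h1 := hΦA r _ a ha _ hb'i (b i)
  have h2 := hΦν _ _ _ (hV r _ a ha _ (hp i)) _ hb'i
  -- Adjointness returns `a⋆` from `b' i` to `b i` as `a`; supersymmetry then exchanges the
  -- arguments, which is where the factor `ν` arises and a matrix coefficient appears.
  have h3 : Φ (b i) (MulOpposite.op (inv.toFun a) • b' i) = koszul k r (p i + σ) *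
      (ν * koszul k (r + p i) (p i + σ) * Φ (b' i) (MulOpposite.op a • b i)) := by
    rw [← h2, h1, ← mul_assoc, koszul_mul_self, one_mul]
  rw [h3]
  -- For even `a` the surviving signs are `(-1)^{σ p}` from the copairing and `(-1)^{p (p + σ)}`
  -- from the exchange, with product `(-1)^p`, the sign in the supertrace. For odd `a` the diagonal
  -- coefficients vanish by parity.
  obtain rfl | rfl := zmod_two_cases r
  · simp only [koszul_zero_left, smul_eq_mul, one_mul, zero_add, koszul_add_right, koszul_self,
      koszul_comm σ]
    linear_combination (ν * koszul k (p i) 1 * Φ (b' i) (MulOpposite.op a • b i)) *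
      koszul_mul_self (k := k) (p i) σ
  · have h4 : Φ (b' i) (MulOpposite.op a • b i) = 0 := by
      refine hΦσ _ _ ?_ _ hb'i _ (hV 1 _ a ha _ (hp i))
      exact (by decide : ∀ p s : ZMod 2, p + s + (1 + p) ≠ s) _ _
    rw [h4]; simp

end Supertrace

/-! ### Supertraces on free supermodules -/

section FreeModules

theorem LinearMap.trace_pi_comp_proj {k ι M : Type*} [Field k] [Fintype ι]
    [AddCommGroup M] [Module k M] [FiniteDimensional k M] (f : ι → M →ₗ[k] M) :
    LinearMap.trace k (ι → M) (LinearMap.pi fun i => f i ∘ₗ LinearMap.proj i) =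
      ∑ i, LinearMap.trace k M (f i) := by
  classical
  let b := Module.finBasis k M
  rw [LinearMap.trace_eq_matrix_trace k (Pi.basis fun _ : ι => b), Matrix.trace,
    Fintype.sum_sigma]
  refine Finset.sum_congr rfl fun i _ => ?_
  rw [LinearMap.trace_eq_matrix_trace k b, Matrix.trace]
  refine Finset.sum_congr rfl fun j _ => ?_
  simp [LinearMap.toMatrix_apply]

variable {k : Type*} [Field k] {A : Type*} [Ring A] [Algebra k A]
  {𝒜 : ZMod 2 → Submodule k A} [IsSuperspace 𝒜]
  {V : Type*} [AddCommGroup V] [Module k V] [FiniteDimensional k V] [Module Aᵐᵒᵖ V]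
  [IsScalarTower k Aᵐᵒᵖ V]
  {𝒱 : ZMod 2 → Submodule k V} [IsSuperspace 𝒱]

/-- The supertrace of the action on a free supermodule. -/
theorem supertrace_free (m n : ℕ) (φ : V ≃ₗ[Aᵐᵒᵖ] (Fin m ⊕ Fin n → A))
    (hφ : ∀ (r : ZMod 2) (v : V), v ∈ 𝒱 r ↔ φ v ∈ freeGrading 𝒜 m n r) (a : A) :
    supertrace 𝒱 a = ((m : k) - n) * supertrace 𝒜 a := by
  let e : V ≃ₗ[k] (Fin m ⊕ Fin n → A) := φ.restrictScalars k
  -- If `A` is infinite-dimensional, finiteness of `V` forces `m = n = 0`; then both sides vanish,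
  -- whatever value the trace on `A` takes by convention.
  by_cases hA : FiniteDimensional k A
  -- On a parity-shifted copy of `A` the sign operator is minus that of `A`; the endomorphism
  -- becomes block diagonal with blocks `± parityInv ∘ rightMul a`.
  · let s : Fin m ⊕ Fin n → k := Sum.elim (fun _ => 1) (fun _ => -1)
    have key : e.conj (parityInv 𝒱 ∘ₗ rightMul k V a) =
        LinearMap.pi fun i => (s i • (parityInv 𝒜 ∘ₗ rightMul k A a)) ∘ₗ LinearMap.proj i := by
      have h1 : ∀ v, e (parityInv 𝒱 v) = fun i => s i • parityInv 𝒜 (e v i) := by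
        refine super_induction 𝒱 (fun x y hx hy => ?_) fun r v hv => ?_
        · rw [map_add, map_add, hx, hy]
          funext i; simp
        · have h2 := (hφ r v).1 hv
          rw [parityInv_apply 𝒱 hv, map_smul]
          funext i
          rcases i with i | i
          · change koszul k r 1 • φ v (Sum.inl i) = (1 : k) • parityInv 𝒜 (φ v (Sum.inl i))
            rw [parityInv_apply 𝒜 (h2.1 i), one_smul]
          · change koszul k r 1 • φ v (Sum.inr i) = (-1 : k) • parityInv 𝒜 (φ v (Sum.inr i))
            rw [parityInv_apply 𝒜 (h2.2 i), koszul_add_left, smul_smul]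
            simp
      refine LinearMap.ext fun x => ?_
      obtain ⟨v, rfl⟩ := e.surjective x
      rw [LinearEquiv.conj_apply_apply, e.symm_apply_apply, LinearMap.comp_apply, h1]
      funext i
      have h3 : e (rightMul k V a v) i = rightMul k A a (e v i) := by
        change φ (MulOpposite.op a • v) i = _
        rw [map_smul]; rfl
      simp [h3]
    rw [supertrace, ← LinearMap.trace_conj' _ e, key, LinearMap.trace_pi_comp_proj]
    simp only [map_smul, Fintype.sum_sum_type, s, Sum.elim_inl, Sum.elim_inr, Finset.sum_const,
      Finset.card_univ, Fintype.card_fin]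
    rw [supertrace]
    simp only [nsmul_eq_mul, smul_eq_mul]
    ring
  · have hempty : IsEmpty (Fin m ⊕ Fin n) := by
      refine ⟨fun i => hA ?_⟩
      refine Module.Finite.of_surjective ((LinearMap.proj i : (Fin m ⊕ Fin n → A) →ₗ[k] A) ∘ₗ
        e.toLinearMap) ?_
      exact (Function.surjective_eval i).comp e.surjective
    have hm : m = 0 := by
      by_contra h
      exact hempty.false (Sum.inl ⟨0, Nat.pos_of_ne_zero h⟩)
    have hn : n = 0 := by
      by_contra h
      exact hempty.false (Sum.inr ⟨0, Nat.pos_of_ne_zero h⟩)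
    have : Subsingleton V := e.toEquiv.subsingleton
    have h0 : parityInv 𝒱 ∘ₗ rightMul k V a = 0 := LinearMap.ext fun v => Subsingleton.elim _ _
    rw [supertrace, h0, hm, hn]
    simp

end FreeModules

/-! ### Consequences of the defining properties of an incarnation superfunctor -/

section Zigzag

open Supercategory MonoidalSupercategory

variable {k : Type u} [Field k] {A : Type w} [Ring A] [Algebra k A]
  {𝒜 : ZMod 2 → Submodule k A} [SetLike.GradedMonoid 𝒜] [IsSuperspace 𝒜]
  {inv : AntiInvolution 𝒜} {σ : ZMod 2}
  {D : Type*} [Category D] [Preadditive D] [Linear k D] [Supercategory k D]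
  [MonoidalSupercategory k D]

/-- The zigzag identity is invariant under transport along an even isomorphism. -/
theorem zigzag_transport {X Y : D} (e : X ≅ Y) (he : e.hom ∈ homPart (k := k) X Y 0)
    {C : (unit k : D) ⟶ tensorObj k X X} {K : tensorObj k X X ⟶ (unit k : D)}
    (h : (leftUnitor (k := k) X).inv ≫ tensorHom (k := k) C (𝟙 X) ≫ (assocIso (k := k) X X X).hom ≫
      tensorHom (k := k) (𝟙 X) K ≫ (rightUnitor (k := k) X).hom = 𝟙 X) :
    (leftUnitor (k := k) Y).inv ≫
      tensorHom (k := k) (C ≫ tensorHom (k := k) e.hom e.hom) (𝟙 Y) ≫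
      (assocIso (k := k) Y Y Y).hom ≫
      tensorHom (k := k) (𝟙 Y) (tensorHom (k := k) e.inv e.inv ≫ K) ≫
      (rightUnitor (k := k) Y).hom = 𝟙 Y := by
  have hei := inv_mem_even he
  -- The isomorphism is carried through the composite from left to right, past the unitor, the cup,
  -- the associator and the cap; it finally meets its inverse.
  have h1 : (leftUnitor (k := k) Y).inv =
      e.inv ≫ (leftUnitor (k := k) X).inv ≫ tensorHom (k := k) (𝟙 _) e.hom := by
    rw [Iso.eq_inv_comp, Iso.eq_inv_comp, ← Category.assoc, Iso.comp_inv_eq, leftUnitor_naturality]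
  have h2 : tensorHom (k := k) (𝟙 (unit k)) e.hom ≫
      tensorHom (k := k) (C ≫ tensorHom (k := k) e.hom e.hom) (𝟙 Y) =
      tensorHom (k := k) C (𝟙 X) ≫ tensorHom (k := k) (tensorHom (k := k) e.hom e.hom) e.hom := by
    rw [tensorHom_comp_of_left_even _ _ _ (id_mem _), tensorHom_comp_of_right_even _ _ _ he,
      Category.id_comp, Category.comp_id, Category.id_comp]
  have h3 : tensorHom (k := k) e.hom (tensorHom (k := k) e.hom e.hom) ≫
      tensorHom (k := k) (𝟙 Y) (tensorHom (k := k) e.inv e.inv ≫ K) =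
      tensorHom (k := k) (𝟙 X) K ≫ tensorHom (k := k) e.hom (𝟙 _) := by
    rw [tensorHom_comp_of_left_even _ _ _ he, tensorHom_comp_of_left_even _ _ _ (id_mem _),
      Category.id_comp, Category.comp_id, Category.comp_id, ← Category.assoc,
      tensorHom_comp_of_left_even _ _ _ he, e.hom_inv_id, tensorHom_id, Category.id_comp]
  rw [h1, Category.assoc, Category.assoc, ← Category.assoc (tensorHom (k := k) (𝟙 (unit k)) e.hom),
    h2, Category.assoc, ← Category.assoc (tensorHom (k := k) (tensorHom (k := k) e.hom e.hom) e.hom),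
    associator_naturality, Category.assoc, ← Category.assoc (tensorHom (k := k) e.hom _), h3,
    Category.assoc, rightUnitor_naturality]
  rw [← Category.assoc (tensorHom (k := k) (𝟙 X) K),
    ← Category.assoc (assocIso (k := k) X X X).hom, ← Category.assoc (tensorHom (k := k) C (𝟙 X)),
    ← Category.assoc (leftUnitor (k := k) X).inv, h, Category.id_comp, e.inv_hom_id]

/-- The zigzag identity for the transported cup and cap, deduced from the zigzag identity for
the images of the cup and the cap under a monoidal superfunctor. -/
theorem zigzag_of_constraints {P₀ P₁ P₂ P₃ : D} (ε : (unit k : D) ≅ P₀)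
    (μ₀₁ : tensorObj k P₀ P₁ ≅ P₁) (μ₁₀ : tensorObj k P₁ P₀ ≅ P₁) (μ₁₁ : tensorObj k P₁ P₁ ≅ P₂)
    (μ₂₁ : tensorObj k P₂ P₁ ≅ P₃) (μ₁₂ : tensorObj k P₁ P₂ ≅ P₃) (u : P₀ ⟶ P₂) (v : P₂ ⟶ P₀)
    (hε : ε.hom ∈ homPart (k := k) _ _ 0)
    (h₀₁ : (leftUnitor (k := k) P₁).hom = tensorHom (k := k) ε.hom (𝟙 P₁) ≫ μ₀₁.hom)
    (h₁₀ : μ₁₀.hom = tensorHom (k := k) (𝟙 P₁) ε.inv ≫ (rightUnitor (k := k) P₁).hom)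
    (h₁₁ : tensorHom (k := k) μ₁₁.hom (𝟙 P₁) ≫ μ₂₁.hom = (assocIso (k := k) P₁ P₁ P₁).hom ≫
      tensorHom (k := k) (𝟙 P₁) μ₁₁.hom ≫ μ₁₂.hom)
    (h : (μ₀₁.inv ≫ tensorHom (k := k) u (𝟙 P₁) ≫ μ₂₁.hom) ≫ μ₁₂.inv ≫
      tensorHom (k := k) (𝟙 P₁) v ≫ μ₁₀.hom = 𝟙 P₁) :
    (leftUnitor (k := k) P₁).inv ≫ tensorHom (k := k) (ε.hom ≫ u ≫ μ₁₁.inv) (𝟙 P₁) ≫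
      (assocIso (k := k) P₁ P₁ P₁).hom ≫ tensorHom (k := k) (𝟙 P₁) (μ₁₁.hom ≫ v ≫ ε.inv) ≫
      (rightUnitor (k := k) P₁).hom = 𝟙 P₁ := by
  have h2 : μ₀₁.inv = (leftUnitor (k := k) P₁).inv ≫ tensorHom (k := k) ε.hom (𝟙 _) := by
    rw [Iso.eq_inv_comp, Iso.comp_inv_eq, h₀₁]
  -- The associativity axiom makes the associator of the target appear between the two halves of the
  -- snake, where the source has a trivial one.
  have h3 : μ₂₁.hom ≫ μ₁₂.inv = tensorHom (k := k) μ₁₁.inv (𝟙 _) ≫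
      (assocIso (k := k) _ _ _).hom ≫ tensorHom (k := k) (𝟙 _) μ₁₁.hom := by
    rw [Iso.comp_inv_eq, Category.assoc, Category.assoc, ← h₁₁, ← Category.assoc,
      tensorHom_comp_of_right_even _ _ _ (id_mem _), Iso.inv_hom_id, Category.id_comp,
      tensorHom_id, Category.id_comp]
  have h9 : tensorHom (k := k) (ε.hom ≫ u ≫ μ₁₁.inv) (𝟙 P₁) =
      tensorHom (k := k) ε.hom (𝟙 _) ≫ tensorHom (k := k) u (𝟙 _) ≫
      tensorHom (k := k) μ₁₁.inv (𝟙 _) := by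
    rw [tensorHom_comp_of_right_even _ _ _ (id_mem _), tensorHom_comp_of_left_even _ _ _ hε]
    simp only [Category.comp_id]
  have h11 : tensorHom (k := k) (𝟙 P₁) (μ₁₁.hom ≫ v ≫ ε.inv) =
      tensorHom (k := k) (𝟙 _) μ₁₁.hom ≫ tensorHom (k := k) (𝟙 _) v ≫
        tensorHom (k := k) (𝟙 _) ε.inv := by
    rw [tensorHom_comp_of_left_even _ _ _ (id_mem _), tensorHom_comp_of_left_even _ _ _ (id_mem _)]
    simp only [Category.comp_id]
  rw [Category.assoc, Category.assoc, ← Category.assoc μ₂₁.hom, h2, h3, h₁₀] at h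
  rw [h9, h11]
  simpa only [Category.assoc] using h

namespace Brauer

/-- The image of the snake relation with all constraints resolved. Strand numbers such as `0 + 1`,
`1 + 1` and `2 + 1` are identified by computation with `1`, `2` and `3`, so the constraints become
isomorphisms among four objects, as `zigzag_of_constraints` requires. -/
theorem zigzag (F : MonoidalSuperfunctor k (Brauer inv σ none) D) :
    (leftUnitor (k := k) (F.obj (go inv σ none))).inv ≫
      tensorHom (k := k) (F.ε.hom ≫ F.map (cup inv σ none) ≫
        (F.μ (go inv σ none) (go inv σ none)).inv) (𝟙 _) ≫
      (assocIso (k := k) _ _ _).hom ≫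
      tensorHom (k := k) (𝟙 _) ((F.μ (go inv σ none) (go inv σ none)).hom ≫
        F.map (cap inv σ none) ≫ F.ε.inv) ≫
      (rightUnitor (k := k) _).hom = 𝟙 _ := by
  refine zigzag_of_constraints (P₀ := F.obj (pow inv σ none 0)) (P₁ := F.obj (pow inv σ none 1))
    (P₂ := F.obj (pow inv σ none 2)) (P₃ := F.obj (pow inv σ none 3)) F.ε
    (F.μ (pow inv σ none 0) (pow inv σ none 1)) (F.μ (pow inv σ none 1) (pow inv σ none 0))
    (F.μ (pow inv σ none 1) (pow inv σ none 1)) (F.μ (pow inv σ none 2) (pow inv σ none 1))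
    (F.μ (pow inv σ none 1) (pow inv σ none 2)) (mapDiag F _ Diag.cup) (mapDiag F _ Diag.cap)
    F.ε_mem (left_unitality_go F) (right_unitality_pow F 1) ?_ ?_
  · have h4 := F.associativity (pow inv σ none 1) (pow inv σ none 1) (pow inv σ none 1)
    have h5 : F.map (assocIso (k := k) (pow inv σ none 1) (pow inv σ none 1)
      (pow inv σ none 1)).hom = 𝟙 (F.obj (pow inv σ none 3)) := map_idOf F _
    rw [h5] at h4
    refine Eq.trans ?_ h4
    congr 1
    exact (Category.comp_id _).symm
  · have h := BrauerHom.of_eq (DiagRel.snake (inv := inv) (σ := σ) (d := none))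
    have h1 : mapDiag F 0 (Diag.comp (Diag.strandRight Diag.cup) (Diag.strandLeft Diag.cap)
        (CharTwo.add_self_eq_zero σ)) = mapDiag F 0 (Diag.id rfl) := by
      rw [mapDiag, h, mapDiag]
    rw [mapDiag_comp, mapDiag_tensor, mapDiag_tensor, mapDiag_id] at h1
    exact h1

end Brauer

end Zigzag

/-! ### Cup, bubbles and uniqueness for a given incarnation superfunctor -/

section Properties

open Supercategory MonoidalSupercategory

variable {k : Type u} [Field k] {A : Type w} [Ring A] [Algebra k A]
  {𝒜 : ZMod 2 → Submodule k A} [SetLike.GradedMonoid 𝒜] [IsSuperspace 𝒜]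
  {inv : AntiInvolution 𝒜} {σ : ZMod 2}
  {V : Type u} [AddCommGroup V] [Module k V] [FiniteDimensional k V] [Module Aᵐᵒᵖ V]
  [IsScalarTower k Aᵐᵒᵖ V] {𝒱 : ZMod 2 → Submodule k V} [IsSuperspace 𝒱]
  {Φ : LinearMap.BilinForm k V} {ν : k}

namespace IsIncarnation

variable {F : MonoidalSuperfunctor k (Brauer inv σ none) (GSMod A 𝒱 Φ)}
  {e : F.obj (Brauer.go inv σ none) ≅ GSMod.std A 𝒱 Φ}

/-- The zigzag identity transported to `V` along `e` and read on vectors. The cap being `Φ`, it says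
that the image of the cup is inverse to `Φ`; hence this image needs no prescription. -/
theorem contract_cupOn (h : IsIncarnation F e ν) (w : V) :
    TensorProduct.rid k V (superTensor 𝒱 (tensorGrading 𝒱 𝒱) (unitGrading k)
      LinearMap.id (TensorProduct.lift Φ) (TensorProduct.assoc k V V V (cupOn F e 1 ⊗ₜ w))) = w := by
  have h1 := zigzag_transport e h.even (Brauer.zigzag F)
  simp only [Category.assoc] at h1
  have h2 := LinearMap.congr_fun (congrArg GSMod.lin h1) w
  -- The inverse left unitor sends `w` to `1 ⊗ w`, and the remaining structural morphisms are those
  -- of the underlying vector spaces.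
  have h3 : TensorProduct.rid k V (superTensor 𝒱 (tensorGrading 𝒱 𝒱) (unitGrading k)
      LinearMap.id (capOn F e) (TensorProduct.assoc k V V V
        (superTensor (unitGrading k) 𝒱 𝒱 (cupOn F e) LinearMap.id (1 ⊗ₜ w)))) = w := h2
  rw [h.cap, superTensor_even _ (homParity_id 𝒱), TensorProduct.map_tmul] at h3
  exact h3

theorem cupOn_eq (h : IsIncarnation F e ν) (hΦ : Φ.Nondegenerate)
    (hΦσ : ∀ r s : ZMod 2, r + s ≠ σ → ∀ v ∈ 𝒱 r, ∀ w ∈ 𝒱 s, Φ v w = 0)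
    {n : ℕ} {b : Module.Basis (Fin n) k V} {p : Fin n → ZMod 2} {b' : Fin n → V}
    (hp : ∀ i, b i ∈ 𝒱 (p i)) (hb : ∀ i j, Φ (b' i) (b j) = if i = j then 1 else 0) :
    cupOn F e 1 = ∑ i, koszul k σ (p i) • (b i ⊗ₜ[k] b' i) :=
  eq_sum_of_zigzag hΦ hΦσ hb hp h.contract_cupOn

end IsIncarnation

theorem exists_dual_bases (𝒱 : ZMod 2 → Submodule k V) [IsSuperspace 𝒱] (hΦ : Φ.Nondegenerate) :
    ∃ (n : ℕ) (b : Module.Basis (Fin n) k V) (p : Fin n → ZMod 2) (b' : Fin n → V),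
      (∀ i, b i ∈ 𝒱 (p i)) ∧ ∀ i j, Φ (b' i) (b j) = if i = j then 1 else 0 := by
  obtain ⟨n, b, p, hp⟩ := exists_homogeneous_basis 𝒱
  refine ⟨n, b, p, Φ.dualBasis hΦ b, hp, fun i j => ?_⟩
  rw [LinearMap.BilinForm.apply_dualBasis_left]
  simp only [eq_comm]

namespace IsIncarnation

variable {F : MonoidalSuperfunctor k (Brauer inv σ none) (GSMod A 𝒱 Φ)}
  {e : F.obj (Brauer.go inv σ none) ≅ GSMod.std A 𝒱 Φ}

/-- The bubbles are sent to supertraces. -/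
theorem map_bubble (h : IsIncarnation F e ν) (hΦ : Φ.Nondegenerate)
    (hV : ∀ r s : ZMod 2, ∀ a ∈ 𝒜 r, ∀ v ∈ 𝒱 s, MulOpposite.op a • v ∈ 𝒱 (r + s))
    (hΦσ : ∀ r s : ZMod 2, r + s ≠ σ → ∀ v ∈ 𝒱 r, ∀ w ∈ 𝒱 s, Φ v w = 0)
    (hΦν : ∀ r s : ZMod 2, ∀ v ∈ 𝒱 r, ∀ w ∈ 𝒱 s, Φ v w = ν * koszul k r s * Φ w v)
    (hΦA : ∀ r s : ZMod 2, ∀ a ∈ 𝒜 r, ∀ w ∈ 𝒱 s, ∀ v : V,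
      Φ (MulOpposite.op a • v) w = koszul k r s * Φ v (MulOpposite.op (inv.toFun a) • w))
    (a : A) :
    F.map (Brauer.bubble inv σ none a) = (ν * supertrace 𝒱 a) • 𝟙 (F.obj (unit k)) := by
  obtain ⟨n, b, p, b', hp, hb⟩ := exists_dual_bases 𝒱 hΦ
  have he := h.even
  let I := Brauer.go inv σ none
  -- `C`, `T`, `K` are the cup, the token and the cap transported to `V`. Their composite is an
  -- endomorphism of the unit, determined by its value at `1`; the isomorphisms `e` introduced by
  -- the transport cancel in pairs.
  let C := F.ε.hom ≫ F.map (Brauer.cup inv σ none) ≫ (F.μ I I).inv ≫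
    tensorHom (k := k) e.hom e.hom
  let T := e.inv ≫ F.map (Brauer.token inv none a) ≫ e.hom
  let K := tensorHom (k := k) e.inv e.inv ≫ (F.μ I I).hom ≫ F.map (Brauer.cap inv σ none) ≫
    F.ε.inv
  have h1 : C ≫ tensorHom (k := k) (𝟙 _) T ≫ K = (ν * supertrace 𝒱 a) • 𝟙 (unit k) := by
    refine GSMod.hom_ext (LinearMap.ext_ring ?_)
    change capOn F e (superTensor 𝒱 𝒱 𝒱 LinearMap.id (tokenOn F e a) (cupOn F e 1)) =
      (ν * supertrace 𝒱 a) • 1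
    rw [h.cap, h.token, h.cupOn_eq hΦ hΦσ hp hb,
      form_rho_copairing hV hΦσ hΦν hΦA hΦ hb hp, smul_eq_mul, mul_one]
  have h2 : tensorHom (k := k) e.hom e.hom ≫ tensorHom (k := k) (𝟙 _) T ≫
      tensorHom (k := k) e.inv e.inv =
      tensorHom (k := k) (𝟙 _) (F.map (Brauer.token inv none a)) := by
    rw [tensorHom_comp_of_left_even _ _ _ (id_mem _), tensorHom_comp_of_left_even _ _ _ he]
    simp [T]
  have h3 : F.map (Brauer.bubble inv σ none a) = F.map (Brauer.cup inv σ none) ≫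
      ((F.μ I I).inv ≫ tensorHom (k := k) (𝟙 _) (F.map (Brauer.token inv none a)) ≫
        (F.μ I I).hom) ≫ F.map (Brauer.cap inv σ none) := by
    rw [Brauer.bubble, F.map_comp, F.map_comp, F.map_tensorHom, F.map_id]
  have h4 : F.map (Brauer.bubble inv σ none a) =
      F.ε.inv ≫ (C ≫ tensorHom (k := k) (𝟙 _) T ≫ K) ≫ F.ε.hom := by
    rw [h3, ← h2]
    simp only [C, K, Category.assoc, Iso.inv_hom_id_assoc, Iso.inv_hom_id, Category.comp_id]
  rw [h4, h1, Linear.smul_comp, Linear.comp_smul, Category.id_comp, F.ε.inv_hom_id]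

/-- An incarnation superfunctor on a free supermodule respects the specialization relations. -/
theorem respectsBubbles (h : IsIncarnation F e ν) (hΦ : Φ.Nondegenerate)
    (hV : ∀ r s : ZMod 2, ∀ a ∈ 𝒜 r, ∀ v ∈ 𝒱 s, MulOpposite.op a • v ∈ 𝒱 (r + s))
    (hΦσ : ∀ r s : ZMod 2, r + s ≠ σ → ∀ v ∈ 𝒱 r, ∀ w ∈ 𝒱 s, Φ v w = 0)
    (hΦν : ∀ r s : ZMod 2, ∀ v ∈ 𝒱 r, ∀ w ∈ 𝒱 s, Φ v w = ν * koszul k r s * Φ w v)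
    (hΦA : ∀ r s : ZMod 2, ∀ a ∈ 𝒜 r, ∀ w ∈ 𝒱 s, ∀ v : V,
      Φ (MulOpposite.op a • v) w = koszul k r s * Φ v (MulOpposite.op (inv.toFun a) • w))
    {m n : ℕ} (φ : V ≃ₗ[Aᵐᵒᵖ] (Fin m ⊕ Fin n → A))
    (hφ : ∀ (r : ZMod 2) (v : V), v ∈ 𝒱 r ↔ φ v ∈ freeGrading 𝒜 m n r) :
    Brauer.RespectsBubbles F (ν * ((m : k) - n)) := by
  -- The diagram `Diag.bubble` and the morphism `Brauer.bubble` differ only in bracketing and in how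
  -- a homogeneous token is written.
  have key : ∀ (r : ZMod 2) (a : A) (ha : a ∈ 𝒜 r), Brauer.mapDiag F r (Diag.bubble a ha) =
      (ν * supertrace 𝒱 a) • 𝟙 _ := by
    intro r a ha
    refine Eq.trans ?_ (h.map_bubble hΦ hV hΦσ hΦν hΦA a)
    rw [Brauer.mapDiag]
    congr 1
    have h1 : (BrauerHom.of (Diag.bubble a ha) : BrauerHom inv σ none 0 0) =
        BrauerHom.comp (BrauerHom.comp (BrauerHom.of Diag.cup)
          (BrauerHom.tensor (BrauerHom.idOf rfl) (BrauerHom.of (Diag.tok a ha))))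
          (BrauerHom.of Diag.cap) := by
      rw [BrauerHom.tensor_of _ _ (zero_add r), BrauerHom.comp_of _ _ rfl, BrauerHom.comp_of]
      rfl
    refine h1.trans ?_
    rw [← BrauerHom.token_of ha, BrauerHom.comp_assoc]
    rfl
  refine ⟨fun a ha => ?_, fun a ha => ?_⟩
  · rw [key 0 a ha, supertrace_free m n φ hφ]
    congr 1
    ring
  · rw [key 1 a ha]
    obtain ⟨n, b, p, b', hp, hb⟩ := exists_dual_bases 𝒱 hΦ
    -- An odd `a` changes the parity of `b i`, so its diagonal coefficients pair vectors of total
    -- parity `σ + 1`.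
    have h0 : supertrace 𝒱 a = 0 := by
      rw [supertrace_eq_sum hb hp]
      refine Finset.sum_eq_zero fun i _ => ?_
      rw [hΦσ _ _ ?_ _ (dual_mem hΦ hΦσ hb hp i) _ (hV 1 _ a ha _ (hp i)), mul_zero]
      exact (by decide : ∀ p s : ZMod 2, p + s + (1 + p) ≠ s) _ _
    rw [h0, mul_zero, zero_smul]

variable {F' : MonoidalSuperfunctor k (Brauer inv σ none) (GSMod A 𝒱 Φ)}
  {e' : F'.obj (Brauer.go inv σ none) ≅ GSMod.std A 𝒱 Φ}

/-- Incarnation superfunctors are unique up to a unique monoidal natural isomorphism. -/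
theorem existsUnique_natIso (h : IsIncarnation F e ν) (h' : IsIncarnation F' e' ν)
    (hΦ : Φ.Nondegenerate)
    (hΦσ : ∀ r s : ZMod 2, r + s ≠ σ → ∀ v ∈ 𝒱 r, ∀ w ∈ 𝒱 s, Φ v w = 0) :
    ∃! η : MonoidalSuperNatIso F F', (η.app (Brauer.go inv σ none)).hom ≫ e'.hom = e.hom := by
  have hi := comp_mem_even h.even (inv_mem_even h'.even)
  -- The normalization leaves no choice for the component at the generating object: it must be `e`
  -- followed by the inverse of `e'`.
  let i : F.obj (Brauer.go inv σ none) ≅ F'.obj (Brauer.go inv σ none) := e ≪≫ e'.symm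
  let I := Brauer.go inv σ none
  -- `S` and `S'` identify the two images of two strands with `V ⊗ V`. By monoidality the
  -- isomorphism on two strands is `S` followed by the inverse of `S'`, so naturality for a
  -- generator says that both superfunctors induce the same map on `V ⊗ V`.
  let S : F.obj (tensorObj k I I) ≅ tensorObj k (GSMod.std A 𝒱 Φ) (GSMod.std A 𝒱 Φ) :=
    (F.μ I I).symm ≪≫ tensorIso e e h.even
  let S' : F'.obj (tensorObj k I I) ≅ tensorObj k (GSMod.std A 𝒱 Φ) (GSMod.std A 𝒱 Φ) :=
    (F'.μ I I).symm ≪≫ tensorIso e' e' h'.even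
  have h1 : (Brauer.powIso F F' i hi 1).hom = i.hom := Brauer.powIso_one F F' i hi
  let j : F.obj (tensorObj k I I) ≅ F'.obj (tensorObj k I I) := Brauer.powIso F F' i hi 2
  have h3 : (F.μ I I).hom ≫ j.hom = tensorHom (k := k) i.hom i.hom ≫ (F'.μ I I).hom := by
    have h4 := Brauer.powIso_add F F' i hi 1 1
    rw [h1] at h4
    exact h4
  have hj : j.hom = S.hom ≫ S'.inv := by
    have h4 : tensorHom (k := k) i.hom i.hom = tensorHom (k := k) e.hom e.hom ≫
        tensorHom (k := k) e'.inv e'.inv := (tensorHom_comp_of_left_even _ _ _ h.even).symm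
    rw [← cancel_epi (F.μ I I).hom, h3, h4]
    simp only [S, S', Iso.trans_hom, Iso.trans_inv, Iso.symm_hom, Iso.symm_inv, tensorIso_hom,
      tensorIso_inv, Category.assoc, Iso.hom_inv_id_assoc]
  have h2 : (Brauer.powIso F F' i hi 2).hom = S.hom ≫ S'.inv := hj
  have h0 : (Brauer.powIso F F' i hi 0).hom = F.ε.inv ≫ F'.ε.hom := rfl
  have hcross : S.inv ≫ F.map (Brauer.cross inv σ none) ≫ S.hom =
      S'.inv ≫ F'.map (Brauer.cross inv σ none) ≫ S'.hom := by
    refine GSMod.hom_ext (Eq.trans ?_ ((h.cross.trans h'.cross.symm).trans ?_))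
    · simp only [crossOn, S, Iso.trans_hom, Iso.trans_inv, Iso.symm_hom, Iso.symm_inv,
        tensorIso_hom, tensorIso_inv, Category.assoc]
      rfl
    · simp only [crossOn, S', Iso.trans_hom, Iso.trans_inv, Iso.symm_hom, Iso.symm_inv,
        tensorIso_hom, tensorIso_inv, Category.assoc]
      rfl
  have hcap : S.inv ≫ F.map (Brauer.cap inv σ none) ≫ F.ε.inv =
      S'.inv ≫ F'.map (Brauer.cap inv σ none) ≫ F'.ε.inv := by
    refine GSMod.hom_ext (Eq.trans ?_ ((h.cap.trans h'.cap.symm).trans ?_))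
    · simp only [capOn, S, Iso.trans_inv, Iso.symm_inv, tensorIso_inv, Category.assoc]
      rfl
    · simp only [capOn, S', Iso.trans_inv, Iso.symm_inv, tensorIso_inv, Category.assoc]
      rfl
  -- Nothing is assumed about cups: both images equal the copairing of one and the same pair of dual
  -- bases.
  have hcup : F.ε.hom ≫ F.map (Brauer.cup inv σ none) ≫ S.hom =
      F'.ε.hom ≫ F'.map (Brauer.cup inv σ none) ≫ S'.hom := by
    obtain ⟨n, b, p, b', hp, hb⟩ := exists_dual_bases 𝒱 hΦ
    refine GSMod.hom_ext (LinearMap.ext_ring ?_)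
    exact (h.cupOn_eq hΦ hΦσ hp hb).trans (h'.cupOn_eq hΦ hΦσ hp hb).symm
  have htok : ∀ a : A, F.map (Brauer.token inv none a) ≫ i.hom =
      i.hom ≫ F'.map (Brauer.token inv none a) := by
    intro a
    have h3 : e.inv ≫ F.map (Brauer.token inv none a) ≫ e.hom =
        e'.inv ≫ F'.map (Brauer.token inv none a) ≫ e'.hom :=
      GSMod.hom_ext ((h.token a).trans (h'.token a).symm)
    rw [Iso.inv_comp_eq] at h3
    have h4 := congrArg (· ≫ e'.inv) h3
    simp only [Category.assoc, Iso.hom_inv_id, Category.comp_id] at h4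
    simpa only [i, Iso.trans_hom, Iso.symm_hom, Category.assoc] using h4
  refine ⟨Brauer.natIso F F' i hi ?_ ?_ ?_ htok, ?_, fun η hη => Brauer.natIso_ext _ _ ?_⟩
  · rw [h2]
    rw [Iso.inv_comp_eq] at hcross
    have h4 := congrArg (· ≫ S'.inv) hcross
    simp only [Category.assoc, Iso.hom_inv_id, Category.comp_id] at h4
    exact h4.trans (Category.assoc _ _ _).symm
  · rw [h2, h0]
    rw [Iso.inv_comp_eq] at hcap
    have h4 := congrArg (· ≫ F'.ε.hom) hcap
    simp only [Category.assoc, Iso.inv_hom_id, Category.comp_id] at h4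
    exact h4.trans (Category.assoc _ _ _).symm
  · rw [h2, h0]
    rw [← Iso.eq_inv_comp] at hcup
    have h4 := congrArg (· ≫ S'.inv) hcup
    simp only [Category.assoc, Iso.hom_inv_id, Category.comp_id] at h4
    exact h4.trans (Category.assoc _ _ _).symm
  · change (Brauer.powIso F F' i hi 1).hom ≫ e'.hom = e.hom
    rw [h1]
    exact (Category.assoc _ _ _).trans
      ((congrArg (e.hom ≫ ·) e'.inv_hom_id).trans (Category.comp_id _))
  · have h4 : (η.app I).hom = i.hom := by
      rw [← cancel_mono e'.hom]
      refine Eq.trans hη ?_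
      simp [i]
    exact h4.trans h1.symm

end IsIncarnation

end Properties

/-! ### Tensor powers of a supermodule -/

section TensorPowers

open Supercategory MonoidalSupercategory

variable {k : Type u} [Field k] {A : Type w} [Ring A] [Algebra k A]
  {V : Type u} [AddCommGroup V] [Module k V] [Module Aᵐᵒᵖ V] [IsScalarTower k Aᵐᵒᵖ V]
  {𝒱 : ZMod 2 → Submodule k V} [IsSuperspace 𝒱] {Φ : LinearMap.BilinForm k V}

namespace GSMod

theorem lin_tensorHom_id {W W' : GSMod A 𝒱 Φ} (f : W ⟶ W') (U : GSMod A 𝒱 Φ) (x : W.carrier)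
    (y : U.carrier) :
    lin (tensorHom (k := k) f (𝟙 U)) (x ⊗ₜ[k] y) = lin f x ⊗ₜ[k] y := by
  change superTensor W.grading U.grading U.grading (lin f) LinearMap.id (x ⊗ₜ[k] y) = _
  rw [superTensor_even _ (homParity_id _)]; rfl

theorem lin_tensorHom_even {W W' U U' : GSMod A 𝒱 Φ} (f : W ⟶ W') {g : U ⟶ U'}
    (hg : g ∈ homPart (k := k) U U' 0) (x : W.carrier) (y : U.carrier) :
    lin (tensorHom (k := k) f g) (x ⊗ₜ[k] y) = lin f x ⊗ₜ[k] lin g y := by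
  change superTensor W.grading U.grading U'.grading (lin f) (lin g) (x ⊗ₜ[k] y) = _
  rw [superTensor_even (lin f) (g := lin g) hg.1]; rfl

theorem lin_tensorHom {W W' U U' : GSMod A 𝒱 Φ} (f : W ⟶ W') {g : U ⟶ U'} {r s : ZMod 2}
    (hg : g ∈ homPart (k := k) U U' r) {x : W.carrier} (hx : x ∈ W.grading s) (y : U.carrier) :
    lin (tensorHom (k := k) f g) (x ⊗ₜ[k] y) = koszul k r s • (lin f x ⊗ₜ[k] lin g y) :=
  superTensor_apply _ _ _ _ hg.1 hx y

theorem lin_hom_inv {W W' : GSMod A 𝒱 Φ} (e : W ≅ W') (x : W'.carrier) :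
    lin e.hom (lin e.inv x) = x :=
  LinearMap.congr_fun (congrArg lin e.inv_hom_id) x

theorem lin_inv_hom {W W' : GSMod A 𝒱 Φ} (e : W ≅ W') (x : W.carrier) :
    lin e.inv (lin e.hom x) = x :=
  LinearMap.congr_fun (congrArg lin e.hom_inv_id) x

theorem eqToHom_mem {W W' : GSMod A 𝒱 Φ} (h : W = W') :
    eqToHom h ∈ homPart (k := k) W W' 0 := by
  subst h; exact id_mem W

end GSMod

open GSMod

/-- A choice of tensor powers of a supermodule `W`, with multiplication maps that are strictly
associative and unital up to the equalities between exponents. -/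
structure TensorPowers (W : GSMod A 𝒱 Φ) where
  /-- The tensor powers. -/
  obj : ℕ → GSMod A 𝒱 Φ
  /-- The multiplication maps. -/
  mul {m n a : ℕ} (h : m + n = a) : tensorObj k (obj m) (obj n) ≅ obj a
  mul_mem {m n a : ℕ} (h : m + n = a) : (mul h).hom ∈ homPart (k := k) _ _ 0
  /-- The zeroth tensor power is trivial. -/
  one : (unit k : GSMod A 𝒱 Φ) ≅ obj 0
  one_mem : one.hom ∈ homPart (k := k) _ _ 0
  /-- The first tensor power is `W`. -/
  gen : W ≅ obj 1
  gen_mem : gen.hom ∈ homPart (k := k) _ _ 0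
  protected mul_assoc {l m n a b c : ℕ} (ha : l + m = a) (h₁ : a + n = c) (hb : m + n = b) (h₂ : l + b = c)
    (x : (obj l).carrier) (y : (obj m).carrier) (z : (obj n).carrier) :
    lin (mul h₁).hom (lin (mul ha).hom (x ⊗ₜ[k] y) ⊗ₜ[k] z) =
      lin (mul h₂).hom (x ⊗ₜ[k] lin (mul hb).hom (y ⊗ₜ[k] z))
  protected one_mul {n : ℕ} (h : 0 + n = n) (x : (obj n).carrier) :
    lin (mul h).hom (lin one.hom (1 : k) ⊗ₜ[k] x) = x
  protected mul_one {n : ℕ} (h : n + 0 = n) (x : (obj n).carrier) :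
    lin (mul h).hom (x ⊗ₜ[k] lin one.hom (1 : k)) = x

namespace TensorPowers

variable (W : GSMod A 𝒱 Φ)

/-- Tensoring an isomorphism with an object on the right. -/
noncomputable def whiskerRight {X Y : GSMod A 𝒱 Φ} (e : X ≅ Y) (U : GSMod A 𝒱 Φ) :
    tensorObj k X U ≅ tensorObj k Y U where
  hom := tensorHom (k := k) e.hom (𝟙 U)
  inv := tensorHom (k := k) e.inv (𝟙 U)
  hom_inv_id := by
    rw [tensorHom_comp_of_right_even _ _ _ (id_mem _), e.hom_inv_id, Category.id_comp, tensorHom_id]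
  inv_hom_id := by
    rw [tensorHom_comp_of_right_even _ _ _ (id_mem _), e.inv_hom_id, Category.id_comp, tensorHom_id]

/-- Tensoring an isomorphism with an object on the left. -/
noncomputable def whiskerLeft (U : GSMod A 𝒱 Φ) {X Y : GSMod A 𝒱 Φ} (e : X ≅ Y) :
    tensorObj k U X ≅ tensorObj k U Y where
  hom := tensorHom (k := k) (𝟙 U) e.hom
  inv := tensorHom (k := k) (𝟙 U) e.inv
  hom_inv_id := by
    rw [tensorHom_comp_of_left_even _ _ _ (id_mem _), e.hom_inv_id, Category.id_comp, tensorHom_id]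
  inv_hom_id := by
    rw [tensorHom_comp_of_left_even _ _ _ (id_mem _), e.inv_hom_id, Category.id_comp, tensorHom_id]

/-- The iterated tensor powers, with all brackets on the left. -/
noncomputable def iter : ℕ → GSMod A 𝒱 Φ
  | 0 => unit k
  | n + 1 => tensorObj k (iter n) W

/-- The zeroth iterated tensor power. -/
noncomputable def iterZero : (unit k : GSMod A 𝒱 Φ) ≅ iter W 0 := Iso.refl _

/-- The successor step for iterated tensor powers. -/
noncomputable def iterSucc (n : ℕ) : tensorObj k (iter W n) W ≅ iter W (n + 1) := Iso.refl _

theorem iterZero_mem : (iterZero W).hom ∈ homPart (k := k) _ _ 0 := id_mem _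

theorem iterSucc_mem (n : ℕ) : (iterSucc W n).hom ∈ homPart (k := k) _ _ 0 := id_mem _

/-- The multiplication of iterated tensor powers. -/
noncomputable def iterMulAux (m : ℕ) : ∀ n : ℕ,
    tensorObj k (iter W m) (iter W n) ≅ iter W (m + n)
  | 0 => whiskerLeft (iter W m) (iterZero W).symm ≪≫ rightUnitor (k := k) (iter W m)
  | n + 1 => whiskerLeft (iter W m) (iterSucc W n).symm ≪≫
      (assocIso (k := k) (iter W m) (iter W n) W).symm ≪≫
      whiskerRight (iterMulAux m n) W ≪≫ iterSucc W (m + n)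

theorem trans_mem {X Y Z : GSMod A 𝒱 Φ} {e : X ≅ Y} {e' : Y ≅ Z}
    (h : e.hom ∈ homPart (k := k) _ _ 0) (h' : e'.hom ∈ homPart (k := k) _ _ 0) :
    (e ≪≫ e').hom ∈ homPart (k := k) _ _ 0 := comp_mem_even h h'

theorem symm_mem {X Y : GSMod A 𝒱 Φ} {e : X ≅ Y} (h : e.hom ∈ homPart (k := k) _ _ 0) :
    e.symm.hom ∈ homPart (k := k) _ _ 0 := inv_mem_even h

theorem whiskerLeft_mem (U : GSMod A 𝒱 Φ) {X Y : GSMod A 𝒱 Φ} {e : X ≅ Y}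
    (h : e.hom ∈ homPart (k := k) _ _ 0) :
    (whiskerLeft U e).hom ∈ homPart (k := k) _ _ 0 := tensorHom_mem_even (id_mem _) h

theorem whiskerRight_mem (U : GSMod A 𝒱 Φ) {X Y : GSMod A 𝒱 Φ} {e : X ≅ Y}
    (h : e.hom ∈ homPart (k := k) _ _ 0) :
    (whiskerRight e U).hom ∈ homPart (k := k) _ _ 0 := tensorHom_mem_even h (id_mem _)

theorem iterMulAux_mem (m n : ℕ) : (iterMulAux W m n).hom ∈ homPart (k := k) _ _ 0 := by
  induction n with
  | zero =>
    exact trans_mem (whiskerLeft_mem _ (symm_mem (iterZero_mem W)))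
      (rightUnitor_mem (k := k) (iter W m))
  | succ n ih =>
    have h1 := whiskerLeft_mem (iter W m) (symm_mem (iterSucc_mem W n))
    have h2 := symm_mem (associator_mem (k := k) (iter W m) (iter W n) W)
    have h3 := trans_mem (whiskerRight_mem W ih) (iterSucc_mem W (m + n))
    have h4 := trans_mem h1 (trans_mem h2 h3)
    rw [iterMulAux]
    exact h4

/-- The multiplication of iterated tensor powers. -/
noncomputable def iterMul {m n a : ℕ} (h : m + n = a) :
    tensorObj k (iter W m) (iter W n) ≅ iter W a :=
  iterMulAux W m n ≪≫ eqToIso (congrArg (iter W) h)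

theorem iterMul_mem {m n a : ℕ} (h : m + n = a) : (iterMul W h).hom ∈ homPart (k := k) _ _ 0 :=
  trans_mem (e' := eqToIso (congrArg (iter W) h)) (iterMulAux_mem W m n)
    (eqToHom_mem (congrArg (iter W) h))

variable {W}

/-- Adjunction of a vector on the right. -/
noncomputable def snoc {n : ℕ} (x : (iter W n).carrier) (w : W.carrier) :
    (iter W (n + 1)).carrier :=
  lin (iterSucc W n).hom (x ⊗ₜ[k] w)

/-- This is the induction tool for the iterated powers: a statement linear in a vector of degree `n
+ 1` may be tested on products of a vector of degree `n` with one of `W`. -/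
theorem snoc_ext {n : ℕ} {U : Type*} [AddCommGroup U] [Module k U]
    {f g : (iter W (n + 1)).carrier →ₗ[k] U} (h : ∀ x w, f (snoc x w) = g (snoc x w)) : f = g := by
  have key : f ∘ₗ lin (iterSucc W n).hom = g ∘ₗ lin (iterSucc W n).hom := TensorProduct.ext' h
  refine LinearMap.ext fun x => ?_
  rw [← lin_hom_inv (iterSucc W n) x]
  exact LinearMap.congr_fun key _

theorem iterMul_zero {m : ℕ} (h : m + 0 = m) (x : (iter W m).carrier) (c : k) :
    lin (iterMul W h).hom (x ⊗ₜ[k] lin (iterZero W).hom c) = c • x := by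
  have h1 : lin (whiskerLeft (iter W m) (iterZero W).symm).hom
      (x ⊗ₜ[k] lin (iterZero W).hom c) = x ⊗ₜ[k] c :=
    (lin_tensorHom_even (𝟙 (iter W m)) (inv_mem_even (iterZero_mem W)) x _).trans
      (by rw [lin_inv_hom]; rfl)
  have h2 : iterMul W h = iterMulAux W m 0 := by
    rw [iterMul, eqToIso_refl, Iso.trans_refl]
  rw [h2]
  exact (congrArg (lin (rightUnitor (k := k) (iter W m)).hom) h1).trans
    (TensorProduct.rid_tmul _ _)

/-- Together with `iterMul_zero` this describes the multiplication by recursion on the right factor,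
as for addition of natural numbers. The exponent equations are parameters, so that changes of
bracketing in exponents require no transport. -/
theorem iterMul_snoc {m n a : ℕ} (h : m + (n + 1) = a + 1) (h' : m + n = a)
    (x : (iter W m).carrier) (y : (iter W n).carrier) (w : W.carrier) :
    lin (iterMul W h).hom (x ⊗ₜ[k] snoc y w) =
      snoc (lin (iterMul W h').hom (x ⊗ₜ[k] y)) w := by
  subst h'
  have h1 : lin (whiskerLeft (iter W m) (iterSucc W n).symm).hom (x ⊗ₜ[k] snoc y w) =
      x ⊗ₜ[k] (y ⊗ₜ[k] w) :=
    (lin_tensorHom_even (𝟙 (iter W m)) (inv_mem_even (iterSucc_mem W n)) x _).trans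
      (by rw [snoc, lin_inv_hom]; rfl)
  have h2 : iterMul W h = iterMulAux W m (n + 1) := by
    rw [iterMul, eqToIso_refl]; exact Iso.trans_refl _
  have h3 : iterMul W (rfl : m + n = m + n) = iterMulAux W m n := by
    rw [iterMul, eqToIso_refl, Iso.trans_refl]
  rw [h2, h3]
  have h4 : lin (assocIso (k := k) (iter W m) (iter W n) W).inv (x ⊗ₜ[k] (y ⊗ₜ[k] w)) =
      (x ⊗ₜ[k] y) ⊗ₜ[k] w := TensorProduct.assoc_symm_tmul x y w
  have h5 := lin_tensorHom_id (iterMulAux W m n).hom W (x ⊗ₜ[k] y) w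
  have h6 : lin (iterMulAux W m (n + 1)).hom (x ⊗ₜ[k] snoc y w) =
      lin (iterSucc W (m + n)).hom (lin (whiskerRight (iterMulAux W m n) W).hom
        (lin (assocIso (k := k) (iter W m) (iter W n) W).inv
          (lin (whiskerLeft (iter W m) (iterSucc W n).symm).hom (x ⊗ₜ[k] snoc y w)))) := rfl
  rw [h6, h1, h4]
  exact congrArg (lin (iterSucc W (m + n)).hom) h5

/-- Induction on the degree of the last factor: scalars pass through for degree zero, and in the
step the last vector of `W` is split off on both sides. -/
theorem iterMul_assoc {l m n a b c : ℕ} (ha : l + m = a) (h₁ : a + n = c) (hb : m + n = b)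
    (h₂ : l + b = c) (x : (iter W l).carrier) (y : (iter W m).carrier) (z : (iter W n).carrier) :
    lin (iterMul W h₁).hom (lin (iterMul W ha).hom (x ⊗ₜ[k] y) ⊗ₜ[k] z) =
      lin (iterMul W h₂).hom (x ⊗ₜ[k] lin (iterMul W hb).hom (y ⊗ₜ[k] z)) := by
  induction n generalizing b c with
  | zero =>
    subst hb h₁
    obtain ⟨c, rfl⟩ : ∃ c : k, lin (iterZero W).hom c = z := ⟨_, lin_hom_inv (iterZero W) z⟩
    have h3 := iterMul_zero (W := W) (rfl : m + 0 = m) y c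
    have h4 := iterMul_zero (W := W) (rfl : a + 0 = a) (lin (iterMul W ha).hom (x ⊗ₜ[k] y)) c
    refine h4.trans ?_
    refine Eq.trans ?_ (congrArg (fun t => lin (iterMul W h₂).hom (x ⊗ₜ[k] t)) h3).symm
    change _ = lin (iterMul W h₂).hom (x ⊗ₜ[k] (c • y))
    rw [TensorProduct.tmul_smul, map_smul]
  | succ n ih =>
    subst hb h₁
    have key : lin (iterMul W (rfl : a + (n + 1) = a + (n + 1))).hom ∘ₗ
        TensorProduct.mk k _ _ (lin (iterMul W ha).hom (x ⊗ₜ[k] y)) =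
        lin (iterMul W h₂).hom ∘ₗ TensorProduct.mk k _ _ x ∘ₗ
          lin (iterMul W (rfl : m + (n + 1) = m + (n + 1))).hom ∘ₗ TensorProduct.mk k _ _ y := by
      refine snoc_ext fun z w => ?_
      have h3 := iterMul_snoc (W := W) (rfl : a + (n + 1) = a + n + 1) rfl
        (lin (iterMul W ha).hom (x ⊗ₜ[k] y)) z w
      have h4 := iterMul_snoc (W := W) (rfl : m + (n + 1) = m + n + 1) rfl y z w
      have h5 := iterMul_snoc (W := W) (a := a + n) h₂ (Nat.succ.inj h₂) x
        (lin (iterMul W (rfl : m + n = m + n)).hom (y ⊗ₜ[k] z)) w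
      refine h3.trans ?_
      refine Eq.trans ?_ (congrArg (fun t => lin (iterMul W h₂).hom (x ⊗ₜ[k] t)) h4).symm
      refine Eq.trans ?_ h5.symm
      rw [ih rfl rfl (Nat.succ.inj h₂)]
    exact LinearMap.congr_fun key z

/-- The recursion acts on the right factor, so the left unit law needs an induction of its own,
unlike the right one. -/
theorem iter_one_mul {n : ℕ} (h : 0 + n = n) (x : (iter W n).carrier) :
    lin (iterMul W h).hom (lin (iterZero W).hom (1 : k) ⊗ₜ[k] x) = x := by
  induction n with
  | zero =>
    obtain ⟨c, rfl⟩ : ∃ c : k, lin (iterZero W).hom c = x := ⟨_, lin_hom_inv (iterZero W) x⟩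
    rw [iterMul_zero, ← map_smul]
    congr 1
    exact _root_.mul_one c
  | succ n ih =>
    have key : lin (iterMul W h).hom ∘ₗ
        TensorProduct.mk k (iter W 0).carrier (iter W (n + 1)).carrier
          (lin (iterZero W).hom (1 : k)) = LinearMap.id := by
      refine snoc_ext fun z w => ?_
      have h3 := iterMul_snoc (W := W) h (Nat.zero_add n) (lin (iterZero W).hom (1 : k)) z w
      refine h3.trans ?_
      rw [ih]; rfl
    exact LinearMap.congr_fun key x

variable (W)

/-- Tensor powers in which the first power is `W` itself. -/
noncomputable def powObj : ℕ → GSMod A 𝒱 Φ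
  | 0 => unit k
  | 1 => W
  | n + 2 => iter W (n + 2)

/-- The comparison between two models of tensor powers. -/
noncomputable def powObjIso : ∀ n : ℕ, iter W n ≅ powObj W n
  | 0 => Iso.refl _
  | 1 => leftUnitor (k := k) W
  | _ + 2 => Iso.refl _

theorem powObjIso_mem : ∀ n : ℕ, (powObjIso W n).hom ∈ homPart (k := k) _ _ 0
  | 0 => id_mem _
  | 1 => leftUnitor_mem (k := k) W
  | _ + 2 => id_mem _

theorem powObj_mul (W : GSMod A 𝒱 Φ) {m n a : ℕ} (h : m + n = a) (x : (powObj W m).carrier)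
    (y : (powObj W n).carrier) :
    lin ((tensorIso (powObjIso W m).symm (powObjIso W n).symm
      (inv_mem_even (powObjIso_mem W m))) ≪≫ iterMul W h ≪≫ powObjIso W a).hom (x ⊗ₜ[k] y) =
    lin (powObjIso W a).hom (lin (iterMul W h).hom
      (lin (powObjIso W m).inv x ⊗ₜ[k] lin (powObjIso W n).inv y)) := by
  have h1 := lin_tensorHom_even (powObjIso W m).inv (inv_mem_even (powObjIso_mem W n)) x y
  change lin (powObjIso W a).hom (lin (iterMul W h).hom (lin (tensorHom (k := k)
    (powObjIso W m).inv (powObjIso W n).inv) (x ⊗ₜ[k] y))) = _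
  rw [h1]

/-- The tensor powers of a supermodule exist, with `W` itself as first tensor power. -/
noncomputable def std : TensorPowers W where
  obj := powObj W
  mul {m n a} h := (tensorIso (powObjIso W m).symm (powObjIso W n).symm
    (inv_mem_even (powObjIso_mem W m))) ≪≫ iterMul W h ≪≫ powObjIso W a
  mul_mem {m n a} h := comp_mem_even (tensorHom_mem_even (inv_mem_even (powObjIso_mem W m))
    (inv_mem_even (powObjIso_mem W n))) (comp_mem_even (iterMul_mem W h) (powObjIso_mem W a))
  one := Iso.refl _
  one_mem := id_mem _
  -- The first power is `W` itself and not `k ⊗ W`; this is what later yields an equality `F(I) = V`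
  -- rather than an isomorphism.
  gen := Iso.refl _
  gen_mem := id_mem _
  mul_assoc ha h₁ hb h₂ x y z := by
    simp only [powObj_mul, lin_inv_hom]
    rw [iterMul_assoc ha h₁ hb h₂]
  one_mul {n} h x := by
    rw [powObj_mul]
    have h1 := iter_one_mul h (lin (powObjIso W n).inv x)
    exact (congrArg (lin (powObjIso W n).hom) h1).trans (lin_hom_inv _ x)
  mul_one {n} h x := by
    rw [powObj_mul]
    have h1 := iterMul_zero h (lin (powObjIso W n).inv x) 1
    rw [one_smul] at h1
    exact (congrArg (lin (powObjIso W n).hom) h1).trans (lin_hom_inv _ x)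

end TensorPowers

end TensorPowers

/-! ### Calculus in tensor powers -/

section TensorPowersCalculus

open Supercategory MonoidalSupercategory GSMod

variable {k : Type u} [Field k] {A : Type w} [Ring A] [Algebra k A]
  {V : Type u} [AddCommGroup V] [Module k V] [Module Aᵐᵒᵖ V] [IsScalarTower k Aᵐᵒᵖ V]
  {𝒱 : ZMod 2 → Submodule k V} [IsSuperspace 𝒱] {Φ : LinearMap.BilinForm k V}

namespace TensorPowers

variable {W : GSMod A 𝒱 Φ} (S : TensorPowers W)

/-- The multiplication of vectors in tensor powers. -/
noncomputable def join {m n a : ℕ} (h : m + n = a) :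
    (S.obj m).carrier →ₗ[k] (S.obj n).carrier →ₗ[k] (S.obj a).carrier :=
  (TensorProduct.mk k _ _).compr₂ (lin (S.mul h).hom)

/-- The vectors of degree one. -/
noncomputable def vec : W.carrier →ₗ[k] (S.obj 1).carrier := lin S.gen.hom

/-- The unit vector of degree zero. -/
noncomputable def unitVec : (S.obj 0).carrier := lin S.one.hom (1 : k)

theorem mem_of_even {X Y : GSMod A 𝒱 Φ} {f : X ⟶ Y} (hf : f ∈ homPart (k := k) X Y 0) {r : ZMod 2}
    {x : X.carrier} (hx : x ∈ X.grading r) : lin f x ∈ Y.grading r := by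
  have := hf.1 r x hx
  rwa [add_zero] at this

theorem vec_mem {r : ZMod 2} {v : W.carrier} (hv : v ∈ W.grading r) :
    S.vec v ∈ (S.obj 1).grading r := mem_of_even S.gen_mem hv

theorem unitVec_mem : S.unitVec ∈ (S.obj 0).grading 0 :=
  mem_of_even (X := unit k) (r := 0) (x := (1 : k)) S.one_mem
    (show (1 : k) ∈ unitGrading k 0 by simp [unitGrading])

theorem join_mem {m n a : ℕ} (h : m + n = a) {r s : ZMod 2} {x : (S.obj m).carrier}
    {y : (S.obj n).carrier} (hx : x ∈ (S.obj m).grading r) (hy : y ∈ (S.obj n).grading s) :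
    S.join h x y ∈ (S.obj a).grading (r + s) :=
  mem_of_even (X := tensorObj k (S.obj m) (S.obj n)) (S.mul_mem h) (tmul_mem_tensorGrading hx hy)

theorem join_assoc {l m n a b c : ℕ} (ha : l + m = a) (h₁ : a + n = c) (hb : m + n = b)
    (h₂ : l + b = c) (x : (S.obj l).carrier) (y : (S.obj m).carrier) (z : (S.obj n).carrier) :
    S.join h₁ (S.join ha x y) z = S.join h₂ x (S.join hb y z) := S.mul_assoc ha h₁ hb h₂ x y z

theorem unitVec_join {n : ℕ} (h : 0 + n = n) (x : (S.obj n).carrier) :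
    S.join h S.unitVec x = x := S.one_mul h x

theorem join_unitVec {n : ℕ} (h : n + 0 = n) (x : (S.obj n).carrier) :
    S.join h x S.unitVec = x := S.mul_one h x

variable {U : Type*} [AddCommGroup U] [Module k U]

/-- Products of homogeneous vectors span each power. With this, identities of diagrams are checked
on such products, without reference to brackets in iterated tensor products. -/
theorem ext_join {m n a : ℕ} (h : m + n = a) {f g : (S.obj a).carrier →ₗ[k] U}
    (hfg : ∀ r, ∀ x ∈ (S.obj m).grading r, ∀ s, ∀ y ∈ (S.obj n).grading s,
      f (S.join h x y) = g (S.join h x y)) : f = g := by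
  have key : f ∘ₗ lin (S.mul h).hom = g ∘ₗ lin (S.mul h).hom :=
    super_ext₂ (S.obj m).grading (S.obj n).grading hfg
  refine LinearMap.ext fun x => ?_
  rw [← lin_hom_inv (S.mul h) x]
  exact LinearMap.congr_fun key _

theorem ext_join_join {l m n a c : ℕ} (ha : l + m = a) (h : a + n = c)
    {f g : (S.obj c).carrier →ₗ[k] U}
    (hfg : ∀ r, ∀ x ∈ (S.obj l).grading r, ∀ s, ∀ y ∈ (S.obj m).grading s,
      ∀ t, ∀ z ∈ (S.obj n).grading t,
        f (S.join h (S.join ha x y) z) = g (S.join h (S.join ha x y) z)) : f = g := by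
  refine S.ext_join h fun r x _ s z hz => ?_
  have key : f ∘ₗ (S.join h).flip z = g ∘ₗ (S.join h).flip z :=
    S.ext_join ha fun r' x hx s' y hy => hfg r' x hx s' y hy s z hz
  exact LinearMap.congr_fun key x

theorem ext_vec {f g : (S.obj 1).carrier →ₗ[k] U}
    (hfg : ∀ r, ∀ v ∈ W.grading r, f (S.vec v) = g (S.vec v)) : f = g := by
  have key : f ∘ₗ lin S.gen.hom = g ∘ₗ lin S.gen.hom := super_ext W.grading hfg
  refine LinearMap.ext fun x => ?_
  rw [← lin_hom_inv S.gen x]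
  exact LinearMap.congr_fun key _

theorem ext_vec_vec {f g : (S.obj 2).carrier →ₗ[k] U}
    (hfg : ∀ r, ∀ v ∈ W.grading r, ∀ s, ∀ w ∈ W.grading s,
      f (S.join (rfl : 1 + 1 = 2) (S.vec v) (S.vec w)) =
        g (S.join (rfl : 1 + 1 = 2) (S.vec v) (S.vec w))) : f = g := by
  refine S.ext_join (rfl : 1 + 1 = 2) fun _ x _ _ y _ => ?_
  have h1 : f ∘ₗ (S.join (rfl : 1 + 1 = 2)).flip y = g ∘ₗ (S.join (rfl : 1 + 1 = 2)).flip y := by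
    refine S.ext_vec fun r v hv => ?_
    have h2 : f ∘ₗ S.join (rfl : 1 + 1 = 2) (S.vec v) = g ∘ₗ S.join (rfl : 1 + 1 = 2) (S.vec v) :=
      S.ext_vec fun s w hw => hfg r v hv s w hw
    exact LinearMap.congr_fun h2 y
  exact LinearMap.congr_fun h1 x

/-- The product of three vectors. -/
noncomputable def triple (u v w : W.carrier) : (S.obj 3).carrier :=
  S.join (rfl : 2 + 1 = 3) (S.join (rfl : 1 + 1 = 2) (S.vec u) (S.vec v)) (S.vec w)

theorem triple_eq (u v w : W.carrier) : S.triple u v w =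
    S.join (rfl : 1 + 2 = 3) (S.vec u) (S.join (rfl : 1 + 1 = 2) (S.vec v) (S.vec w)) :=
  S.join_assoc _ _ _ _ _ _ _

theorem ext_triple {f g : (S.obj 3).carrier →ₗ[k] U}
    (hfg : ∀ r, ∀ u ∈ W.grading r, ∀ s, ∀ v ∈ W.grading s, ∀ t, ∀ w ∈ W.grading t,
      f (S.triple u v w) = g (S.triple u v w)) : f = g := by
  refine S.ext_join (rfl : 2 + 1 = 3) fun _ x _ _ y _ => ?_
  have h1 : f ∘ₗ (S.join (rfl : 2 + 1 = 3)).flip y = g ∘ₗ (S.join (rfl : 2 + 1 = 3)).flip y := by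
    refine S.ext_vec_vec fun r u hu s v hv => ?_
    have h2 : f ∘ₗ S.join (rfl : 2 + 1 = 3) (S.join (rfl : 1 + 1 = 2) (S.vec u) (S.vec v)) =
        g ∘ₗ S.join (rfl : 2 + 1 = 3) (S.join (rfl : 1 + 1 = 2) (S.vec u) (S.vec v)) :=
      S.ext_vec fun t w hw => hfg r u hu s v hv t w hw
    exact LinearMap.congr_fun h2 y
  exact LinearMap.congr_fun h1 x

/-- The square of the first tensor power. -/
noncomputable def square : tensorObj k W W ≅ S.obj 2 :=
  tensorIso S.gen S.gen S.gen_mem ≪≫ S.mul (rfl : 1 + 1 = 2)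

theorem square_mem : S.square.hom ∈ homPart (k := k) _ _ 0 :=
  trans_mem (e := tensorIso S.gen S.gen S.gen_mem) (tensorHom_mem_even S.gen_mem S.gen_mem)
    (S.mul_mem _)

theorem square_tmul (v w : W.carrier) :
    lin S.square.hom (v ⊗ₜ[k] w) = S.join (rfl : 1 + 1 = 2) (S.vec v) (S.vec w) :=
  congrArg (lin (S.mul (rfl : 1 + 1 = 2)).hom) (lin_tensorHom_even S.gen.hom S.gen_mem v w)

end TensorPowers

end TensorPowersCalculus

/-! ### Evaluation of diagrams -/

section Evaluation

open Supercategory MonoidalSupercategory GSMod TensorPowers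

variable {k : Type u} [Field k] {A : Type w} [Ring A] [Algebra k A]
  {𝒜 : ZMod 2 → Submodule k A} [SetLike.GradedMonoid 𝒜] [IsSuperspace 𝒜]
  {V : Type u} [AddCommGroup V] [Module k V] [FiniteDimensional k V] [Module Aᵐᵒᵖ V]
  [IsScalarTower k Aᵐᵒᵖ V] {𝒱 : ZMod 2 → Submodule k V} [IsSuperspace 𝒱]
  {Φ : LinearMap.BilinForm k V}

/-- The flip, a form, a copairing and the action of tokens, together with proofs that they are
morphisms of supermodules. -/
structure GeneratorImages (𝒱 : ZMod 2 → Submodule k V) [IsSuperspace 𝒱]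
    (Φ : LinearMap.BilinForm k V) (inv : AntiInvolution 𝒜) (σ : ZMod 2) (ν : k) where
  /-- The image of `1` under the cup. -/
  copairing : V ⊗[k] V
  cross_mem : ν • superFlip 𝒱 𝒱 ∈
    homOfParity (tensor (GSMod.std A 𝒱 Φ) (GSMod.std A 𝒱 Φ))
      (tensor (GSMod.std A 𝒱 Φ) (GSMod.std A 𝒱 Φ)) 0
  cap_mem : TensorProduct.lift Φ ∈
    homOfParity (tensor (GSMod.std A 𝒱 Φ) (GSMod.std A 𝒱 Φ)) (triv A 𝒱 Φ) σ
  cup_mem : LinearMap.toSpanSingleton k (V ⊗[k] V) copairing ∈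
    homOfParity (triv A 𝒱 Φ) (tensor (GSMod.std A 𝒱 Φ) (GSMod.std A 𝒱 Φ)) σ
  tok_mem {r : ZMod 2} {a : A} (ha : a ∈ 𝒜 r) :
    rho 𝒜 𝒱 (inv.toFun a) ∈ homOfParity (GSMod.std A 𝒱 Φ) (GSMod.std A 𝒱 Φ) r

variable {inv : AntiInvolution 𝒜} {σ : ZMod 2} {ν : k}
  (D : GeneratorImages 𝒱 Φ inv σ ν) (S : TensorPowers (GSMod.std A 𝒱 Φ))

theorem superFlip_tmul {p q : ZMod 2} {v w : V} (hv : v ∈ 𝒱 p) (hw : w ∈ 𝒱 q) :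
    superFlip 𝒱 𝒱 (v ⊗ₜ[k] w) = koszul k p q • (w ⊗ₜ[k] v) := by
  simp only [superFlip, LinearMap.sum_apply, LinearMap.smul_apply, LinearMap.comp_apply,
    TensorProduct.map_tmul]
  rw [Finset.sum_eq_single p, Finset.sum_eq_single q]
  · rw [parityProj_same 𝒱 hv, parityProj_same 𝒱 hw]; rfl
  · intro s _ hs
    rw [parityProj_ne 𝒱 hw hs.symm]; simp
  · simp
  · intro s _ hs
    rw [parityProj_ne 𝒱 hv hs.symm]; simp
  · simp

namespace GeneratorImages

/-- The value of a diagram, as a linear map between tensor powers. -/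
noncomputable def eval : ∀ {m n : ℕ} {r : ZMod 2}, Diag 𝒜 σ m n r →
    ((S.obj m).carrier →ₗ[k] (S.obj n).carrier)
  | _, _, _, .id h => lin (eqToHom (congrArg S.obj h))
  | _, _, _, .comp f g _ => eval g ∘ₗ eval f
  | _, _, _, .tensor (m := m) (m' := m') (n' := n') f g ha hb _ => lin (S.mul hb).hom ∘ₗ
      superTensor (S.obj m).grading (S.obj m').grading (S.obj n').grading (eval f) (eval g) ∘ₗ
        lin (S.mul ha).inv
  | _, _, _, .cross => lin S.square.hom ∘ₗ (ν • superFlip 𝒱 𝒱) ∘ₗ lin S.square.inv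
  | _, _, _, .cap => lin S.one.hom ∘ₗ TensorProduct.lift Φ ∘ₗ lin S.square.inv
  | _, _, _, .cup => lin S.square.hom ∘ₗ LinearMap.toSpanSingleton k (V ⊗[k] V) D.copairing ∘ₗ
      lin S.one.inv
  | _, _, _, .tok a _ => lin S.gen.hom ∘ₗ rho 𝒜 𝒱 (inv.toFun a) ∘ₗ lin S.gen.inv
  | _, _, _, .zero => 0
  | _, _, _, .add f g => eval f + eval g
  | _, _, _, .smul c f => c • eval f

theorem comp_mem_even' {X Y Z T : GSMod A 𝒱 Φ} {f : X ⟶ Y} (hf : f ∈ homPart (k := k) X Y 0)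
    {h : Z ⟶ T} (hh : h ∈ homPart (k := k) Z T 0) {r : ZMod 2} {g : Y.carrier →ₗ[k] Z.carrier}
    (hg : g ∈ homOfParity Y Z r) : lin h ∘ₗ g ∘ₗ lin f ∈ homOfParity X T r := by
  have h1 := homOfParity_comp (homOfParity_comp hf hg) hh
  rwa [zero_add, add_zero] at h1

/-- Evaluation takes values in linear maps, where sums and scalar multiples are immediate; parity
and equivariance are recovered here by induction from the generators. -/
theorem eval_mem {m n : ℕ} {r : ZMod 2} (f : Diag 𝒜 σ m n r) :
    D.eval S f ∈ homOfParity (S.obj m) (S.obj n) r := by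
  induction f with
  | id h => exact eqToHom_mem _
  | comp f g h ihf ihg => subst h; exact homOfParity_comp ihf ihg
  | tensor f g ha hb h ihf ihg =>
    subst h
    exact comp_mem_even' (inv_mem_even (S.mul_mem ha)) (S.mul_mem hb) (homOfParity_tensor ihf ihg)
  | cross => exact comp_mem_even' (inv_mem_even S.square_mem) S.square_mem D.cross_mem
  | cap => exact comp_mem_even' (inv_mem_even S.square_mem) S.one_mem D.cap_mem
  | cup => exact comp_mem_even' (inv_mem_even S.one_mem) S.square_mem D.cup_mem
  | tok a ha => exact comp_mem_even' (inv_mem_even S.gen_mem) S.gen_mem (D.tok_mem ha)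
  | zero => exact zero_mem _
  | add f g ihf ihg => exact add_mem ihf ihg
  | smul c f ih => exact Submodule.smul_mem _ c ih

theorem eval_id {n : ℕ} (h : n = n) (x : (S.obj n).carrier) :
    D.eval S (.id h : Diag 𝒜 σ n n 0) x = x := by
  rw [eval, eqToHom_refl]; rfl

theorem eval_id_eq {n : ℕ} (h : n = n) :
    D.eval S (.id h : Diag 𝒜 σ n n 0) = LinearMap.id := LinearMap.ext (D.eval_id S h)

/-- The sign comes from moving `g` past `x`, which is why `x` has to be homogeneous. With an
identity on the right the sign disappears and `eval_tensor_id` holds for all vectors. -/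
theorem eval_tensor {m n m' n' a b : ℕ} {r s t p : ZMod 2} (f : Diag 𝒜 σ m n r)
    (g : Diag 𝒜 σ m' n' s) (ha : m + m' = a) (hb : n + n' = b) (h : r + s = t)
    {x : (S.obj m).carrier} (hx : x ∈ (S.obj m).grading p) (y : (S.obj m').carrier) :
    D.eval S (.tensor f g ha hb h) (S.join ha x y) =
      koszul k s p • S.join hb (D.eval S f x) (D.eval S g y) := by
  have h1 : lin (S.mul ha).inv (S.join ha x y) = x ⊗ₜ[k] y := lin_inv_hom (S.mul ha) _
  rw [eval, LinearMap.comp_apply, LinearMap.comp_apply, h1,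
    superTensor_apply _ _ _ _ (D.eval_mem S g).1 hx]
  exact map_smul (lin (S.mul hb).hom) _ _

theorem eval_tensor_id {m n n' a b : ℕ} {r t : ZMod 2} (f : Diag 𝒜 σ m n r)
    (h' : n' = n') (ha : m + n' = a) (hb : n + n' = b) (h : r + 0 = t)
    (x : (S.obj m).carrier) (y : (S.obj n').carrier) :
    D.eval S (.tensor f (.id h') ha hb h) (S.join ha x y) = S.join hb (D.eval S f x) y := by
  refine super_induction (S.obj m).grading (P := fun x => D.eval S (.tensor f (.id h') ha hb h)
    (S.join ha x y) = S.join hb (D.eval S f x) y) (fun v w hv hw => ?_) (fun p x hx => ?_) x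
  · simp only [map_add, LinearMap.add_apply, hv, hw]
  · rw [eval_tensor D S f _ ha hb h hx, koszul_zero_left, one_smul, eval_id]

theorem eval_id_tensor {m m' n' a b : ℕ} {s t p : ZMod 2} (g : Diag 𝒜 σ m' n' s)
    (h' : m = m) (ha : m + m' = a) (hb : m + n' = b) (h : 0 + s = t)
    {x : (S.obj m).carrier} (hx : x ∈ (S.obj m).grading p) (y : (S.obj m').carrier) :
    D.eval S (.tensor (.id h') g ha hb h) (S.join ha x y) =
      koszul k s p • S.join hb x (D.eval S g y) := by
  rw [eval_tensor D S _ g ha hb h hx, eval_id]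

theorem eval_cross {p q : ZMod 2} {v w : V} (hv : v ∈ 𝒱 p) (hw : w ∈ 𝒱 q) :
    D.eval S (.cross : Diag 𝒜 σ 2 2 0) (S.join (rfl : 1 + 1 = 2) (S.vec v) (S.vec w)) =
      (ν * koszul k p q) • S.join (rfl : 1 + 1 = 2) (S.vec w) (S.vec v) := by
  rw [eval, LinearMap.comp_apply, LinearMap.comp_apply, ← square_tmul, ← square_tmul]
  have h1 : lin S.square.inv (lin S.square.hom (v ⊗ₜ[k] w)) = v ⊗ₜ[k] w := lin_inv_hom _ _
  rw [h1, LinearMap.smul_apply, superFlip_tmul hv hw, smul_smul]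
  exact map_smul (lin S.square.hom) _ _

theorem eval_cap (v w : V) :
    D.eval S (.cap : Diag 𝒜 σ 2 0 σ) (S.join (rfl : 1 + 1 = 2) (S.vec v) (S.vec w)) =
      Φ v w • S.unitVec := by
  rw [eval, LinearMap.comp_apply, LinearMap.comp_apply, ← square_tmul]
  have h1 : lin S.square.inv (lin S.square.hom (v ⊗ₜ[k] w)) = v ⊗ₜ[k] w := lin_inv_hom _ _
  rw [h1, TensorProduct.lift.tmul, unitVec, ← map_smul]
  exact congrArg (lin S.one.hom) (_root_.mul_one _).symm

theorem eval_cup {n : ℕ} {b b' : Fin n → V} {p : Fin n → ZMod 2}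
    (hc : D.copairing = ∑ i, koszul k σ (p i) • (b i ⊗ₜ[k] b' i)) :
    D.eval S (.cup : Diag 𝒜 σ 0 2 σ) S.unitVec =
      ∑ i, koszul k σ (p i) • S.join (rfl : 1 + 1 = 2) (S.vec (b i)) (S.vec (b' i)) := by
  have h1 : lin S.one.inv S.unitVec = (1 : k) := lin_inv_hom S.one _
  rw [eval, LinearMap.comp_apply, LinearMap.comp_apply, h1, LinearMap.toSpanSingleton_apply,
    one_smul, hc, map_sum]
  refine Finset.sum_congr rfl fun i _ => ?_
  rw [← square_tmul]
  exact map_smul (lin S.square.hom) _ _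

theorem eval_tok {r : ZMod 2} {a : A} (ha : a ∈ 𝒜 r) (v : V) :
    D.eval S (.tok a ha : Diag 𝒜 σ 1 1 r) (S.vec v) = S.vec (rho 𝒜 𝒱 (inv.toFun a) v) := by
  have h1 : lin S.gen.inv (S.vec v) = v := lin_inv_hom S.gen v
  rw [eval, LinearMap.comp_apply, LinearMap.comp_apply, h1]
  rfl

end GeneratorImages

end Evaluation

/-! ### Verification of the diagrammatic relations on vectors -/

section EvaluationRelations

open Supercategory MonoidalSupercategory GSMod TensorPowers

variable {k : Type u} [Field k] {A : Type w} [Ring A] [Algebra k A]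
  {𝒜 : ZMod 2 → Submodule k A} [SetLike.GradedMonoid 𝒜] [IsSuperspace 𝒜]
  {V : Type u} [AddCommGroup V] [Module k V] [FiniteDimensional k V] [Module Aᵐᵒᵖ V]
  [IsScalarTower k Aᵐᵒᵖ V] {𝒱 : ZMod 2 → Submodule k V} [IsSuperspace 𝒱]
  {Φ : LinearMap.BilinForm k V}

/-- Apply the anti-involution to `1 · 1⋆`: the result is `1⋆⋆ · 1⋆`, and involutivity reduces both
sides. -/
theorem AntiInvolution.map_one (inv : AntiInvolution 𝒜) : inv.toFun 1 = 1 := by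
  have h1 : (1 : A) ∈ 𝒜 0 := SetLike.GradedOne.one_mem
  have h2 := inv.map_mul h1 (inv.map_mem h1)
  rwa [one_mul, koszul_zero_left, one_smul, inv.involutive, one_mul, eq_comm] at h2

theorem rho_smul (c : k) (a : A) : rho 𝒜 𝒱 (c • a) = c • rho 𝒜 𝒱 a := by
  have h : ∀ a : A, rightMul k V (c • a) = c • rightMul k V a := fun a => by
    ext v; simp [rightMul_apply]
  simp only [rho, map_smul, h, LinearMap.smul_comp, Finset.smul_sum]

theorem rho_one : rho 𝒜 𝒱 (1 : A) = LinearMap.id := by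
  rw [rho_eq (SetLike.GradedOne.one_mem : (1 : A) ∈ 𝒜 0), signMap_zero]
  ext v; simp [rightMul_apply]

/-- The anti-involution and the right action both reverse products. The sign `(-1)^{ā b̄}` of the
anti-involution is the one that `ρ_{a⋆}` acquires because `b⋆` has shifted the parity of the vector.
-/
theorem rho_comp_rho {inv : AntiInvolution 𝒜}
    (hV : ∀ r s : ZMod 2, ∀ a ∈ 𝒜 r, ∀ v ∈ 𝒱 s, MulOpposite.op a • v ∈ 𝒱 (r + s))
    {r s : ZMod 2} {a b : A} (ha : a ∈ 𝒜 r) (hb : b ∈ 𝒜 s) :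
    rho 𝒜 𝒱 (inv.toFun a) ∘ₗ rho 𝒜 𝒱 (inv.toFun b) = rho 𝒜 𝒱 (inv.toFun (a * b)) := by
  refine super_ext 𝒱 fun p v hv => ?_
  have hb' := inv.map_mem hb
  have ha' := inv.map_mem ha
  have h : MulOpposite.op (inv.toFun b * inv.toFun a) • v =
      MulOpposite.op (inv.toFun a) • MulOpposite.op (inv.toFun b) • v := by
    rw [MulOpposite.op_mul, mul_smul]
  rw [inv.map_mul ha hb, rho_smul, LinearMap.smul_apply, LinearMap.comp_apply,
    rho_apply hb' hv, map_smul, rho_apply ha' (hV _ _ _ hb' _ hv),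
    rho_apply (SetLike.GradedMul.mul_mem hb' ha') hv, h]
  generalize MulOpposite.op (inv.toFun a) • MulOpposite.op (inv.toFun b) • v = x
  rw [smul_smul, smul_smul, koszul_add_left, koszul_add_right]
  congr 1; ring

variable {inv : AntiInvolution 𝒜} {σ : ZMod 2} {ν : k}
  (D : GeneratorImages 𝒱 Φ inv σ ν) (S : TensorPowers (GSMod.std A 𝒱 Φ))

namespace GeneratorImages

theorem eval_comp {l m n : ℕ} {r s t : ZMod 2} (f : Diag 𝒜 σ l m r) (g : Diag 𝒜 σ m n s)
    (h : r + s = t) (x : (S.obj l).carrier) :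
    D.eval S (.comp f g h) x = D.eval S g (D.eval S f x) := by
  rw [eval, LinearMap.comp_apply]

theorem eval_add {m n : ℕ} {r : ZMod 2} (f g : Diag 𝒜 σ m n r) (x : (S.obj m).carrier) :
    D.eval S (.add f g) x = D.eval S f x + D.eval S g x := by
  rw [eval, LinearMap.add_apply]

theorem eval_smul {m n : ℕ} {r : ZMod 2} (c : k) (f : Diag 𝒜 σ m n r) (x : (S.obj m).carrier) :
    D.eval S (.smul c f) x = c • D.eval S f x := by
  rw [eval, LinearMap.smul_apply]

theorem eval_cross_strand {p q : ZMod 2} {u v : V} (hu : u ∈ 𝒱 p) (hv : v ∈ 𝒱 q) (w : V) :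
    D.eval S (.tensor .cross (.id (rfl : 1 = 1)) (rfl : 2 + 1 = 3) (rfl : 2 + 1 = 3) (add_zero 0) :
      Diag 𝒜 σ 3 3 0) (S.triple u v w) = (ν * koszul k p q) • S.triple v u w := by
  rw [triple, eval_tensor_id, eval_cross D S hu hv, map_smul, LinearMap.smul_apply, triple]

theorem eval_strand_cross {p q r : ZMod 2} {u v w : V} (hu : u ∈ 𝒱 r) (hv : v ∈ 𝒱 p)
    (hw : w ∈ 𝒱 q) :
    D.eval S (.tensor (.id (rfl : 1 = 1)) .cross (rfl : 1 + 2 = 3) (rfl : 1 + 2 = 3) (zero_add 0) :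
      Diag 𝒜 σ 3 3 0) (S.triple u v w) = (ν * koszul k p q) • S.triple u w v := by
  rw [triple_eq, eval_id_tensor D S _ _ _ _ _ (S.vec_mem hu), eval_cross D S hv hw, map_smul,
    koszul_zero_left, one_smul, triple_eq]

theorem eval_cap_strand (u v w : V) :
    D.eval S (.tensor .cap (.id (rfl : 1 = 1)) (rfl : 2 + 1 = 3) (rfl : 0 + 1 = 1) (add_zero σ) :
      Diag 𝒜 σ 3 1 σ) (S.triple u v w) = Φ u v • S.vec w := by
  rw [triple, eval_tensor_id, eval_cap D S, map_smul, LinearMap.smul_apply, unitVec_join]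

theorem eval_strand_cap {r : ZMod 2} {u : V} (hu : u ∈ 𝒱 r) (v w : V) :
    D.eval S (.tensor (.id (rfl : 1 = 1)) .cap (rfl : 1 + 2 = 3) (rfl : 1 + 0 = 1) (zero_add σ) :
      Diag 𝒜 σ 3 1 σ) (S.triple u v w) = (koszul k σ r * Φ v w) • S.vec u := by
  rw [triple_eq, eval_id_tensor D S _ _ _ _ _ (S.vec_mem hu), eval_cap D S, map_smul,
    join_unitVec, smul_smul]

theorem eval_cup_strand {n : ℕ} {b b' : Fin n → V} {p : Fin n → ZMod 2}
    (hc : D.copairing = ∑ i, koszul k σ (p i) • (b i ⊗ₜ[k] b' i)) (v : V) :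
    D.eval S (.tensor .cup (.id (rfl : 1 = 1)) (rfl : 0 + 1 = 1) (rfl : 2 + 1 = 3) (add_zero σ) :
      Diag 𝒜 σ 1 3 σ) (S.vec v) = ∑ i, koszul k σ (p i) • S.triple (b i) (b' i) v := by
  -- A cup has no input strands, so the single vector is first written as a product with the unit
  -- vector of degree zero.
  conv_lhs => rw [← S.unitVec_join (rfl : 0 + 1 = 1) (S.vec v)]
  rw [eval_tensor_id, D.eval_cup S hc]
  simp only [map_sum, map_smul, LinearMap.sum_apply, LinearMap.smul_apply, triple]

theorem eval_strand_cup {n : ℕ} {b b' : Fin n → V} {p : Fin n → ZMod 2}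
    (hc : D.copairing = ∑ i, koszul k σ (p i) • (b i ⊗ₜ[k] b' i)) {r : ZMod 2} {v : V}
    (hv : v ∈ 𝒱 r) :
    D.eval S (.tensor (.id (rfl : 1 = 1)) .cup (rfl : 1 + 0 = 1) (rfl : 1 + 2 = 3) (zero_add σ) :
      Diag 𝒜 σ 1 3 σ) (S.vec v) =
        koszul k σ r • ∑ i, koszul k σ (p i) • S.triple v (b i) (b' i) := by
  conv_lhs => rw [← S.join_unitVec (rfl : 1 + 0 = 1) (S.vec v)]
  rw [eval_id_tensor D S _ _ _ _ _ (S.vec_mem hv), D.eval_cup S hc]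
  simp only [map_sum, map_smul, triple_eq]

theorem eval_cross_cross (hν : ν * ν = 1) :
    D.eval S (.comp .cross .cross (add_zero 0) : Diag 𝒜 σ 2 2 0) = LinearMap.id := by
  refine S.ext_vec_vec fun r v hv s w hw => ?_
  rw [eval_comp, D.eval_cross S hv hw, map_smul, D.eval_cross S hw hv, smul_smul,
    koszul_comm s r, mul_mul_mul_comm, hν, koszul_mul_self, _root_.one_mul, one_smul]
  rfl

/-- Both sides reverse `u`, `v`, `w` and collect `ν ^ 3` and one Koszul sign for each of the three
pairs. -/
theorem eval_braid : D.eval S (.comp (.comp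
      (.tensor .cross (.id (rfl : 1 = 1)) (rfl : 2 + 1 = 3) (rfl : 2 + 1 = 3) (add_zero 0))
      (.tensor (.id (rfl : 1 = 1)) .cross (rfl : 1 + 2 = 3) (rfl : 1 + 2 = 3) (zero_add 0))
        (add_zero 0))
      (.tensor .cross (.id (rfl : 1 = 1)) (rfl : 2 + 1 = 3) (rfl : 2 + 1 = 3) (add_zero 0))
        (add_zero 0) : Diag 𝒜 σ 3 3 0) =
    D.eval S (.comp (.comp
      (.tensor (.id (rfl : 1 = 1)) .cross (rfl : 1 + 2 = 3) (rfl : 1 + 2 = 3) (zero_add 0))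
      (.tensor .cross (.id (rfl : 1 = 1)) (rfl : 2 + 1 = 3) (rfl : 2 + 1 = 3) (add_zero 0))
        (add_zero 0))
      (.tensor (.id (rfl : 1 = 1)) .cross (rfl : 1 + 2 = 3) (rfl : 1 + 2 = 3) (zero_add 0))
        (add_zero 0) : Diag 𝒜 σ 3 3 0) := by
  refine S.ext_triple fun p u hu q v hv r w hw => ?_
  rw [eval_comp, eval_comp, eval_comp, eval_comp, D.eval_cross_strand S hu hv, map_smul, D.eval_strand_cross S hv hu hw, map_smul, map_smul,
    D.eval_cross_strand S hv hw, D.eval_strand_cross S hu hv hw, map_smul,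
    D.eval_cross_strand S hu hw, map_smul, map_smul, D.eval_strand_cross S hw hu hv]
  simp only [smul_smul]
  congr 1; ring

/-- The sign `(-1)^{σ p}` in the copairing is there to cancel the sign of moving the cap past the
left-hand vector `b i`; what remains is the expansion in the basis `b`. -/
theorem eval_snake {n : ℕ} {b : Module.Basis (Fin n) k V} {b' : Fin n → V} {p : Fin n → ZMod 2}
    (hp : ∀ i, b i ∈ 𝒱 (p i)) (hb : ∀ i j, Φ (b' i) (b j) = if i = j then 1 else 0)
    (hc : D.copairing = ∑ i, koszul k σ (p i) • (b i ⊗ₜ[k] b' i)) :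
    D.eval S (.comp
      (.tensor .cup (.id (rfl : 1 = 1)) (rfl : 0 + 1 = 1) (rfl : 2 + 1 = 3) (add_zero σ))
      (.tensor (.id (rfl : 1 = 1)) .cap (rfl : 1 + 2 = 3) (rfl : 1 + 0 = 1) (zero_add σ))
      (CharTwo.add_self_eq_zero σ) : Diag 𝒜 σ 1 1 0) = LinearMap.id := by
  refine S.ext_vec fun r v hv => ?_
  rw [eval_comp, D.eval_cup_strand S hc, map_sum]
  simp only [map_smul, D.eval_strand_cap S (hp _), smul_smul, ← mul_assoc, koszul_mul_self,
    _root_.one_mul]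
  simp only [← map_smul, ← map_sum, sum_form_smul_basis hb]
  rfl

theorem eval_snake' (hΦ : Φ.Nondegenerate)
    (hΦσ : ∀ r s : ZMod 2, r + s ≠ σ → ∀ v ∈ 𝒱 r, ∀ w ∈ 𝒱 s, Φ v w = 0)
    {n : ℕ} {b : Module.Basis (Fin n) k V} {b' : Fin n → V} {p : Fin n → ZMod 2}
    (hp : ∀ i, b i ∈ 𝒱 (p i)) (hb : ∀ i j, Φ (b' i) (b j) = if i = j then 1 else 0)
    (hc : D.copairing = ∑ i, koszul k σ (p i) • (b i ⊗ₜ[k] b' i)) :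
    D.eval S (.smul (koszul k σ 1) (.comp
      (.tensor (.id (rfl : 1 = 1)) .cup (rfl : 1 + 0 = 1) (rfl : 1 + 2 = 3) (zero_add σ))
      (.tensor .cap (.id (rfl : 1 = 1)) (rfl : 2 + 1 = 3) (rfl : 0 + 1 = 1) (add_zero σ))
      (CharTwo.add_self_eq_zero σ)) : Diag 𝒜 σ 1 1 0) = LinearMap.id := by
  refine S.ext_vec fun r v hv => ?_
  -- One sign comes from the copairing, the other from moving the cup past `v`. They combine to
  -- `(-1)^{σ (r + p i)}`, and since `Φ v (b i)` vanishes unless `r + p i = σ`, this may be replaced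
  -- by `(-1)^σ`, the sign in the relation.
  have key : ∀ i, (koszul k σ r * (koszul k σ (p i) * Φ v (b i))) = koszul k σ 1 * Φ v (b i) := by
    intro i
    by_cases h : r + p i = σ
    · rw [← mul_assoc, ← koszul_add_right, h, koszul_self]
    · rw [hΦσ r (p i) h v hv _ (hp i)]; simp
  rw [eval_smul, eval_comp, D.eval_strand_cup S hc hv, map_smul,
    map_sum]
  simp only [map_smul, D.eval_cap_strand S, smul_smul, Finset.smul_sum, key]
  simp only [← mul_assoc, koszul_mul_self, _root_.one_mul]
  simp only [← map_smul, ← map_sum, sum_form_smul_dual hΦ hb]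
  rfl

theorem eval_cross_cap
    (hΦν : ∀ r s : ZMod 2, ∀ v ∈ 𝒱 r, ∀ w ∈ 𝒱 s, Φ v w = ν * koszul k r s * Φ w v) :
    D.eval S (.comp .cross .cap (zero_add σ) : Diag 𝒜 σ 2 0 σ) = D.eval S .cap := by
  refine S.ext_vec_vec fun r v hv s w hw => ?_
  rw [eval_comp, D.eval_cross S hv hw, map_smul, D.eval_cap, D.eval_cap,
    smul_smul, ← hΦν r s v hv w hw]

/-- One side carries the signs of `v` past `u` and of the cap past `v`, the other that of `w` past
`v`. They agree because `σ` is the sum of the parities of `u` and `w` wherever `Φ u w` is nonzero.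
-/
theorem eval_slide
    (hΦσ : ∀ r s : ZMod 2, r + s ≠ σ → ∀ v ∈ 𝒱 r, ∀ w ∈ 𝒱 s, Φ v w = 0) :
    D.eval S (.comp
      (.tensor .cross (.id (rfl : 1 = 1)) (rfl : 2 + 1 = 3) (rfl : 2 + 1 = 3) (add_zero 0))
      (.tensor (.id (rfl : 1 = 1)) .cap (rfl : 1 + 2 = 3) (rfl : 1 + 0 = 1) (zero_add σ))
      (zero_add σ) : Diag 𝒜 σ 3 1 σ) =
    D.eval S (.comp
      (.tensor (.id (rfl : 1 = 1)) .cross (rfl : 1 + 2 = 3) (rfl : 1 + 2 = 3) (zero_add 0))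
      (.tensor .cap (.id (rfl : 1 = 1)) (rfl : 2 + 1 = 3) (rfl : 0 + 1 = 1) (add_zero σ))
      (zero_add σ) : Diag 𝒜 σ 3 1 σ) := by
  refine S.ext_triple fun p u hu q v hv r w hw => ?_
  rw [eval_comp, eval_comp, D.eval_cross_strand S hu hv,
    D.eval_strand_cross S hu hv hw, map_smul, map_smul, D.eval_strand_cap S hv,
    D.eval_cap_strand S, smul_smul, smul_smul]
  congr 1
  by_cases h : p + r = σ
  · rw [← h, koszul_add_left, koszul_comm r q]
    linear_combination (ν * koszul k q r * Φ u w) * koszul_mul_self (k := k) p q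
  · rw [hΦσ p r h u hu w hw]; simp

theorem eval_tok_cross (hV : ∀ r s : ZMod 2, ∀ a ∈ 𝒜 r, ∀ v ∈ 𝒱 s, MulOpposite.op a • v ∈ 𝒱 (r + s))
    {r : ZMod 2} {a : A} (ha : a ∈ 𝒜 r) :
    D.eval S (.comp (.tensor (.tok a ha) (.id (rfl : 1 = 1)) (rfl : 1 + 1 = 2) (rfl : 1 + 1 = 2)
      (add_zero r)) .cross (add_zero r) : Diag 𝒜 σ 2 2 r) =
    D.eval S (.comp .cross (.tensor (.id (rfl : 1 = 1)) (.tok a ha) (rfl : 1 + 1 = 2)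
      (rfl : 1 + 1 = 2) (zero_add r)) (zero_add r) : Diag 𝒜 σ 2 2 r) := by
  refine S.ext_vec_vec fun p v hv q w hw => ?_
  rw [eval_comp, eval_comp, eval_tensor_id, D.eval_tok,
    D.eval_cross S (rho_mem hV (inv.map_mem ha) p v hv) hw, D.eval_cross S hv hw, map_smul,
    D.eval_id_tensor S _ _ _ _ _ (S.vec_mem hw), D.eval_tok, smul_smul]
  congr 1
  rw [koszul_add_left]; ring

/-- A token labelled `a` acts through `a⋆`, so this is adjointness for `a⋆` in place of `a`; on the
right, `a⋆⋆ = a` acts. -/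
theorem eval_tok_cap
    (hΦA : ∀ r s : ZMod 2, ∀ a ∈ 𝒜 r, ∀ w ∈ 𝒱 s, ∀ v : V,
      Φ (MulOpposite.op a • v) w = koszul k r s * Φ v (MulOpposite.op (inv.toFun a) • w))
    {r : ZMod 2} {a : A} (ha : a ∈ 𝒜 r) :
    D.eval S (.comp (.tensor (.tok a ha) (.id (rfl : 1 = 1)) (rfl : 1 + 1 = 2) (rfl : 1 + 1 = 2)
      (add_zero r)) .cap rfl : Diag 𝒜 σ 2 0 (r + σ)) =
    D.eval S (.comp (.tensor (.id (rfl : 1 = 1)) (.tok (inv.toFun a) (inv.map_mem ha))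
      (rfl : 1 + 1 = 2) (rfl : 1 + 1 = 2) (zero_add r)) .cap rfl : Diag 𝒜 σ 2 0 (r + σ)) := by
  refine S.ext_vec_vec fun p v hv q w hw => ?_
  have ha' := inv.map_mem ha
  rw [eval_comp, eval_comp, eval_tensor_id, D.eval_tok,
    D.eval_cap, D.eval_id_tensor S _ _ _ _ _ (S.vec_mem hv), D.eval_tok, map_smul, D.eval_cap,
    smul_smul, rho_apply ha' hv, map_smul, LinearMap.smul_apply, hΦA r q _ ha' w hw, smul_eq_mul,
    inv.involutive, rho_apply ha hw, (Φ v).map_smul, smul_eq_mul]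

/-- The map `g'` moves past `f x`, whose parity exceeds that of `x` by that of `f`; the excess
produces the interchange sign. -/
theorem eval_interchange {l m n l' m' n' a b c : ℕ} {r s r' s' rs rs' v w t : ZMod 2}
    (f : Diag 𝒜 σ l m r) (g : Diag 𝒜 σ l' m' s) (f' : Diag 𝒜 σ m n r') (g' : Diag 𝒜 σ m' n' s')
    (ha : l + l' = a) (hb : m + m' = b) (hc : n + n' = c) (h₁ : r + s = rs)
    (h₂ : r' + s' = rs') (h₃ : rs + rs' = t) (h₄ : r + r' = v) (h₅ : s + s' = w)
    (h₆ : v + w = t) :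
    D.eval S (.comp (.tensor f g ha hb h₁) (.tensor f' g' hb hc h₂) h₃) =
      D.eval S (.smul (koszul k r s') (.tensor (.comp f f' h₄) (.comp g g' h₅) ha hc h₆)) := by
  refine S.ext_join ha fun p x hx q y hy => ?_
  rw [eval_comp, eval_smul, D.eval_tensor S f g ha hb h₁ hx,
    map_smul, D.eval_tensor S f' g' hb hc h₂ ((D.eval_mem S f).1 p x hx),
    D.eval_tensor S _ _ ha hc h₆ hx, eval_comp, eval_comp,
    smul_smul, smul_smul, ← h₅]
  congr 1
  rw [koszul_add_left, koszul_add_right, koszul_comm s' r]; ring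

theorem eval_tensor_assoc {m n m' n' m'' n'' a a' b b' c e : ℕ} {r s t rs st v : ZMod 2}
    (f : Diag 𝒜 σ m n r) (g : Diag 𝒜 σ m' n' s) (g' : Diag 𝒜 σ m'' n'' t)
    (ha : m + m' = a) (ha' : n + n' = a') (hb : m' + m'' = b) (hb' : n' + n'' = b')
    (h₁ : a + m'' = c) (h₂ : a' + n'' = e) (h₃ : m + b = c) (h₄ : n + b' = e)
    (h₅ : r + s = rs) (h₆ : rs + t = v) (h₇ : s + t = st) (h₈ : r + st = v) :
    D.eval S (.tensor (.tensor f g ha ha' h₅) g' h₁ h₂ h₆) =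
      D.eval S (.tensor f (.tensor g g' hb hb' h₇) h₃ h₄ h₈) := by
  refine S.ext_join_join ha h₁ fun p x hx q y hy o z hz => ?_
  rw [D.eval_tensor S _ g' h₁ h₂ h₆ (S.join_mem ha hx hy), D.eval_tensor S f g ha ha' h₅ hx,
    S.join_assoc ha h₁ hb h₃, D.eval_tensor S f _ h₃ h₄ h₈ hx, D.eval_tensor S g g' hb hb' h₇ hy,
    map_smul, LinearMap.smul_apply, map_smul, S.join_assoc ha' h₂ hb' h₄, smul_smul, smul_smul,
    ← h₇]
  congr 1
  rw [koszul_add_left, koszul_add_right]; ring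

theorem eval_unit_tensor {m n : ℕ} {r : ZMod 2} (f : Diag 𝒜 σ m n r) :
    D.eval S (.tensor (.id (rfl : 0 = 0)) f (Nat.zero_add m) (Nat.zero_add n) (zero_add r)) =
      D.eval S f := by
  refine LinearMap.ext fun x => ?_
  conv_lhs => rw [← S.unitVec_join (Nat.zero_add m) x]
  rw [D.eval_id_tensor S f _ _ _ _ S.unitVec_mem, koszul_zero_right, one_smul, unitVec_join]

theorem eval_tensor_unit {m n : ℕ} {r : ZMod 2} (f : Diag 𝒜 σ m n r) :
    D.eval S (.tensor f (.id (rfl : 0 = 0)) (Nat.add_zero m) (Nat.add_zero n) (add_zero r)) =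
      D.eval S f := by
  refine LinearMap.ext fun x => ?_
  conv_lhs => rw [← S.join_unitVec (Nat.add_zero m) x]
  rw [eval_tensor_id, join_unitVec]

theorem eval_tensor_id_id {m n a b : ℕ} (ha : m + n = a) (hb : m + n = b) :
    D.eval S (.tensor (.id (rfl : m = m)) (.id (rfl : n = n)) ha hb (add_zero 0) :
      Diag 𝒜 σ a b 0) = D.eval S (.id (ha.symm.trans hb)) := by
  subst ha hb
  refine S.ext_join rfl fun p x hx q y hy => ?_
  rw [eval_tensor_id, eval_id, eval_id]

/-- Evaluation is compatible with the relations between diagrams. -/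
theorem eval_eq (hV : ∀ r s : ZMod 2, ∀ a ∈ 𝒜 r, ∀ v ∈ 𝒱 s, MulOpposite.op a • v ∈ 𝒱 (r + s))
    (hν : ν * ν = 1) (hΦ : Φ.Nondegenerate)
    (hΦσ : ∀ r s : ZMod 2, r + s ≠ σ → ∀ v ∈ 𝒱 r, ∀ w ∈ 𝒱 s, Φ v w = 0)
    (hΦν : ∀ r s : ZMod 2, ∀ v ∈ 𝒱 r, ∀ w ∈ 𝒱 s, Φ v w = ν * koszul k r s * Φ w v)
    (hΦA : ∀ r s : ZMod 2, ∀ a ∈ 𝒜 r, ∀ w ∈ 𝒱 s, ∀ v : V,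
      Φ (MulOpposite.op a • v) w = koszul k r s * Φ v (MulOpposite.op (inv.toFun a) • w))
    {l : ℕ} {b : Module.Basis (Fin l) k V} {b' : Fin l → V} {p : Fin l → ZMod 2}
    (hp : ∀ i, b i ∈ 𝒱 (p i)) (hb : ∀ i j, Φ (b' i) (b j) = if i = j then 1 else 0)
    (hc : D.copairing = ∑ i, koszul k σ (p i) • (b i ⊗ₜ[k] b' i))
    {m n : ℕ} {r : ZMod 2} {f g : Diag 𝒜 σ m n r} (h : DiagRel inv σ none f g) :
    D.eval S f = D.eval S g := by
  induction h with
  | comp_congr_left g h _ ih => rw [eval, eval, ih]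
  | comp_congr_right f h _ ih => rw [eval, eval, ih]
  | tensor_congr_left g ha hb h _ ih => rw [eval, eval, ih]
  | tensor_congr_right f ha hb h _ ih => rw [eval, eval, ih]
  | add_congr_left g _ ih => rw [eval, eval, ih]
  | add_congr_right f _ ih => rw [eval, eval, ih]
  | smul_congr c _ ih => rw [eval, eval, ih]
  | add_assoc f g h => simp only [eval, _root_.add_assoc]
  | add_comm f g => simp only [eval]; rw [_root_.add_comm]
  | zero_add f => simp only [eval, _root_.zero_add]
  | zero_smul f => simp only [eval, _root_.zero_smul]
  | one_smul f => simp only [eval, _root_.one_smul]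
  | mul_smul c c' f => simp only [eval, smul_smul]
  | add_smul c c' f => simp only [eval, _root_.add_smul]
  | smul_add c f g => simp only [eval, _root_.smul_add]
  | comp_add f g g' h => simp only [eval, LinearMap.add_comp]
  | add_comp f f' g h => simp only [eval, LinearMap.comp_add]
  | comp_smul f c g h => simp only [eval, LinearMap.smul_comp]
  | smul_comp c f g h => simp only [eval, LinearMap.comp_smul]
  | tensor_add f g g' ha hb h =>
    simp only [eval, superTensor_add_right, LinearMap.add_comp, LinearMap.comp_add]
  | add_tensor f f' g ha hb h =>
    simp only [eval, superTensor_add_left, LinearMap.add_comp, LinearMap.comp_add]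
  | tensor_smul f c g ha hb h =>
    simp only [eval, superTensor_smul_right, LinearMap.smul_comp, LinearMap.comp_smul]
  | smul_tensor c f g ha hb h =>
    simp only [eval, superTensor_smul_left, LinearMap.smul_comp, LinearMap.comp_smul]
  | id_comp f => rw [eval, eval_id_eq, LinearMap.comp_id]
  | comp_id f => rw [eval, eval_id_eq, LinearMap.id_comp]
  | comp_assoc f g g' h₁ h₂ h₃ h₄ => simp only [eval, LinearMap.comp_assoc]
  | tensor_id ha hb => exact D.eval_tensor_id_id S ha hb
  | interchange => exact D.eval_interchange S _ _ _ _ _ _ _ _ _ _ _ _ _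
  | tensor_assoc => exact D.eval_tensor_assoc S _ _ _ _ _ _ _ _ _ _ _ _ _ _ _
  | unit_tensor f => exact D.eval_unit_tensor S f
  | tensor_unit f => exact D.eval_tensor_unit S f
  | cross_cross => exact (D.eval_cross_cross S hν).trans (D.eval_id_eq S rfl).symm
  | braid => exact D.eval_braid S
  | snake => exact (D.eval_snake S hp hb hc).trans (D.eval_id_eq S rfl).symm
  | snake' => exact (D.eval_id_eq S rfl).trans (D.eval_snake' S hΦ hΦσ hp hb hc).symm
  | cross_cap => exact D.eval_cross_cap S hΦν
  | slide => exact D.eval_slide S hΦσ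
  | tok_one =>
    refine S.ext_vec fun r v _ => ?_
    rw [eval_tok, eval_id, inv.map_one, rho_one]; rfl
  | tok_add ha hb =>
    refine S.ext_vec fun r v _ => ?_
    rw [eval_add, eval_tok, eval_tok, eval_tok, map_add inv.toFun, rho_add,
      LinearMap.add_apply, map_add]
  | tok_smul c ha =>
    refine S.ext_vec fun r v _ => ?_
    rw [eval_smul, eval_tok, eval_tok, map_smul inv.toFun, rho_smul,
      LinearMap.smul_apply, map_smul]
  | tok_mul ha hb =>
    refine S.ext_vec fun r v _ => ?_
    rw [eval_comp, eval_tok, eval_tok, eval_tok, ← rho_comp_rho hV ha hb,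
      LinearMap.comp_apply]
  | tok_cross ha => exact D.eval_tok_cross S hV ha
  | tok_cap ha => exact D.eval_tok_cap S hΦA ha
  | bubble_even _ _ hc => exact (Option.some_ne_none _ hc.symm).elim
  | bubble_odd _ _ hc => exact (Option.some_ne_none _ hc.symm).elim

end GeneratorImages

end EvaluationRelations

/-! ### The superfunctor given by evaluation -/

section EvaluationFunctor

open Supercategory MonoidalSupercategory GSMod TensorPowers

variable {k : Type u} [Field k] {A : Type w} [Ring A] [Algebra k A]
  {𝒜 : ZMod 2 → Submodule k A} [SetLike.GradedMonoid 𝒜] [IsSuperspace 𝒜]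
  {V : Type u} [AddCommGroup V] [Module k V] [FiniteDimensional k V] [Module Aᵐᵒᵖ V]
  [IsScalarTower k Aᵐᵒᵖ V] {𝒱 : ZMod 2 → Submodule k V} [IsSuperspace 𝒱]
  {Φ : LinearMap.BilinForm k V}
  {inv : AntiInvolution 𝒜} {σ : ZMod 2} {ν : k}

theorem Brauer.token_eq_sum (d : Option k) (a : A) :
    (Brauer.token (σ := σ) inv d a : BrauerHom inv σ d 1 1) =
      ∑ r : ZMod 2, BrauerHom.of (Diag.tok (parityProj 𝒜 r a) (parityProj_mem 𝒜 r a)) :=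
  (Finset.univ_sum_single _).symm

namespace GeneratorImages

variable (D : GeneratorImages 𝒱 Φ inv σ ν) (S : TensorPowers (GSMod.std A 𝒱 Φ))
  (hD : ∀ {m n : ℕ} {r : ZMod 2} {f g : Diag 𝒜 σ m n r}, DiagRel inv σ none f g →
    D.eval S f = D.eval S g)

/-- The value of a diagram, as a morphism of supermodules. -/
noncomputable def evalMor {m n : ℕ} (r : ZMod 2) (f : Diag 𝒜 σ m n r) : S.obj m ⟶ S.obj n :=
  ⟨D.eval S f, homOfParity_le _ _ _ (D.eval_mem S f)⟩

/-- Evaluation of diagrammatic morphisms. -/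
noncomputable def evalHom (m n : ℕ) : BrauerHom inv σ none m n →ₗ[k] (S.obj m ⟶ S.obj n) :=
  BrauerHom.lift (D.evalMor S) (fun _ _ _ h => hom_ext (hD h))
    (fun _ f g => hom_ext (LinearMap.ext (D.eval_add S f g)))
    (fun _ c f => hom_ext (LinearMap.ext (D.eval_smul S c f)))

theorem evalHom_of {m n : ℕ} {r : ZMod 2} (f : Diag 𝒜 σ m n r) :
    D.evalHom S hD m n (BrauerHom.of f) = D.evalMor S r f := BrauerHom.lift_of _ _ _ _ f

theorem evalHom_comp {l m n : ℕ} (f : BrauerHom inv σ none l m) (g : BrauerHom inv σ none m n) :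
    D.evalHom S hD l n (BrauerHom.comp f g) = D.evalHom S hD l m f ≫ D.evalHom S hD m n g := by
  induction f using BrauerHom.induction with
  | hadd f f' hf hf' =>
    simp only [map_add, LinearMap.add_apply, hf, hf', Preadditive.add_comp]
  | h r f =>
  induction g using BrauerHom.induction with
  | hadd g g' hg hg' => simp only [map_add, hg, hg', Preadditive.comp_add]
  | h s g =>
  rw [BrauerHom.comp_of f g rfl, evalHom_of, evalHom_of, evalHom_of]
  exact hom_ext (LinearMap.ext (D.eval_comp S f g rfl))

theorem evalHom_tensor {m n m' n' : ℕ} (f : BrauerHom inv σ none m n)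
    (g : BrauerHom inv σ none m' n') :
    tensorHom (k := k) (D.evalHom S hD m n f) (D.evalHom S hD m' n' g) ≫ (S.mul rfl).hom =
      (S.mul rfl).hom ≫ D.evalHom S hD _ _ (BrauerHom.tensor f g) := by
  induction f using BrauerHom.induction with
  | hadd f f' hf hf' =>
    simp only [map_add, LinearMap.add_apply, Preadditive.add_comp, Preadditive.comp_add, hf, hf']
  | h r f =>
  induction g using BrauerHom.induction with
  | hadd g g' hg hg' =>
    simp only [map_add, Preadditive.add_comp, Preadditive.comp_add, hg, hg']
  | h s g =>
  rw [BrauerHom.tensor_of f g rfl, evalHom_of, evalHom_of, evalHom_of]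
  refine hom_ext (super_ext₂ (S.obj m).grading (S.obj m').grading fun p x hx q y hy => ?_)
  have h1 := lin_tensorHom (D.evalMor S r f) (g := D.evalMor S s g) (D.eval_mem S g) hx y
  refine (congrArg (lin (S.mul (rfl : n + n' = n + n')).hom) h1).trans ?_
  exact (map_smul (lin (S.mul (rfl : n + n' = n + n')).hom) _ _).trans
    (D.eval_tensor S f g rfl rfl rfl hx y).symm

/-- The associators and unitors of the diagram category act on products merely by a change of the
exponent equation. Hence the coherence axioms of the evaluation superfunctor are the associativity
and unit laws of the multiplication. -/
theorem evalHom_idOf_join {m n a b : ℕ} (h : a = b) (ha : m + n = a) (hb : m + n = b)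
    (x : (S.obj m).carrier) (y : (S.obj n).carrier) :
    lin (D.evalHom S hD a b (BrauerHom.idOf h)) (S.join ha x y) = S.join hb x y := by
  subst h
  rw [evalHom_of]
  exact D.eval_id S rfl _

/-- The monoidal superfunctor given by evaluation. -/
noncomputable def evalFunctor :
    MonoidalSuperfunctor k (Brauer inv σ none) (GSMod A 𝒱 Φ) where
  obj X := S.obj X.strands
  map {X Y} f := D.evalHom S hD X.strands Y.strands f
  map_id X := (D.evalHom_of S hD _).trans (hom_ext (D.eval_id_eq S rfl))
  map_comp f g := D.evalHom_comp S hD f g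
  map_add {X Y} f g := (D.evalHom S hD X.strands Y.strands).map_add f g
  map_smul {X Y} c f := (D.evalHom S hD X.strands Y.strands).map_smul c f
  map_mem {X Y p f} hf := by
    obtain ⟨f', rfl⟩ := BrauerHom.exists_of hf
    change D.evalHom S hD X.strands Y.strands (BrauerHom.of f') ∈ homPart (k := k) _ _ p
    rw [evalHom_of]
    exact D.eval_mem S f'
  ε := S.one
  μ X Y := S.mul rfl
  ε_mem := S.one_mem
  μ_mem _ _ := S.mul_mem _
  μ_naturality f g := D.evalHom_tensor S hD f g
  associativity X Y Z := by
    refine hom_ext (TensorProduct.ext_threefold fun x y z => ?_)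
    have h1 := lin_tensorHom_id (S.mul (rfl : X.strands + Y.strands = _)).hom (S.obj Z.strands)
      (x ⊗ₜ[k] y) z
    have h2 := lin_tensorHom_even (𝟙 (S.obj X.strands))
      (S.mul_mem (rfl : Y.strands + Z.strands = _)) x (y ⊗ₜ[k] z)
    have h3 := D.evalHom_idOf_join S hD (Nat.add_assoc X.strands Y.strands Z.strands) rfl
      (Nat.add_assoc _ _ _) (S.join rfl x y) z
    refine (congrArg (fun t => lin (D.evalHom S hD _ _ (BrauerHom.idOf (Nat.add_assoc X.strands
      Y.strands Z.strands))) (lin (S.mul rfl).hom t)) h1).trans (h3.trans ?_)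
    refine Eq.trans ?_ (congrArg (lin (S.mul rfl).hom) h2).symm
    exact S.join_assoc _ _ _ _ x y z
  left_unitality X := by
    refine hom_ext (TensorProduct.ext' fun c x => ?_)
    have h1 := lin_tensorHom_id S.one.hom (S.obj X.strands) c x
    have h3 := D.evalHom_idOf_join S hD (Nat.zero_add X.strands) rfl
      (Nat.zero_add _) (lin S.one.hom c) x
    refine Eq.trans ?_ (congrArg (fun t => lin (D.evalHom S hD _ _ (BrauerHom.idOf (Nat.zero_add
      X.strands))) (lin (S.mul rfl).hom t)) h1).symm
    refine Eq.trans ?_ h3.symm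
    have h4 : lin S.one.hom c = c • S.unitVec :=
      (congrArg (lin S.one.hom) (mul_one c).symm).trans (map_smul (lin S.one.hom) c (1 : k))
    rw [h4, map_smul, LinearMap.smul_apply, unitVec_join]
    rfl
  right_unitality X := by
    refine hom_ext (TensorProduct.ext' fun x c => ?_)
    have h1 := lin_tensorHom_even (𝟙 (S.obj X.strands)) S.one_mem x c
    have h3 := D.evalHom_idOf_join S hD (Nat.add_zero X.strands) rfl
      (Nat.add_zero _) x (lin S.one.hom c)
    refine Eq.trans ?_ (congrArg (fun t => lin (D.evalHom S hD _ _ (BrauerHom.idOf (Nat.add_zero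
      X.strands))) (lin (S.mul rfl).hom t)) h1).symm
    refine Eq.trans ?_ h3.symm
    have h4 : lin S.one.hom c = c • S.unitVec :=
      (congrArg (lin S.one.hom) (mul_one c).symm).trans (map_smul (lin S.one.hom) c (1 : k))
    rw [h4, map_smul, join_unitVec]
    rfl

theorem isIncarnation_evalFunctor : IsIncarnation (D.evalFunctor S hD) S.gen.symm ν where
  even := inv_mem_even S.gen_mem
  cross := by
    refine TensorProduct.ext' fun v w => ?_
    -- The constraint on two strands is the multiplication of two degree-one vectors, so the
    -- identification with `V ⊗ V` is `S.square`, by which the crossing was conjugated in its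
    -- evaluation.
    have h1 : crossOn (D.evalFunctor S hD) S.gen.symm (v ⊗ₜ[k] w) = lin S.square.inv
        (lin (D.evalHom S hD 2 2 (BrauerHom.of .cross)) (lin S.square.hom (v ⊗ₜ[k] w))) := rfl
    have h2 : D.eval S (.cross : Diag 𝒜 σ 2 2 0) (lin S.square.hom (v ⊗ₜ[k] w)) =
        lin S.square.hom ((ν • superFlip 𝒱 𝒱) (v ⊗ₜ[k] w)) := by
      rw [eval, LinearMap.comp_apply, LinearMap.comp_apply]
      exact congrArg (fun t => lin S.square.hom ((ν • superFlip 𝒱 𝒱) t)) (lin_inv_hom S.square _)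
    rw [h1, evalHom_of]
    exact (congrArg (lin S.square.inv) h2).trans (lin_inv_hom S.square _)
  cap := by
    refine TensorProduct.ext' fun v w => ?_
    have h1 : capOn (D.evalFunctor S hD) S.gen.symm (v ⊗ₜ[k] w) = lin S.one.inv
        (lin (D.evalHom S hD 2 0 (BrauerHom.of .cap)) (lin S.square.hom (v ⊗ₜ[k] w))) := rfl
    have h2 : D.eval S (.cap : Diag 𝒜 σ 2 0 σ) (lin S.square.hom (v ⊗ₜ[k] w)) =
        lin S.one.hom (TensorProduct.lift Φ (v ⊗ₜ[k] w)) := by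
      rw [eval, LinearMap.comp_apply, LinearMap.comp_apply]
      exact congrArg (fun t => lin S.one.hom (TensorProduct.lift Φ t)) (lin_inv_hom S.square _)
    rw [h1, evalHom_of]
    exact (congrArg (lin S.one.inv) h2).trans (lin_inv_hom S.one _)
  token a := by
    refine LinearMap.ext fun v => ?_
    have h1 : tokenOn (D.evalFunctor S hD) S.gen.symm a v = lin S.gen.inv
        (linL _ _ (D.evalHom S hD 1 1 (Brauer.token inv none a)) (S.vec v)) := rfl
    have h2 : linL _ _ (D.evalHom S hD 1 1 (Brauer.token inv none a)) (S.vec v) =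
        S.vec (rho 𝒜 𝒱 (inv.toFun a) v) := by
      -- Diagrams only carry homogeneous tokens; a general token is the sum of its even and its odd
      -- part, and `ρ` is additive.
      rw [Brauer.token_eq_sum, map_sum, map_sum, LinearMap.sum_apply, sum_zmod_two, evalHom_of,
        evalHom_of]
      conv_rhs => rw [← parityProj_add 𝒜 a, map_add inv.toFun, rho_add, LinearMap.add_apply, map_add]
      exact congrArg₂ (· + ·) (D.eval_tok S _ v) (D.eval_tok S _ v)
    rw [h1, h2]
    exact lin_inv_hom S.gen _

end GeneratorImages

end EvaluationFunctor

/-! ### Equivariance of the generators -/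

section BaseChangeForms

variable {k : Type*} [Field k] {V : Type*} [AddCommGroup V] [Module k V]
  {R : Type*} [CommRing R] [Algebra k R] {Φ : LinearMap.BilinForm k V}

theorem comm_mulR (x y : R ⊗[k] V) :
    (TensorProduct.comm k V V).toLinearMap.baseChange R (mulR R x y) = mulR R y x := by
  induction x with
  | zero => simp [mulR_zero_left, mulR_zero_right]
  | add x x' hx hx' => simp only [mulR_add_left, mulR_add_right, map_add, hx, hx']
  | tmul r v =>
    induction y with
    | zero => simp [mulR_zero_left, mulR_zero_right]
    | add y y' hy hy' => simp only [mulR_add_left, mulR_add_right, map_add, hy, hy']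
    | tmul s w => simp [mulR_tmul, mul_comm]

/-- This relates the two base changes of the form, as a linear map on `V ⊗ V` and as a bilinear
form. The first occurs in equivariance, the second in the definition of the points of the group. -/
theorem rid_lift_mulR (x y : R ⊗[k] V) :
    TensorProduct.AlgebraTensorModule.rid k R R
      ((TensorProduct.lift Φ).baseChange R (mulR R x y)) = Φ.baseChange R x y := by
  induction x with
  | zero => simp [mulR_zero_left]
  | add x x' hx hx' => simp only [mulR_add_left, map_add, hx, hx', LinearMap.add_apply]
  | tmul r v =>
    induction y with
    | zero => simp [mulR_zero_right]
    | add y y' hy hy' => simp only [mulR_add_right, map_add, hy, hy']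
    | tmul s w =>
      rw [mulR_tmul, LinearMap.baseChange_tmul, LinearMap.BilinForm.baseChange_tmul]
      simp

theorem mulR_smul_left (c : R) (x y : R ⊗[k] V) : mulR R (c • x) y = c • mulR R x y := by
  rw [mulR, mulR, ← TensorProduct.smul_tmul', map_smul]

theorem mulR_smul_right (c : R) (x y : R ⊗[k] V) : mulR R x (c • y) = c • mulR R x y := by
  simp [mulR]

theorem mulR_sum_left {ι : Type*} (s : Finset ι) (x : ι → R ⊗[k] V) (y : R ⊗[k] V) :
    mulR R (∑ i ∈ s, x i) y = ∑ i ∈ s, mulR R (x i) y := by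
  simp [mulR, TensorProduct.sum_tmul]

theorem mulR_sum_right {ι : Type*} (s : Finset ι) (x : R ⊗[k] V) (y : ι → R ⊗[k] V) :
    mulR R x (∑ i ∈ s, y i) = ∑ i ∈ s, mulR R x (y i) := by
  simp [mulR, TensorProduct.tmul_sum]

variable [FiniteDimensional k V] {n : ℕ} {b : Module.Basis (Fin n) k V} {b' : Fin n → V}

theorem sum_baseChange_smul_basis (hb : ∀ i j, Φ (b' i) (b j) = if i = j then 1 else 0)
    (x : R ⊗[k] V) :
    ∑ j, Φ.baseChange R (1 ⊗ₜ[k] b' j) x • ((1 : R) ⊗ₜ[k] b j) = x := by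
  induction x with
  | zero => simp
  | add x y hx hy =>
    simp only [map_add, add_smul, Finset.sum_add_distrib, hx, hy]
  | tmul r v =>
    conv_rhs => rw [← sum_form_smul_basis hb v, TensorProduct.tmul_sum]
    refine Finset.sum_congr rfl fun j _ => ?_
    rw [LinearMap.BilinForm.baseChange_tmul, TensorProduct.tmul_smul, TensorProduct.smul_tmul',
      TensorProduct.smul_tmul']
    simp

theorem sum_baseChange_smul_dual (hΦ : Φ.Nondegenerate)
    (hb : ∀ i j, Φ (b' i) (b j) = if i = j then 1 else 0) (x : R ⊗[k] V) :
    ∑ j, Φ.baseChange R x (1 ⊗ₜ[k] b j) • ((1 : R) ⊗ₜ[k] b' j) = x := by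
  induction x with
  | zero => simp
  | add x y hx hy =>
    simp only [map_add, LinearMap.add_apply, add_smul, Finset.sum_add_distrib, hx, hy]
  | tmul r v =>
    conv_rhs => rw [← sum_form_smul_dual hΦ hb v, TensorProduct.tmul_sum]
    refine Finset.sum_congr rfl fun j _ => ?_
    rw [LinearMap.BilinForm.baseChange_tmul, TensorProduct.tmul_smul, TensorProduct.smul_tmul',
      TensorProduct.smul_tmul']
    simp

/-- The canonical element of a form is preserved by isometries. -/
theorem sum_mulR_isometry (hΦ : Φ.Nondegenerate)
    (hb : ∀ i j, Φ (b' i) (b j) = if i = j then 1 else 0) (g : (R ⊗[k] V) ≃ₗ[R] (R ⊗[k] V))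
    (hg : ∀ x y, Φ.baseChange R (g x) (g y) = Φ.baseChange R x y) :
    ∑ i, mulR R (g (1 ⊗ₜ[k] b i)) (g (1 ⊗ₜ[k] b' i)) =
      ∑ i, mulR R ((1 : R) ⊗ₜ[k] b i) (1 ⊗ₜ[k] b' i) := by
  -- An isometry carries dual bases to dual bases; this is the expansion in the transformed ones.
  have key : ∀ x, ∑ i, Φ.baseChange R (g (1 ⊗ₜ[k] b' i)) x • g (1 ⊗ₜ[k] b i) = x := by
    intro x
    obtain ⟨y, rfl⟩ := g.surjective x
    simp only [hg]
    conv_rhs => rw [← sum_baseChange_smul_basis hb y, map_sum]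
    simp only [map_smul]
  -- Expand `g b'_i` in the old dual basis, move the coefficients to the left factor and sum over
  -- `i` first: the left factors add up to `b_j`.
  calc ∑ i, mulR R (g (1 ⊗ₜ[k] b i)) (g (1 ⊗ₜ[k] b' i))
      = ∑ i, ∑ j, mulR R (Φ.baseChange R (g (1 ⊗ₜ[k] b' i)) (1 ⊗ₜ[k] b j) • g (1 ⊗ₜ[k] b i))
          (1 ⊗ₜ[k] b' j) := by
        refine Finset.sum_congr rfl fun i _ => ?_
        conv_lhs => rw [← sum_baseChange_smul_dual hΦ hb (g (1 ⊗ₜ[k] b' i)), mulR_sum_right]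
        simp only [mulR_smul_left, mulR_smul_right]
    _ = _ := by
        rw [Finset.sum_comm]
        refine Finset.sum_congr rfl fun j _ => ?_
        rw [← mulR_sum_left, key]

end BaseChangeForms

/-! ### Flip, form, tokens and copairing as morphisms of supermodules -/

section GeneratorsEquivariant

open GSMod

variable {k : Type u} [Field k] {A : Type w} [Ring A] [Algebra k A]
  {𝒜 : ZMod 2 → Submodule k A} [IsSuperspace 𝒜]
  {V : Type u} [AddCommGroup V] [Module k V] [FiniteDimensional k V] [Module Aᵐᵒᵖ V]
  [IsScalarTower k Aᵐᵒᵖ V] {𝒱 : ZMod 2 → Submodule k V} [IsSuperspace 𝒱]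
  {Φ : LinearMap.BilinForm k V}

theorem superFlip_mulR {R : Type*} [CommRing R] [Algebra k R] (x y : R ⊗[k] V) :
    (superFlip 𝒱 𝒱).baseChange R (mulR R x y) = ∑ r : ZMod 2, ∑ s : ZMod 2, koszul k r s •
      mulR R ((parityProj 𝒱 s).baseChange R y) ((parityProj 𝒱 r).baseChange R x) := by
  simp only [superFlip, sum_zmod_two, LinearMap.baseChange_add, LinearMap.add_apply,
    LinearMap.baseChange_smul, LinearMap.smul_apply, LinearMap.baseChange_comp,
    LinearMap.comp_apply, baseChange_map_mulR, comm_mulR]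

/-- Points of the group are even, so they commute with the parity projections out of which the flip
is built. For `X` in the Lie superalgebra the two summands of its action are exchanged, and the sign
of moving `X` past a vector matches the change in the Koszul sign of the flip. -/
theorem superFlip_mem : superFlip 𝒱 𝒱 ∈
    homOfParity (tensor (GSMod.std A 𝒱 Φ) (GSMod.std A 𝒱 Φ))
      (tensor (GSMod.std A 𝒱 Φ) (GSMod.std A 𝒱 Φ)) 0 := by
  refine ⟨homParity_tensor fun r v hv s w hw => ?_, fun R _ _ g z => ?_, fun r X z => ?_⟩
  · change superFlip 𝒱 𝒱 (v ⊗ₜ[k] w) ∈ _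
    rw [superFlip_tmul hv hw, add_zero, add_comm]
    exact Submodule.smul_mem _ _ (tmul_mem_tensorGrading hw hv)
  · refine mulR_induction (P := fun z => (superFlip 𝒱 𝒱).baseChange R
      ((tensor (GSMod.std A 𝒱 Φ) (GSMod.std A 𝒱 Φ)).grp R g z) =
        (tensor (GSMod.std A 𝒱 Φ) (GSMod.std A 𝒱 Φ)).grp R g ((superFlip 𝒱 𝒱).baseChange R z))
      (fun x y hx hy => by simp only [map_add, hx, hy]) (fun x y => ?_) z
    have h1 : ∀ r x, (parityProj 𝒱 r).baseChange R ((GSMod.std A 𝒱 Φ).grp R g x) =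
        (GSMod.std A 𝒱 Φ).grp R g ((parityProj 𝒱 r).baseChange R x) := fun r x =>
      ((GSMod.std A 𝒱 Φ).grp_even R g r x).symm
    rw [tensor_grp]
    refine (superFlip_mulR _ _).trans ?_
    rw [superFlip_mulR]
    have h2 : ∀ (c : k) (z : R ⊗[k] (V ⊗[k] V)),
        (tensor (GSMod.std A 𝒱 Φ) (GSMod.std A 𝒱 Φ)).grp R g (c • z) =
          c • (tensor (GSMod.std A 𝒱 Φ) (GSMod.std A 𝒱 Φ)).grp R g z := fun c z => by
      rw [← algebraMap_smul R c z, map_smul, algebraMap_smul]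
    have h3 := tensor_grp (GSMod.std A 𝒱 Φ) (GSMod.std A 𝒱 Φ) R g
    generalize (tensor (GSMod.std A 𝒱 Φ) (GSMod.std A 𝒱 Φ)).grp R g = T at h2 h3 ⊢
    generalize (GSMod.std A 𝒱 Φ).grp R g = G at h1 h3 ⊢
    simp only [sum_zmod_two, map_add, h2, h3, h1]
  · rw [koszul_zero_right, one_smul]
    refine LinearMap.congr_fun (f := superFlip 𝒱 𝒱 ∘ₗ
        (tensor (GSMod.std A 𝒱 Φ) (GSMod.std A 𝒱 Φ)).lie r X)
      (g := (tensor (GSMod.std A 𝒱 Φ) (GSMod.std A 𝒱 Φ)).lie r X ∘ₗ superFlip 𝒱 𝒱)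
      (super_ext₂ 𝒱 𝒱 fun p v hv q w hw => ?_) z
    have hXv := X.2.1 p v hv
    have hXw := X.2.1 q w hw
    have h1 := tensor_lie (GSMod.std A 𝒱 Φ) (GSMod.std A 𝒱 Φ) r X hv w
    have h2 := tensor_lie (GSMod.std A 𝒱 Φ) (GSMod.std A 𝒱 Φ) r X hw v
    rw [LinearMap.comp_apply, LinearMap.comp_apply, superFlip_tmul hv hw, map_smul, h1, h2,
      map_add, map_smul]
    refine (congrArg₂ (fun a b => a + koszul k r p • b) (superFlip_tmul hXv hw)
      (superFlip_tmul hv hXw)).trans ?_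
    rw [smul_add, smul_smul, smul_smul, add_comm, koszul_add_left, koszul_add_right]
    congr 2
    linear_combination (koszul k p q) * koszul_mul_self (k := k) r p +
      (koszul k p q * koszul k r p) * (koszul_comm (k := k) p r)

/-- Invariance under the group is the isometry condition and invariance under the Lie superalgebra
its infinitesimal form; both act trivially on `k`. -/
theorem lift_mem {σ : ZMod 2}
    (hΦσ : ∀ r s : ZMod 2, r + s ≠ σ → ∀ v ∈ 𝒱 r, ∀ w ∈ 𝒱 s, Φ v w = 0) :
    TensorProduct.lift Φ ∈
      homOfParity (tensor (GSMod.std A 𝒱 Φ) (GSMod.std A 𝒱 Φ)) (triv A 𝒱 Φ) σ := by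
  refine ⟨lift_form_mem hΦσ, fun R _ _ g z => ?_, fun r X z => ?_⟩
  · refine mulR_induction (P := fun z => (TensorProduct.lift Φ).baseChange R
      ((tensor (GSMod.std A 𝒱 Φ) (GSMod.std A 𝒱 Φ)).grp R g z) =
        (TensorProduct.lift Φ).baseChange R z)
      (fun x y hx hy => by simp only [map_add, hx, hy]) (fun x y => ?_) z
    apply (TensorProduct.AlgebraTensorModule.rid k R R).injective
    rw [tensor_grp]
    exact (rid_lift_mulR _ _).trans ((g.2.2.2 x y).trans (rid_lift_mulR x y).symm)
  · refine Eq.trans ?_ (smul_zero _).symm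
    refine LinearMap.congr_fun (f := TensorProduct.lift Φ ∘ₗ
        (tensor (GSMod.std A 𝒱 Φ) (GSMod.std A 𝒱 Φ)).lie r X) (g := 0)
      (super_ext₂ 𝒱 𝒱 fun p v hv q w hw => ?_) z
    have h1 := tensor_lie (GSMod.std A 𝒱 Φ) (GSMod.std A 𝒱 Φ) r X hv w
    rw [LinearMap.comp_apply, h1, map_add, map_smul, TensorProduct.lift.tmul,
      TensorProduct.lift.tmul]
    change Φ (X.1 v) w + koszul k r p * Φ v (X.1 w) = 0
    rw [X.2.2.2 p v hv w, neg_add_cancel]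

/-- Points and Lie superalgebra elements are `A`-linear by definition. The sign operator inside
`ρ_a` commutes with points, which are even, and contributes `(-1)^{X̄ ā}` for `X`. -/
theorem rho_mem_homOfParity
    (hV : ∀ r s : ZMod 2, ∀ a ∈ 𝒜 r, ∀ v ∈ 𝒱 s, MulOpposite.op a • v ∈ 𝒱 (r + s))
    {r : ZMod 2} {a : A} (ha : a ∈ 𝒜 r) :
    rho 𝒜 𝒱 a ∈ homOfParity (GSMod.std A 𝒱 Φ) (GSMod.std A 𝒱 Φ) r := by
  refine ⟨rho_mem hV ha, fun R _ _ g z => ?_, fun s X z => ?_⟩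
  · have h1 : ∀ x, (rho 𝒜 𝒱 a).baseChange R x =
        (rightMul k V a).baseChange R ((signMap 𝒱 r).baseChange R x) := fun x => by
      rw [rho_eq ha, LinearMap.baseChange_comp, LinearMap.comp_apply]
    refine (h1 _).trans (Eq.trans ?_ (congrArg ((GSMod.std A 𝒱 Φ).grp R g) (h1 z)).symm)
    refine (congrArg ((rightMul k V a).baseChange R)
      (grp_sign (GSMod.std A 𝒱 Φ) R g r z)).trans ?_
    exact (g.2.2.1 a _).symm
  · refine LinearMap.congr_fun (f := rho 𝒜 𝒱 a ∘ₗ X.1) (g := koszul k s r • (X.1 ∘ₗ rho 𝒜 𝒱 a))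
      (super_ext 𝒱 fun p v hv => ?_) z
    have h1 : X.1 (MulOpposite.op a • v) = MulOpposite.op a • X.1 v := X.2.2.1 a v
    rw [LinearMap.smul_apply, LinearMap.comp_apply, LinearMap.comp_apply,
      rho_apply ha (X.2.1 p v hv), rho_apply ha hv, X.1.map_smul, h1]
    generalize MulOpposite.op a • X.1 v = y
    rw [smul_smul, koszul_add_right, koszul_comm r s, mul_comm]

/-- The copairing is inverse to `Φ`, so it inherits invariance from `Φ`. For the group this reduces
to `sum_mulR_isometry`, for the Lie superalgebra to the analogous exchange of summations, now with
signs. -/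
theorem copairing_mem {σ : ZMod 2} (hΦ : Φ.Nondegenerate)
    (hΦσ : ∀ r s : ZMod 2, r + s ≠ σ → ∀ v ∈ 𝒱 r, ∀ w ∈ 𝒱 s, Φ v w = 0)
    {n : ℕ} {b : Module.Basis (Fin n) k V} {b' : Fin n → V} {p : Fin n → ZMod 2}
    (hp : ∀ i, b i ∈ 𝒱 (p i)) (hb : ∀ i j, Φ (b' i) (b j) = if i = j then 1 else 0) :
    LinearMap.toSpanSingleton k (V ⊗[k] V) (∑ i, koszul k σ (p i) • (b i ⊗ₜ[k] b' i)) ∈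
      homOfParity (triv A 𝒱 Φ) (tensor (GSMod.std A 𝒱 Φ) (GSMod.std A 𝒱 Φ)) σ := by
  have hb' := dual_mem hΦ hΦσ hb hp
  refine ⟨fun r c hc => ?_, fun R _ _ g z => ?_, fun r X c => ?_⟩
  · obtain rfl | rfl := zmod_two_cases r
    · rw [LinearMap.toSpanSingleton_apply, zero_add]
      refine Submodule.smul_mem _ _ (sum_mem fun i _ => Submodule.smul_mem _ _ ?_)
      have := tmul_mem_tensorGrading (hp i) (hb' i)
      rwa [← add_assoc, CharTwo.add_self_eq_zero, zero_add] at this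
    · have h0 : c = 0 := by simpa [unitGrading] using hc
      rw [h0, map_zero]
      exact zero_mem _
  · have h1 : (1 : R) ⊗ₜ[k] (∑ i, koszul k σ (p i) • (b i ⊗ₜ[k] b' i)) =
        (TensorProduct.map (signMap 𝒱 σ) LinearMap.id).baseChange R
          (∑ i, mulR R ((1 : R) ⊗ₜ[k] b i) (1 ⊗ₜ[k] b' i)) := by
      rw [map_sum, TensorProduct.tmul_sum]
      refine Finset.sum_congr rfl fun i _ => ?_
      rw [mulR_tmul, LinearMap.baseChange_tmul, TensorProduct.map_tmul, signMap_apply σ (hp i),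
        TensorProduct.smul_tmul', mul_one, LinearMap.id_apply]
    have h2 : ∀ z, (tensor (GSMod.std A 𝒱 Φ) (GSMod.std A 𝒱 Φ)).grp R g
        ((TensorProduct.map (signMap 𝒱 σ) LinearMap.id).baseChange R z) =
          (TensorProduct.map (signMap 𝒱 σ) LinearMap.id).baseChange R
            ((tensor (GSMod.std A 𝒱 Φ) (GSMod.std A 𝒱 Φ)).grp R g z) := by
      refine mulR_induction (fun x y hx hy => by simp only [map_add, hx, hy]) fun x y => ?_
      rw [baseChange_map_mulR, tensor_grp, tensor_grp, ← grp_sign]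
      refine Eq.trans ?_ (baseChange_map_mulR _ _ _ _).symm
      simp only [LinearMap.baseChange_id, LinearMap.id_apply]
    have h3 : (tensor (GSMod.std A 𝒱 Φ) (GSMod.std A 𝒱 Φ)).grp R g
        ((1 : R) ⊗ₜ[k] (∑ i, koszul k σ (p i) • (b i ⊗ₜ[k] b' i))) =
          (1 : R) ⊗ₜ[k] (∑ i, koszul k σ (p i) • (b i ⊗ₜ[k] b' i)) := by
      rw [h1, h2, map_sum]
      congr 1
      refine Eq.trans (Finset.sum_congr rfl fun i _ => tensor_grp _ _ R g _ _) ?_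
      exact sum_mulR_isometry hΦ hb g.1 g.2.2.2
    induction z with
    | zero => simp
    | add x y hx hy => simp only [map_add, hx, hy]
    | tmul r c =>
      have h4 : (LinearMap.toSpanSingleton k (V ⊗[k] V)
          (∑ i, koszul k σ (p i) • (b i ⊗ₜ[k] b' i))).baseChange R (r ⊗ₜ[k] c) =
          (r * algebraMap k R c) • ((1 : R) ⊗ₜ[k] (∑ i, koszul k σ (p i) • (b i ⊗ₜ[k] b' i))) := by
        rw [LinearMap.baseChange_tmul, LinearMap.toSpanSingleton_apply, TensorProduct.tmul_smul,
          TensorProduct.smul_tmul', TensorProduct.smul_tmul', Algebra.smul_def, smul_eq_mul,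
          mul_one, mul_comm]
      refine h4.trans ?_
      refine Eq.trans ?_ (congrArg _ h4).symm
      rw [map_smul, h3]
  · have h1 : (tensor (GSMod.std A 𝒱 Φ) (GSMod.std A 𝒱 Φ)).lie r X
        (∑ i, koszul k σ (p i) • (b i ⊗ₜ[k] b' i)) = 0 := by
      -- The expansion of `X b'_i` in the dual basis, with skewness moving `X` onto `b_j`.
      have h2 : ∀ i, X.1 (b' i) = ∑ j, -(koszul k r (p i + σ) * Φ (b' i) (X.1 (b j))) • b' j := by
        intro i
        conv_lhs => rw [← sum_form_smul_dual hΦ hb (X.1 (b' i))]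
        refine Finset.sum_congr rfl fun j _ => ?_
        rw [X.2.2.2 _ _ (hb' i)]
      -- The sum over `i` is the expansion of `X b_j` in the basis with the sign operator applied;
      -- as `X b_j` is homogeneous of parity `p j + r`, the signs become one global sign.
      have h3 : ∀ j, ∑ i, (koszul k σ (p i) * Φ (b' i) (X.1 (b j))) • b i =
          koszul k σ (p j + r) • X.1 (b j) := by
        intro j
        conv_rhs => rw [← signMap_apply σ (X.2.1 _ _ (hp j)), ← sum_form_smul_basis hb (X.1 (b j)),
          map_sum]
        refine Finset.sum_congr rfl fun i _ => ?_
        rw [map_smul, signMap_apply σ (hp i), smul_smul, mul_comm]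
      have h4 : ∀ i, (tensor (GSMod.std A 𝒱 Φ) (GSMod.std A 𝒱 Φ)).lie r X (b i ⊗ₜ[k] b' i) =
          X.1 (b i) ⊗ₜ[k] b' i + koszul k r (p i) • (b i ⊗ₜ[k] X.1 (b' i)) := fun i =>
        tensor_lie (GSMod.std A 𝒱 Φ) (GSMod.std A 𝒱 Φ) r X (hp i) (b' i)
      -- After exchanging the sums, the terms in which `X` acts on the right factor become, by `h3`,
      -- the negatives of those in which it acts on the left.
      have h5 : ∑ i, koszul k σ (p i) • koszul k r (p i) • (b i ⊗ₜ[k] X.1 (b' i)) =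
          ∑ j, -(koszul k r σ • (∑ i, (koszul k σ (p i) * Φ (b' i) (X.1 (b j))) • b i) ⊗ₜ[k] b' j) := by
        simp only [h2, TensorProduct.tmul_sum, TensorProduct.sum_tmul, Finset.smul_sum,
          ← Finset.sum_neg_distrib]
        rw [Finset.sum_comm]
        refine Finset.sum_congr rfl fun j _ => Finset.sum_congr rfl fun i _ => ?_
        rw [TensorProduct.tmul_smul, ← TensorProduct.smul_tmul', smul_smul, smul_smul, smul_smul,
          ← neg_smul, koszul_add_right]
        congr 1
        linear_combination (-(koszul k σ (p i) * koszul k r σ * Φ (b' i) (X.1 (b j)))) *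
          koszul_mul_self (k := k) r (p i)
      rw [map_sum]
      simp only [map_smul, h4, smul_add, Finset.sum_add_distrib]
      rw [h5, ← Finset.sum_add_distrib]
      refine Finset.sum_eq_zero fun j _ => ?_
      rw [h3, ← TensorProduct.smul_tmul', smul_smul, koszul_add_right, koszul_comm r σ,
        mul_comm (koszul k σ (p j)), ← mul_assoc, koszul_mul_self, one_mul, add_neg_cancel]
    refine (map_zero (LinearMap.toSpanSingleton k (V ⊗[k] V) _)).trans ?_
    rw [LinearMap.toSpanSingleton_apply]
    refine ((congrArg (koszul k r σ • ·) ((map_smul _ c _).trans (congrArg (c • ·) h1))).trans ?_).symm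
    simp

end GeneratorsEquivariant

/-! ### Existence of the incarnation superfunctor -/

section Existence

variable {k : Type u} [Field k] {A : Type w} [Ring A] [Algebra k A]
  {𝒜 : ZMod 2 → Submodule k A} [SetLike.GradedMonoid 𝒜] [IsSuperspace 𝒜]
  {V : Type u} [AddCommGroup V] [Module k V] [FiniteDimensional k V] [Module Aᵐᵒᵖ V]
  [IsScalarTower k Aᵐᵒᵖ V] {𝒱 : ZMod 2 → Submodule k V} [IsSuperspace 𝒱]
  {Φ : LinearMap.BilinForm k V}
  {inv : AntiInvolution 𝒜} {σ : ZMod 2} {ν : k}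

/-- The images of the generators for a nondegenerate form with given dual bases. -/
noncomputable def GeneratorImages.ofDualBases (inv : AntiInvolution 𝒜) (ν : k)
    (hV : ∀ r s : ZMod 2, ∀ a ∈ 𝒜 r, ∀ v ∈ 𝒱 s, MulOpposite.op a • v ∈ 𝒱 (r + s))
    (hΦ : Φ.Nondegenerate)
    (hΦσ : ∀ r s : ZMod 2, r + s ≠ σ → ∀ v ∈ 𝒱 r, ∀ w ∈ 𝒱 s, Φ v w = 0)
    {n : ℕ} {b : Module.Basis (Fin n) k V} {b' : Fin n → V} {p : Fin n → ZMod 2}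
    (hp : ∀ i, b i ∈ 𝒱 (p i)) (hb : ∀ i j, Φ (b' i) (b j) = if i = j then 1 else 0) :
    GeneratorImages 𝒱 Φ inv σ ν where
  copairing := ∑ i, koszul k σ (p i) • (b i ⊗ₜ[k] b' i)
  cross_mem := Submodule.smul_mem _ ν superFlip_mem
  cap_mem := lift_mem hΦσ
  cup_mem := copairing_mem hΦ hΦσ hp hb
  tok_mem ha := rho_mem_homOfParity hV (inv.map_mem ha)

/-- Any homogeneous basis with its dual may be used to define the copairing. With the standard
tensor powers the generating object is sent to `V` by definition, so the required equality of
objects is reflexivity and induces the identity isomorphism. -/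
theorem exists_isIncarnation
    (hV : ∀ r s : ZMod 2, ∀ a ∈ 𝒜 r, ∀ v ∈ 𝒱 s, MulOpposite.op a • v ∈ 𝒱 (r + s))
    (hν : ν * ν = 1) (hΦ : Φ.Nondegenerate)
    (hΦσ : ∀ r s : ZMod 2, r + s ≠ σ → ∀ v ∈ 𝒱 r, ∀ w ∈ 𝒱 s, Φ v w = 0)
    (hΦν : ∀ r s : ZMod 2, ∀ v ∈ 𝒱 r, ∀ w ∈ 𝒱 s, Φ v w = ν * koszul k r s * Φ w v)
    (hΦA : ∀ r s : ZMod 2, ∀ a ∈ 𝒜 r, ∀ w ∈ 𝒱 s, ∀ v : V,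
      Φ (MulOpposite.op a • v) w = koszul k r s * Φ v (MulOpposite.op (inv.toFun a) • w)) :
    ∃ (F : MonoidalSuperfunctor k (Brauer inv σ none) (GSMod A 𝒱 Φ))
      (h : F.obj (Brauer.go inv σ none) = GSMod.std A 𝒱 Φ), IsIncarnation F (eqToIso h) ν := by
  obtain ⟨n, b, p, b', hp, hb⟩ := exists_dual_bases 𝒱 hΦ
  let D := GeneratorImages.ofDualBases inv ν hV hΦ hΦσ hp hb
  let S := TensorPowers.std (GSMod.std A 𝒱 Φ)
  have hD : ∀ {m n : ℕ} {r : ZMod 2} {f g : Diag 𝒜 σ m n r}, DiagRel inv σ none f g →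
      D.eval S f = D.eval S g := D.eval_eq S hV hν hΦ hΦσ hΦν hΦA hp hb rfl
  exact ⟨D.evalFunctor S hD, rfl, D.isIncarnation_evalFunctor S hD⟩

end Existence

theorem mainTheorem12 {k : Type u} [Field k] {A : Type w} [Ring A] [Algebra k A]
    (𝒜 : ZMod 2 → Submodule k A) [SetLike.GradedMonoid 𝒜] [IsSuperspace 𝒜]
    (inv : AntiInvolution 𝒜)
    {V : Type u} [AddCommGroup V] [Module k V] [FiniteDimensional k V] [Module Aᵐᵒᵖ V]
    [IsScalarTower k Aᵐᵒᵖ V] (𝒱 : ZMod 2 → Submodule k V) [IsSuperspace 𝒱]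
    (hV : ∀ r s : ZMod 2, ∀ a ∈ 𝒜 r, ∀ v ∈ 𝒱 s, MulOpposite.op a • v ∈ 𝒱 (r + s))
    (ν : k) (hν : ν = 1 ∨ ν = -1) (σ : ZMod 2)
    (Φ : LinearMap.BilinForm k V)
    (hΦσ : ∀ r s : ZMod 2, r + s ≠ σ → ∀ v ∈ 𝒱 r, ∀ w ∈ 𝒱 s, Φ v w = 0)
    (hΦν : ∀ r s : ZMod 2, ∀ v ∈ 𝒱 r, ∀ w ∈ 𝒱 s, Φ v w = ν * koszul k r s * Φ w v)
    (hΦA : ∀ r s : ZMod 2, ∀ a ∈ 𝒜 r, ∀ w ∈ 𝒱 s, ∀ v : V,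
      Φ (MulOpposite.op a • v) w = koszul k r s * Φ v (MulOpposite.op (inv.toFun a) • w))
    (hΦ : Φ.Nondegenerate) :
    -- existence
    (∃ (F : MonoidalSuperfunctor k (Brauer inv σ none) (GSMod A 𝒱 Φ))
      (h : F.obj (Brauer.go inv σ none) = GSMod.std A 𝒱 Φ), IsIncarnation F (eqToIso h) ν) ∧
    -- uniqueness
    (∀ (F F' : MonoidalSuperfunctor k (Brauer inv σ none) (GSMod A 𝒱 Φ))
      (e : F.obj (Brauer.go inv σ none) ≅ GSMod.std A 𝒱 Φ)
      (e' : F'.obj (Brauer.go inv σ none) ≅ GSMod.std A 𝒱 Φ),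
      IsIncarnation F e ν → IsIncarnation F' e' ν →
        ∃! η : MonoidalSuperNatIso F F', (η.app (Brauer.go inv σ none)).hom ≫ e'.hom = e.hom) ∧
    -- further properties
    (∀ (F : MonoidalSuperfunctor k (Brauer inv σ none) (GSMod A 𝒱 Φ))
      (e : F.obj (Brauer.go inv σ none) ≅ GSMod.std A 𝒱 Φ), IsIncarnation F e ν →
      -- the image of the cup
      (∀ (n : ℕ) (b : Module.Basis (Fin n) k V) (p : Fin n → ZMod 2) (b' : Fin n → V),
        (∀ i, b i ∈ 𝒱 (p i)) → (∀ i j, Φ (b' i) (b j) = if i = j then 1 else 0) →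
          cupOn F e 1 = ∑ i, koszul k σ (p i) • (b i ⊗ₜ[k] b' i)) ∧
      -- the images of the bubbles
      (∀ a : A, F.map (Brauer.bubble inv σ none a) =
        (ν * supertrace 𝒱 a) • 𝟙 (F.obj (MonoidalSupercategory.unit k))) ∧
      -- specialization
      (∀ (m n : ℕ) (φ : V ≃ₗ[Aᵐᵒᵖ] (Fin m ⊕ Fin n → A)),
        (∀ (r : ZMod 2) (v : V), v ∈ 𝒱 r ↔ φ v ∈ freeGrading 𝒜 m n r) →
          ∃! F' : MonoidalSuperfunctor k (Brauer inv σ (some (ν * ((m : k) - n)))) (GSMod A 𝒱 Φ),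
            (Brauer.quotFunctor inv σ (ν * ((m : k) - n))).comp F' = F)) := by
  have hν' : ν * ν = 1 := by obtain rfl | rfl := hν <;> simp
  refine ⟨exists_isIncarnation hV hν' hΦ hΦσ hΦν hΦA,
    fun F F' e e' h h' => h.existsUnique_natIso h' hΦ hΦσ, fun F e h => ⟨?_, ?_, ?_⟩⟩
  · exact fun n b p b' hp hb => h.cupOn_eq hΦ hΦσ hp hb
  · exact fun a => h.map_bubble hΦ hV hΦσ hΦν hΦA a
  · exact fun m n φ hφ =>
      Brauer.existsUnique_descend (h.respectsBubbles hΦ hV hΦσ hΦν hΦA φ hφ)
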